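/- Let $0<\alpha\le 1$, $n\in\mathbb{N}$, and let $\mu_j>0$, $0<\gamma_j\le 2$, $|\theta_j|\le\min(\gamma_j,2-\gamma_j)$ for $j=1,\dots,n$. Write $$f^{*}(k)=\frac1{\sqrt{2\pi}}\int_{\mathbb R}e^{ikx}f(x)\,dx,\qquad \Psi_{\theta}^{\gamma}(k)=|k|^{\gamma}e^{i\,\mathrm{sign}(k)\theta\pi/2},\qquad b(k)=\sum_{j=1}^n\mu_j\Psi_{\theta_j}^{\gamma_j}(k),\qquad E_{\alpha,\alpha}(z)=\sum_{m\ge0}\frac{z^m}{\Gamma(\alpha m+\alpha)} .$$ Let ${}_xD_{\theta}^{\gamma}$ be the Riesz--Feller derivative, $({}_xD_{\theta}^{\gamma}f)^{*}=-\Psi_{\theta}^{\gamma}f^{*}$, and let ${}_0D_t^{\nu}$ be the Riemann--Liouville derivative: ${}_0D_t^{-\nu}={}_0I_t^{\nu}$ is the fractional integral for $\nu\ge0$ (with ${}_0I_t^0=\mathrm{id}$), and ${}_0D_t^{\alpha}=\frac{d^m}{dt^m}\,{}_0I_t^{m-\alpha}$ with $m=\lfloor\alpha\rfloor+1$ for $\alpha>0$.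 Let $\phi$ be such that $t\mapsto\phi(\cdot,t)$ is a continuous map from $(0,\infty)$ to $L^1(\mathbb R)$ with $\int_0^T\|\phi(\cdot,t)\|_{L^1}dt<\infty$ for all $T>0$. Consider the problem, understood in the sense of tempered distributions in $x$, $${}_0D_t^{\alpha}N(x,t)=\sum_{j=1}^n\mu_j\;{}_xD_{\theta_j}^{\gamma_j}N(x,t)+\phi(x,t)\quad(t>0),$$ $${}_0D_t^{\alpha-1}N(x,0)=\delta(x),\qquad {}_0D_t^{\alpha-2}N(x,0)=0,\qquad \lim_{x\to\pm\infty}N(x,t)=0\quad(t>0).$$ A solution is a family $N(\cdot,t)$, $t>0$, of tempered distributions, weakly continuous in $t>0$, whose Fourier transform $N^{*}(k,t)$ in $x$ is, for each $t>0$, a measurable function of $k$ integrable against some weight $(1+|k|)^{-m}$, and for each $T>0$ a function of $(k,t)$ integrable over $\mathbb R\times(0,T]$ against some weight $(1+|k|)^{-m}$, and which satisfies the equation for every $t>0$, the two initial conditions as limits for $t\to0^{+}$, and the last condition in the sense that the translates of $N(\cdot,t)$ tend to $0$, all tested against Schwartz functions. Then a solution exists, and every solution is given, for every $t>0$, by $$N(x,t)=\frac{t^{\alpha-1}}{2\pi}\int_{-\infty}^{\infty}e^{-ikx}E_{\alpha,\alpha}\left[-b(k)t^{\alpha}\right]dk+\frac1{\sqrt{2\pi}}\int_0^t\xi^{\alpha-1}\int_{-\infty}^{\infty}E_{\alpha,\alpha}\left[-b(k)\xi^{\alpha}\right]e^{-ikx}\phi^{*}(k,t-\xi)\,dk\,d\xi$$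 in the sense of tempered distributions in $x$: for every Schwartz function $\psi$, pairing both sides with $\psi$, where $e^{-ikx}$ on the right is replaced by $\int e^{-ikx}\psi(x)\,dx$, gives an identity whose integrals converge absolutely. Moreover, for every $t>0$ for which $E_{\alpha,\alpha}[-b(k)t^{\alpha}]$ is integrable over $k\in\mathbb R$ and $\xi^{\alpha-1}E_{\alpha,\alpha}[-b(k)\xi^{\alpha}]\phi^{*}(k,t-\xi)$ is integrable over $(\xi,k)\in(0,t]\times\mathbb R$, $N(\cdot,t)$ is the function of $x$ given literally by the right-hand side, and this function is continuous and tends to $0$ as $x\to\pm\infty$. -/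

import Mathlib

open MeasureTheory Filter Topology Set
open scoped SchwartzMap

noncomputable section

/-- The two-parameter Mittag-Leffler function `E_{α,β}(z) = ∑ zⁿ / Γ(α n + β)`. -/
def mittagLeffler (α β : ℝ) (z : ℂ) : ℂ :=
  ∑' n : ℕ, z ^ n / ((Real.Gamma (α * n + β) : ℝ) : ℂ)

/-- Fourier transform of a function, `f*(k) = (2π)^{-1/2} ∫ e^{ikx} f(x) dx`. -/
def fourierStar (f : ℝ → ℂ) (k : ℝ) : ℂ :=
  1 / (√(2 * Real.pi) : ℂ) * ∫ x : ℝ, Complex.exp (Complex.I * k * x) * f x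

/-- Inverse Fourier integral, `(2π)^{-1/2} ∫ e^{-ikx} h(x) dx`. -/
def fourierStarInv (h : ℝ → ℂ) (k : ℝ) : ℂ :=
  1 / (√(2 * Real.pi) : ℂ) * ∫ x : ℝ, Complex.exp (-Complex.I * k * x) * h x

/-- The tempered distribution `T` has the function `h` as its Fourier transform: `h` is measurable
and integrable against some weight `(1 + |k|)^{-m}`, and `T = (2π)^{-1/2} ∫ e^{-ikx} h(k) dk` in the
sense of tempered distributions. -/
def HasFourierStar (T : 𝓢'(ℝ, ℂ)) (h : ℝ → ℂ) : Prop :=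
  (∃ m : ℕ, Integrable (fun k : ℝ => h k / ((1 + |k| : ℝ) : ℂ) ^ m)) ∧
    ∀ ψ : 𝓢(ℝ, ℂ), T ψ = ∫ k : ℝ, h k * fourierStarInv ψ k

/-- The symbol `Ψ_θ^γ(k) = |k|^γ exp(i sign(k) θ π / 2)`. -/
def rieszFellerSymbol (γ θ k : ℝ) : ℂ :=
  ((|k| ^ γ : ℝ) : ℂ) * Complex.exp (Complex.I * (Real.sign k : ℝ) * (θ * Real.pi / 2 : ℝ))

/-- `S` is the Riesz-Feller derivative of order `γ` and asymmetry `θ` of `T`: the Fourier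
transform of `S` is `-Ψ_θ^γ` times that of `T`. -/
def HasRieszFellerDeriv (γ θ : ℝ) (T S : 𝓢'(ℝ, ℂ)) : Prop :=
  ∃ h : ℝ → ℂ, HasFourierStar T h ∧ HasFourierStar S (fun k => -rieszFellerSymbol γ θ k * h k)

/-- The symbol `b(k) = ∑ j, μ_j Ψ_{θ_j}^{γ_j}(k)`. -/
def totalSymbol {n : ℕ} (μ γ θ : Fin n → ℝ) (k : ℝ) : ℂ :=
  ∑ j, (μ j : ℂ) * rieszFellerSymbol (γ j) (θ j) k

/-- Riemann-Liouville fractional integral of order `ν ≥ 0`. -/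
def rlIntegral (ν : ℝ) (u : ℝ → ℂ) (t : ℝ) : ℂ :=
  if ν = 0 then u t
  else 1 / ((Real.Gamma ν : ℝ) : ℂ) * ∫ s in (0 : ℝ)..t, (((t - s) ^ (ν - 1) : ℝ) : ℂ) * u s

/-- The Riemann-Liouville derivative of order `α ≥ 0` of `u` exists at `t` and equals `v`: it is
the derivative of order `m = ⌊α⌋ + 1` of the fractional integral of order `m - α`. -/
def HasRLDerivAt (α : ℝ) (u : ℝ → ℂ) (v : ℂ) (t : ℝ) : Prop :=
  (∀ i < ⌊α⌋₊, ∀ᶠ s in 𝓝 t,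
    DifferentiableAt ℝ (iteratedDeriv i (rlIntegral (⌊α⌋₊ + 1 - α) u)) s) ∧
  HasDerivAt (iteratedDeriv ⌊α⌋₊ (rlIntegral (⌊α⌋₊ + 1 - α) u)) v t

/-- `N`, seen as a family `t ↦ N(·, t)` of tempered distributions in `x`, solves
`₀D_t^α N = ∑ j, μ_j  ₓD_{θ_j}^{γ_j} N + φ` for `t > 0`, with
`₀D_t^{α-1} N(x, 0) = δ(x)`, `₀D_t^{α-2} N(x, 0) = 0` and `N(x, t) → 0` as `x → ±∞`.
Only the values `N t` with `t > 0` matter. -/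
structure IsDeltaSolution (α : ℝ) {n : ℕ} (μ γ θ : Fin n → ℝ) (φ : ℝ → ℝ → ℂ)
    (N : ℝ → 𝓢'(ℝ, ℂ)) : Prop where
  /-- The Fourier transform of `N` in `x` is a function, integrable in time near `t = 0`. -/
  fourier : ∃ Nstar : ℝ → ℝ → ℂ,
    (∀ t, 0 < t → HasFourierStar (N t) (fun k => Nstar k t)) ∧
    ∀ T, 0 < T → ∃ m : ℕ,
      IntegrableOn (fun p : ℝ × ℝ => Nstar p.1 p.2 / ((1 + |p.1| : ℝ) : ℂ) ^ m) (univ ×ˢ Ioc 0 T)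
  /-- `N` is continuous in `t > 0`. -/
  continuousOn : ∀ ψ : 𝓢(ℝ, ℂ), ContinuousOn (fun t => N t ψ) (Ioi 0)
  /-- The equation, in the sense of tempered distributions in `x`, at every time `t > 0`. -/
  equation : ∃ S : Fin n → ℝ → 𝓢'(ℝ, ℂ),
    (∀ j t, 0 < t → HasRieszFellerDeriv (γ j) (θ j) (N t) (S j t)) ∧
    ∀ t, 0 < t → ∀ ψ : 𝓢(ℝ, ℂ),
      HasRLDerivAt α (fun τ => N τ ψ) (∑ j, (μ j : ℂ) * S j t ψ + ∫ x : ℝ, φ x t * ψ x) t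
  /-- `₀D_t^{α-1} N`, a fractional integral of order `1 - α`, has initial value `δ`. -/
  initial_one : ∀ ψ : 𝓢(ℝ, ℂ),
    Tendsto (rlIntegral (1 - α) (fun τ => N τ ψ)) (𝓝[>] 0)
      (𝓝 (TemperedDistribution.delta (0 : ℝ) ψ))
  /-- `₀D_t^{α-2} N`, a fractional integral of order `2 - α`, has initial value `0`. -/
  initial_two : ∀ ψ : 𝓢(ℝ, ℂ),
    Tendsto (rlIntegral (2 - α) (fun τ => N τ ψ)) (𝓝[>] 0) (𝓝 0)
  /-- `N(·, t)` vanishes at infinity: its translates tend to `0` as distributions. -/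
  vanishes : ∀ t, 0 < t → ∀ ψ : 𝓢(ℝ, ℂ),
    Tendsto (fun y : ℝ => N t (SchwartzMap.compSubConstCLM ℂ y ψ)) (cocompact ℝ) (𝓝 0)

end

/-!
The Fourier transform in `x` turns the problem into a fractional relaxation equation for each
frequency `k`. Writing `h_ν(t) = t^{ν-1} / Γ(ν)` for the kernel of fractional integration
(`rlKernel`), so that `h_ν * h_κ = h_{ν+κ}`, and `b = totalSymbol μ γ θ`, the equation with its
first initial condition is the Volterra equation

  `v = (2π)^{-1/2} h_α + h_α * (-b(k) v + φ*(k, ·))`,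

which is solved by `v = (2π)^{-1/2} u + u * φ*(k, ·)` with `u(t) = t^{α-1} E_{α,α}(-b(k) t^α)`,
since `u = h_α - b(k) h_α * u` (`mlKernel_volterra`, `rlIntegral_mlSolution`).

Two points need more than this computation.

* *A bound that is uniform in the frequency.* The conditions on `θ_j` give `|θ_j| ≤ 1`, so
  `Re b ≥ 0`, and `|E_{α,α}(-z)| ≤ 1 / Γ(α)` for `Re z ≥ 0` (`norm_mittagLeffler_neg_le`). The
  latter is the limit of an elementary inequality for power series: `1 / (w + (1 - X)^α)` equals
  `1 / (1 + w - P)`, where `P = 1 - (1 - X)^α` has nonnegative coefficients because `0 < α ≤ 1`; as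
  `|1 + w| ≥ 1`, its coefficients are dominated by those of `1 / (1 - P) = (1 - X)^{-α}`
  (`norm_resolventCoeff_le`). With `w = z / n^α`, the coefficients of `X^n` on both sides, rescaled
  by `n^{1-α}`, tend to `E_{α,α}(-z)` and `1 / Γ(α)` (`tendsto_resolventCoeff`). So `|u| ≤ h_α`, and
  the candidate is a family of functions of `t`, dominated uniformly in `k` by a function that is
  integrable near `0` (`norm_solutionStar_le`). Pairing with a Schwartz function in `k` commutes
  with fractional integration by Fubini (`DominatedFamily.rlIntegral_integral`), which gives
  existence (`exists_isDeltaSolution`).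

* *Uniqueness.* The exceptional null sets of frequencies may depend on the time. So for the
  difference `D` of the Fourier transforms of two solutions the equation is first integrated to
  `∫_0^t D(k, s) ds = -b(k) ∫_0^t h_{α+1}(t - s) D(k, s) ds`, tested against Schwartz functions.
  Both sides are functions of `k` that are integrable against a weight, hence they agree for almost every
  `k`, at first for all rational `t`, and then for all `t` because both sides are continuous in `t`.
  So the primitive `G` of `D(k, ·)` solves `G = -b(k) h_α * G`, and `G = 0` by iteration
  (`eq_zero_of_volterra`). Hence the primitives in time of all pairings vanish, and so do the
  pairings, which are continuous in time (`eq_zero_of_homogeneous`, `IsDeltaSolution.eq`).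

The solution formula is then the inversion of the Fourier transform `v`, by Fubini
(`integral_mul_solutionStar`); if `v(·, t)` is integrable, its inverse Fourier integral is
continuous and vanishes at infinity by the Riemann–Lebesgue lemma.
-/

/-! ### Coefficients of `(1 - X)^{-a}` -/

/-- The coefficient `a (a + 1) ⋯ (a + n - 1) / n!` of `X ^ n` in the power series
`(1 - X)^{-a}`. -/
noncomputable def risingBinom (a : ℝ) (n : ℕ) : ℝ := ∏ i ∈ Finset.range n, (a + i) / (i + 1)

lemma risingBinom_zero_right (a : ℝ) : risingBinom a 0 = 1 := by simp [risingBinom]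

lemma risingBinom_succ (a : ℝ) (n : ℕ) :
    risingBinom a (n + 1) = risingBinom a n * ((a + n) / (n + 1)) := by
  rw [risingBinom, Finset.prod_range_succ, ← risingBinom]

lemma risingBinom_zero_left (n : ℕ) : risingBinom 0 n = if n = 0 then 1 else 0 := by
  cases n with
  | zero => simp [risingBinom]
  | succ n => simp [risingBinom, Finset.prod_eq_zero_iff]

lemma risingBinom_eq_multichoose (a : ℝ) (n : ℕ) : risingBinom a n = Ring.multichoose a n := by
  have h := Ring.factorial_nsmul_multichoose_eq_ascPochhammer a n
  rw [Polynomial.ascPochhammer_smeval_eq_eval] at h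
  have h2 : (n.factorial : ℝ) * risingBinom a n = (ascPochhammer ℝ n).eval a := by
    clear h
    induction n with
    | zero => simp [risingBinom]
    | succ n ih =>
      rw [ascPochhammer_succ_eval, ← ih, risingBinom_succ, Nat.factorial_succ]
      have : (n : ℝ) + 1 ≠ 0 := by positivity
      push_cast
      field_simp
  have h0 : (n.factorial : ℝ) ≠ 0 := by positivity
  rw [nsmul_eq_mul] at h
  exact mul_left_cancel₀ h0 (h2.trans h.symm)

/-- The Chu–Vandermonde identity, i.e. `(1 - X)^{-(a+b)} = (1 - X)^{-a} (1 - X)^{-b}`. -/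
lemma risingBinom_add (a b : ℝ) (n : ℕ) :
    risingBinom (a + b) n =
      ∑ ij ∈ Finset.HasAntidiagonal.antidiagonal n, risingBinom a ij.1 * risingBinom b ij.2 := by
  have key (r : ℝ) (k : ℕ) : risingBinom r k = (-1) ^ k * Ring.choose (-r) k := by
    rw [Ring.choose_neg', risingBinom_eq_multichoose, Int.negOnePow_def, Units.smul_def]
    simp [← mul_assoc, ← mul_pow]
  rw [key, neg_add, Ring.add_choose_eq n (Commute.all _ _), Finset.mul_sum]
  refine Finset.sum_congr rfl fun ij hij => ?_
  rw [Finset.HasAntidiagonal.mem_antidiagonal] at hij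
  rw [key, key, ← hij, pow_add]
  ring

lemma risingBinom_nonneg {a : ℝ} (ha : 0 ≤ a) (n : ℕ) : 0 ≤ risingBinom a n :=
  Finset.prod_nonneg fun i _ => by positivity

lemma risingBinom_le_pow {a : ℝ} (ha : 0 ≤ a) (n : ℕ) : risingBinom a n ≤ (a + 1) ^ n := by
  have hc : (a + 1) ^ n = ∏ _i ∈ Finset.range n, (a + 1) := by simp
  rw [hc]
  refine Finset.prod_le_prod (fun i _ => by positivity) fun i _ => ?_
  rw [div_le_iff₀ (by positivity)]
  have : (0 : ℝ) ≤ i := by positivity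
  nlinarith [mul_nonneg ha this]

/-- For `0 < α ≤ 1` the series `(1 - X)^α` has nonpositive coefficients beyond the constant one. -/
lemma risingBinom_neg_succ_nonpos {α : ℝ} (hα0 : 0 < α) (hα1 : α ≤ 1) (n : ℕ) :
    risingBinom (-α) (n + 1) ≤ 0 := by
  induction n with
  | zero => simp [risingBinom, hα0.le]
  | succ n ih =>
    rw [risingBinom_succ]
    refine mul_nonpos_of_nonpos_of_nonneg ih (div_nonneg ?_ (by positivity))
    push_cast
    have : (0 : ℝ) ≤ n := by positivity
    linarith

lemma risingBinom_mul_add (a : ℝ) (n : ℕ) :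
    risingBinom a n * (a + n) = a * risingBinom (a + 1) n := by
  induction n with
  | zero => simp [risingBinom]
  | succ n ih =>
    rw [risingBinom_succ, risingBinom_succ, ← mul_assoc, ← ih]
    push_cast
    ring

lemma risingBinom_add_one_le {a : ℝ} (ha : 0 ≤ a) {K n : ℕ} (hK : 1 ≤ K) (hn : K ≤ n) :
    risingBinom (a + 1) n ≤ (a + 2) ^ K * ((n : ℝ) / K) ^ a := by
  induction n, hn using Nat.le_induction with
  | base =>
    have : (K : ℝ) ≠ 0 := by positivity
    rw [div_self this, Real.one_rpow, mul_one]
    refine (risingBinom_le_pow (by linarith) K).trans_eq ?_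
    ring
  | succ n hn ih =>
    have hn0 : (0 : ℝ) < n := by exact_mod_cast (by omega : 0 < n)
    have hK0 : (0 : ℝ) < K := by exact_mod_cast (by omega : 0 < K)
    rw [risingBinom_succ]
    -- `1 + a / (n + 1) ≤ exp (a / (n + 1)) ≤ ((n + 1) / n) ^ a`
    have h1 : (a + 1 + n) / (n + 1) ≤ (((n + 1 : ℕ) : ℝ) / n) ^ a := by
      rw [Real.rpow_def_of_pos (by positivity)]
      have hlog : 1 - (((n + 1 : ℕ) : ℝ) / n)⁻¹ ≤ Real.log (((n + 1 : ℕ) : ℝ) / n) :=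
        Real.one_sub_inv_le_log_of_pos (by positivity)
      have h2 : 1 - (((n + 1 : ℕ) : ℝ) / n)⁻¹ = 1 / (n + 1) := by
        push_cast; field_simp; ring
      rw [h2] at hlog
      have h3 := Real.add_one_le_exp (Real.log (((n + 1 : ℕ) : ℝ) / n) * a)
      refine le_trans ?_ h3
      have h4 : (a + 1 + n) / (n + 1) = 1 / (n + 1) * a + 1 := by field_simp; ring
      rw [h4]
      gcongr
    calc risingBinom (a + 1) n * ((a + 1 + n) / (n + 1))
        ≤ ((a + 2) ^ K * ((n : ℝ) / K) ^ a) * (((n + 1 : ℕ) : ℝ) / n) ^ a := by gcongr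
      _ = (a + 2) ^ K * (((n + 1 : ℕ) : ℝ) / K) ^ a := by
        rw [mul_assoc, ← Real.mul_rpow (by positivity) (by positivity)]
        congr 2
        field_simp

/-- A bound that is uniform in `n` and, after choosing `K` large, geometrically small in `a`. -/
lemma rpow_mul_risingBinom_le {a : ℝ} (ha : 0 < a) {K n : ℕ} (hK : 1 ≤ K) (hn : K ≤ n) :
    (n : ℝ) ^ (1 - a) * risingBinom a n ≤ a * (a + 2) ^ K * (K : ℝ) ^ (-a) := by
  have hn0 : (0 : ℝ) < n := by exact_mod_cast (by omega : 0 < n)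
  have hK0 : (0 : ℝ) < K := by exact_mod_cast (by omega : 0 < K)
  have h1 : risingBinom a n = a * risingBinom (a + 1) n / (a + n) := by
    rw [← risingBinom_mul_add, mul_div_cancel_right₀ _ (by positivity)]
  have h2 := risingBinom_add_one_le ha.le hK hn
  rw [h1, sub_eq_add_neg, Real.rpow_add hn0, Real.rpow_one]
  have h0 := risingBinom_nonneg (by linarith : 0 ≤ a + 1) n
  calc (n : ℝ) * (n : ℝ) ^ (-a) * (a * risingBinom (a + 1) n / (a + n))
      = (n / (a + n)) * ((n : ℝ) ^ (-a) * (a * risingBinom (a + 1) n)) := by ring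
    _ ≤ 1 * ((n : ℝ) ^ (-a) * (a * ((a + 2) ^ K * ((n : ℝ) / K) ^ a))) := by
        gcongr
        rw [div_le_one (by positivity)]
        linarith
    _ = a * (a + 2) ^ K * (K : ℝ) ^ (-a) := by
        rw [Real.div_rpow hn0.le hK0.le, Real.rpow_neg hn0.le, Real.rpow_neg hK0.le]
        have : (n : ℝ) ^ a ≠ 0 := by positivity
        field_simp

lemma tendsto_rpow_mul_risingBinom {a : ℝ} (ha : 0 < a) :
    Tendsto (fun n : ℕ => (n : ℝ) ^ (1 - a) * risingBinom a n) atTop (𝓝 (1 / Real.Gamma a)) := by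
  have h1 := (Real.GammaSeq_tendsto_Gamma a).inv₀ (Real.Gamma_pos_of_pos ha).ne'
  have h2 : Tendsto (fun n : ℕ => (n : ℝ) / (n + a)) atTop (𝓝 1) :=
    tendsto_natCast_div_add_atTop a
  have h3 := h2.mul h1
  rw [one_mul, ← one_div] at h3
  refine h3.congr' ?_
  filter_upwards [eventually_gt_atTop 0] with n hn
  have hn0 : (0 : ℝ) < n := by exact_mod_cast hn
  have hp : risingBinom a n = (∏ j ∈ Finset.range n, (a + j)) / n.factorial := by
    rw [risingBinom, Finset.prod_div_distrib, ← Finset.prod_range_add_one_eq_factorial]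
    push_cast
    rfl
  have hpos : 0 < ∏ j ∈ Finset.range n, (a + (j : ℝ)) :=
    Finset.prod_pos fun i _ => by positivity
  rw [hp, Real.GammaSeq, Finset.prod_range_succ, sub_eq_add_neg, Real.rpow_add hn0, Real.rpow_one,
    Real.rpow_neg hn0.le]
  have : (n : ℝ) ^ a ≠ 0 := by positivity
  have : (n.factorial : ℝ) ≠ 0 := by positivity
  have : a + n ≠ 0 := by positivity
  have := hpos.ne'
  field_simp
  ring

lemma one_div_Gamma_le {a : ℝ} (ha : 0 < a) {K : ℕ} (hK : 1 ≤ K) :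
    1 / Real.Gamma a ≤ a * (a + 2) ^ K * (K : ℝ) ^ (-a) :=
  le_of_tendsto (tendsto_rpow_mul_risingBinom ha)
    (by filter_upwards [eventually_ge_atTop K] with n hn using rpow_mul_risingBinom_le ha hK hn)

/-! ### The Mittag-Leffler function on the left half-plane -/

/-- The coefficient of `X ^ n` in `1 / (w + (1 - X) ^ α)`, expanded in powers of `w`. -/
noncomputable def resolventCoeff (α : ℝ) (w : ℂ) (n : ℕ) : ℂ :=
  ∑' m : ℕ, (-w) ^ m * (risingBinom (α * (m + 1)) n : ℝ)

lemma risingBinom_le_pow_of_le_one {α : ℝ} (hα0 : 0 < α) (hα1 : α ≤ 1) (n m : ℕ) :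
    risingBinom (α * (m + 1)) n ≤ ((m : ℝ) + 2) ^ n := by
  refine (risingBinom_le_pow (by positivity) n).trans ?_
  have : α * (m + 1) ≤ 1 * (m + 1) := by gcongr
  exact pow_le_pow_left₀ (by positivity) (by linarith) n

lemma summable_add_two_pow_mul_geometric (n : ℕ) {r : ℝ} (h0 : 0 ≤ r) (hr : r < 1) :
    Summable fun m : ℕ => ((m : ℝ) + 2) ^ n * r ^ m := by
  have h1 : Summable fun m : ℕ => (m : ℝ) ^ n * r ^ m :=
    summable_pow_mul_geometric_of_norm_lt_one n (by rwa [Real.norm_of_nonneg h0])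
  rcases h0.eq_or_lt with rfl | hpos
  · refine summable_of_ne_finset_zero (s := {0}) fun m hm => ?_
    simp only [Finset.mem_singleton] at hm
    simp [hm]
  · have h2 := ((summable_nat_add_iff 2).2 h1).mul_right (r ^ 2)⁻¹
    refine h2.congr fun m => ?_
    push_cast
    field_simp
    ring

lemma summable_resolventCoeff {α : ℝ} (hα0 : 0 < α) (hα1 : α ≤ 1) {w : ℂ} (hw : ‖w‖ < 1)
    (n : ℕ) : Summable fun m : ℕ => (-w) ^ m * ((risingBinom (α * (m + 1)) n : ℝ) : ℂ) := by
  refine Summable.of_norm_bounded (summable_add_two_pow_mul_geometric n (norm_nonneg w) hw)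
    fun m => ?_
  rw [norm_mul, norm_pow, norm_neg, Complex.norm_real,
    Real.norm_of_nonneg (risingBinom_nonneg (by positivity) n), mul_comm]
  gcongr
  exact risingBinom_le_pow_of_le_one hα0 hα1 n m

/-- The identity `(w + (1 - X) ^ α) * (1 / (w + (1 - X) ^ α)) = 1`, coefficient by coefficient. -/
lemma sum_risingBinom_mul_resolventCoeff {α : ℝ} (hα0 : 0 < α) (hα1 : α ≤ 1) {w : ℂ}
    (hw : ‖w‖ < 1) (n : ℕ) :
    ∑ ij ∈ Finset.HasAntidiagonal.antidiagonal n,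
        ((risingBinom (-α) ij.1 : ℝ) : ℂ) * resolventCoeff α w ij.2
      = (if n = 0 then 1 else 0) - w * resolventCoeff α w n := by
  have h1 : ∑ ij ∈ Finset.HasAntidiagonal.antidiagonal n,
      ((risingBinom (-α) ij.1 : ℝ) : ℂ) * resolventCoeff α w ij.2
      = ∑' m : ℕ, (-w) ^ m * ((risingBinom (α * m) n : ℝ) : ℂ) := by
    refine Eq.trans (HasSum.tsum_eq (hasSum_sum fun ij _ =>
      (summable_resolventCoeff hα0 hα1 hw ij.2).hasSum.mul_left _)).symm ?_
    refine tsum_congr fun m => ?_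
    have h2 : α * m = -α + α * (m + 1) := by ring
    rw [h2, risingBinom_add]
    push_cast
    rw [Finset.mul_sum]
    exact Finset.sum_congr rfl fun ij _ => by ring
  have h3 : (fun m : ℕ => (-w) ^ (m + 1) * ((risingBinom (α * (m + 1 : ℕ)) n : ℝ) : ℂ))
      = fun m : ℕ => (-w) * ((-w) ^ m * ((risingBinom (α * (m + 1)) n : ℝ) : ℂ)) := by
    funext m
    push_cast
    ring
  have h4 := (summable_resolventCoeff hα0 hα1 hw n).mul_left (-w)
  rw [h1, ((summable_nat_add_iff 1).1 (h3 ▸ h4)).tsum_eq_zero_add, h3, tsum_mul_left,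
    ← resolventCoeff]
  simp only [Nat.cast_zero, mul_zero, risingBinom_zero_left]
  split_ifs <;> simp [sub_eq_add_neg]

/-- `1 / (w + 1 - P)` is dominated coefficientwise by `1 / (1 - P)`, since `P = 1 - (1 - X) ^ α`
has nonnegative coefficients and `|w + 1| ≥ 1`. -/
lemma norm_resolventCoeff_le {α : ℝ} (hα0 : 0 < α) (hα1 : α ≤ 1) {w : ℂ} (hw : ‖w‖ < 1)
    (hre : 0 ≤ w.re) (n : ℕ) : ‖resolventCoeff α w n‖ ≤ risingBinom α n := by
  induction n using Nat.strong_induction_on with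
  | _ n ih =>
    have h1 := sum_risingBinom_mul_resolventCoeff hα0 hα1 hw n
    have h2 := risingBinom_add (-α) α n
    rw [neg_add_cancel, risingBinom_zero_left] at h2
    rw [Finset.Nat.sum_antidiagonal_eq_sum_range_succ_mk, Finset.sum_range_succ'] at h1 h2
    simp only [risingBinom_zero_right, one_mul, Nat.sub_zero, Complex.ofReal_one] at h1 h2
    have h3 : (1 + w) * resolventCoeff α w n = (if n = 0 then 1 else 0)
        + ∑ k ∈ Finset.range n,
          ((-risingBinom (-α) (k + 1) : ℝ) : ℂ) * resolventCoeff α w (n - (k + 1)) := by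
      simp only [Complex.ofReal_neg, neg_mul, Finset.sum_neg_distrib]
      linear_combination h1
    have h4 : risingBinom α n = (if n = 0 then 1 else 0)
        + ∑ k ∈ Finset.range n, -risingBinom (-α) (k + 1) * risingBinom α (n - (k + 1)) := by
      simp only [neg_mul, Finset.sum_neg_distrib]
      linear_combination -h2
    have h5 : 1 ≤ ‖1 + w‖ := by
      refine le_trans ?_ (Complex.re_le_norm _)
      simpa using hre
    calc ‖resolventCoeff α w n‖ ≤ ‖1 + w‖ * ‖resolventCoeff α w n‖ :=
          le_mul_of_one_le_left (norm_nonneg _) h5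
      _ = ‖(1 + w) * resolventCoeff α w n‖ := (norm_mul _ _).symm
      _ ≤ risingBinom α n := by
        rw [h3, h4]
        refine (norm_add_le _ _).trans (add_le_add ?_ ((norm_sum_le _ _).trans ?_))
        · split_ifs <;> simp
        · refine Finset.sum_le_sum fun k hk => ?_
          have hk' := Finset.mem_range.1 hk
          have h6 : 0 ≤ -risingBinom (-α) (k + 1) :=
            neg_nonneg.2 (risingBinom_neg_succ_nonpos hα0 hα1 k)
          rw [norm_mul, Complex.norm_real, Real.norm_of_nonneg h6]
          exact mul_le_mul_of_nonneg_left (ih _ (by omega)) h6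

/-- A bound for the coefficients `1 / Γ (α (m + 1))` and their discrete approximations, which shows
that the Mittag-Leffler series has infinite radius of convergence. -/
lemma exists_geometric_bound {α : ℝ} (hα0 : 0 < α) (hα1 : α ≤ 1) {r : ℝ} (hr : 0 ≤ r) :
    ∃ K : ℕ, 1 ≤ K ∧ ∀ m : ℕ,
      r ^ m * (α * (m + 1) * (α * (m + 1) + 2) ^ K * (K : ℝ) ^ (-(α * (m + 1))))
        ≤ ((m : ℝ) + 3) ^ (K + 1) * (1 / 2 : ℝ) ^ m := by
  have h1 : Tendsto (fun K : ℕ => r * (K : ℝ) ^ (-α)) atTop (𝓝 (r * 0)) :=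
    ((tendsto_rpow_neg_atTop hα0).comp tendsto_natCast_atTop_atTop).const_mul r
  rw [mul_zero] at h1
  obtain ⟨K, hK1, hK⟩ := ((h1.eventually (ge_mem_nhds (by norm_num : (0 : ℝ) < 1 / 2))).and
    (eventually_ge_atTop 1)).exists
  refine ⟨K, hK, fun m => ?_⟩
  have hK0 : (0 : ℝ) < K := by exact_mod_cast (by omega : 0 < K)
  have hm : (0 : ℝ) ≤ m := by positivity
  have ha : α * (m + 1) ≤ m + 1 := by nlinarith
  have e1 : (K : ℝ) ^ (-(α * (m + 1))) = ((K : ℝ) ^ (-α)) ^ m * (K : ℝ) ^ (-α) := by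
    rw [← Real.rpow_natCast, ← Real.rpow_mul hK0.le, ← Real.rpow_add hK0]
    congr 1
    ring
  have e2 : (K : ℝ) ^ (-α) ≤ 1 :=
    Real.rpow_le_one_of_one_le_of_nonpos (by exact_mod_cast hK) (by linarith)
  calc r ^ m * (α * (m + 1) * (α * (m + 1) + 2) ^ K * (K : ℝ) ^ (-(α * (m + 1))))
      = (α * (m + 1) * (α * (m + 1) + 2) ^ K) * (r * (K : ℝ) ^ (-α)) ^ m * (K : ℝ) ^ (-α) := by
        rw [e1, mul_pow]; ring
    _ ≤ ((m + 3) * ((m : ℝ) + 3) ^ K) * (1 / 2 : ℝ) ^ m * 1 := by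
        have h2 : α * (m + 1) * (α * (m + 1) + 2) ^ K ≤ (m + 3) * ((m : ℝ) + 3) ^ K :=
          mul_le_mul (by linarith) (pow_le_pow_left₀ (by positivity) (by linarith) K)
            (by positivity) (by positivity)
        have h3 : (r * (K : ℝ) ^ (-α)) ^ m ≤ (1 / 2 : ℝ) ^ m :=
          pow_le_pow_left₀ (by positivity) hK1 m
        exact mul_le_mul (mul_le_mul h2 h3 (by positivity) (by positivity)) e2 (by positivity)
          (by positivity)
    _ = ((m : ℝ) + 3) ^ (K + 1) * (1 / 2 : ℝ) ^ m := by ring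

lemma summable_add_three_pow_mul_geometric (n : ℕ) :
    Summable fun m : ℕ => ((m : ℝ) + 3) ^ n * (1 / 2 : ℝ) ^ m := by
  have h := (summable_nat_add_iff 1).2
    (summable_add_two_pow_mul_geometric n (by norm_num : (0 : ℝ) ≤ 1 / 2) (by norm_num))
  refine (h.mul_right 2).congr fun m => ?_
  push_cast
  ring

lemma summable_pow_div_Gamma {α : ℝ} (hα0 : 0 < α) (hα1 : α ≤ 1) {r : ℝ} (hr : 0 ≤ r) :
    Summable fun m : ℕ => r ^ m / Real.Gamma (α * m + α) := by
  obtain ⟨K, hK, hb⟩ := exists_geometric_bound hα0 hα1 hr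
  refine Summable.of_nonneg_of_le (fun m => ?_) (fun m => ?_)
    (summable_add_three_pow_mul_geometric (K + 1))
  · have := Real.Gamma_pos_of_pos (by positivity : 0 < α * m + α)
    positivity
  · refine le_trans ?_ (hb m)
    have e : α * m + α = α * (m + 1) := by ring
    rw [e, div_eq_mul_one_div]
    gcongr
    exact one_div_Gamma_le (by positivity) hK

lemma summable_mittagLeffler {α : ℝ} (hα0 : 0 < α) (hα1 : α ≤ 1) (z : ℂ) :
    Summable fun m : ℕ => z ^ m / ((Real.Gamma (α * m + α) : ℝ) : ℂ) := by
  refine Summable.of_norm ((summable_pow_div_Gamma hα0 hα1 (norm_nonneg z)).congr fun m => ?_)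
  have := Real.Gamma_pos_of_pos (by positivity : 0 < α * m + α)
  rw [norm_div, norm_pow, Complex.norm_real, Real.norm_of_nonneg this.le]

lemma continuous_mittagLeffler {α : ℝ} (hα0 : 0 < α) (hα1 : α ≤ 1) :
    Continuous (mittagLeffler α α) := by
  rw [continuous_iff_continuousAt]
  intro z
  have h : ContinuousOn (mittagLeffler α α) (Metric.ball 0 (‖z‖ + 1)) := by
    refine continuousOn_tsum (u := fun m : ℕ => (‖z‖ + 1) ^ m / Real.Gamma (α * m + α))
      (fun m => by fun_prop) (summable_pow_div_Gamma hα0 hα1 (by positivity)) fun m x hx => ?_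
    have := Real.Gamma_pos_of_pos (by positivity : 0 < α * m + α)
    rw [norm_div, norm_pow, Complex.norm_real, Real.norm_of_nonneg this.le]
    have : ‖x‖ ≤ ‖z‖ + 1 := (mem_ball_zero_iff.1 hx).le
    gcongr
  exact h.continuousAt (Metric.isOpen_ball.mem_nhds (by simp))

/-- The functions `n ^ (1 - α) * resolventCoeff α (z / n ^ α) n` are discrete approximations of the
Mittag-Leffler function. -/
lemma tendsto_resolventCoeff {α : ℝ} (hα0 : 0 < α) (hα1 : α ≤ 1) (z : ℂ) :
    Tendsto (fun n : ℕ => (((n : ℝ) ^ (1 - α) : ℝ) : ℂ) *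
      resolventCoeff α (z / (((n : ℝ) ^ α : ℝ) : ℂ)) n) atTop (𝓝 (mittagLeffler α α (-z))) := by
  obtain ⟨K, hK, hb⟩ := exists_geometric_bound hα0 hα1 (norm_nonneg z)
  have h1 : Tendsto (fun n : ℕ => ∑' m : ℕ, (-z) ^ m *
      (((n : ℝ) ^ (1 - α * (m + 1)) * risingBinom (α * (m + 1)) n : ℝ) : ℂ)) atTop
      (𝓝 (∑' m : ℕ, (-z) ^ m * ((1 / Real.Gamma (α * (m + 1)) : ℝ) : ℂ))) := by
    refine tendsto_tsum_of_dominated_convergence (summable_add_three_pow_mul_geometric (K + 1))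
      (fun m => ?_) ?_
    · exact ((Complex.continuous_ofReal.tendsto _).comp
        (tendsto_rpow_mul_risingBinom (by positivity))).const_mul _
    · filter_upwards [eventually_ge_atTop K] with n hn m
      refine le_trans ?_ (hb m)
      have h0 : 0 ≤ risingBinom (α * (m + 1)) n := risingBinom_nonneg (by positivity) n
      rw [norm_mul, norm_pow, norm_neg, Complex.norm_real, Real.norm_of_nonneg (by positivity)]
      exact mul_le_mul_of_nonneg_left (rpow_mul_risingBinom_le (by positivity) hK hn)
        (by positivity)
  have e2 : mittagLeffler α α (-z)
      = ∑' m : ℕ, (-z) ^ m * ((1 / Real.Gamma (α * (m + 1)) : ℝ) : ℂ) := by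
    refine tsum_congr fun m => ?_
    have e : α * m + α = α * (m + 1) := by ring
    rw [e]
    push_cast
    ring
  rw [e2]
  refine h1.congr' ?_
  filter_upwards [eventually_gt_atTop 0] with n hn
  have hn0 : (0 : ℝ) < n := by exact_mod_cast hn
  rw [resolventCoeff, ← tsum_mul_left]
  refine tsum_congr fun m => ?_
  have e3 : (n : ℝ) ^ (1 - α * (m + 1)) = (n : ℝ) ^ (1 - α) / ((n : ℝ) ^ α) ^ m := by
    rw [← Real.rpow_natCast, ← Real.rpow_mul hn0.le, ← Real.rpow_sub hn0]
    congr 1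
    ring
  rw [e3, neg_div', div_pow]
  push_cast
  ring

/-- For `0 < α ≤ 1`, the function `z ↦ E_{α,α}(-z)` is bounded on the right half-plane by its value
at `0`. -/
theorem norm_mittagLeffler_neg_le {α : ℝ} (hα0 : 0 < α) (hα1 : α ≤ 1) {z : ℂ} (hz : 0 ≤ z.re) :
    ‖mittagLeffler α α (-z)‖ ≤ 1 / Real.Gamma α := by
  refine le_of_tendsto_of_tendsto (tendsto_resolventCoeff hα0 hα1 z).norm
    (tendsto_rpow_mul_risingBinom hα0) ?_
  have h1 : Tendsto (fun n : ℕ => ‖z‖ * (n : ℝ) ^ (-α)) atTop (𝓝 (‖z‖ * 0)) :=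
    ((tendsto_rpow_neg_atTop hα0).comp tendsto_natCast_atTop_atTop).const_mul _
  rw [mul_zero] at h1
  filter_upwards [eventually_gt_atTop 0, h1.eventually (gt_mem_nhds one_pos)] with n hn hlt
  have hn0 : (0 : ℝ) < n := by exact_mod_cast hn
  have hp : 0 < (n : ℝ) ^ α := by positivity
  rw [norm_mul, Complex.norm_real, Real.norm_of_nonneg (by positivity)]
  refine mul_le_mul_of_nonneg_left (norm_resolventCoeff_le hα0 hα1 ?_ ?_ n) (by positivity)
  · rwa [norm_div, Complex.norm_real, Real.norm_of_nonneg hp.le, div_eq_mul_inv,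
      ← Real.rpow_neg hn0.le]
  · rw [Complex.div_ofReal_re]
    positivity

/-! ### Convolution of causal functions -/

section Causal

variable {𝕜 : Type*} [RCLike 𝕜]

/-- Convolution of functions on the line. -/
noncomputable abbrev conv (f g : ℝ → 𝕜) : ℝ → 𝕜 :=
  convolution f g (ContinuousLinearMap.mul ℝ 𝕜) volume

/-- A function on the line that vanishes for `t ≤ 0` and is integrable on every `(-∞, T]`. -/
structure Causal (f : ℝ → 𝕜) : Prop where
  zero : ∀ t ≤ 0, f t = 0
  int : ∀ T, IntegrableOn f (Iic T)

/-- A causal function that is continuous on `(0, ∞)`; it may be unbounded near `0`. -/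
structure CausalContinuous (f : ℝ → 𝕜) : Prop extends Causal f where
  cont : ContinuousOn f (Ioi 0)

lemma ContinuousOn.exists_bound_Icc {f : ℝ → 𝕜} (hf : ContinuousOn f (Ioi 0)) {a b : ℝ}
    (ha : 0 < a) : ∃ C, 0 ≤ C ∧ ∀ s ∈ Icc a b, ‖f s‖ ≤ C := by
  obtain ⟨C, hC⟩ := isCompact_Icc.exists_bound_of_continuousOn
    (hf.mono fun s (hs : s ∈ Icc a b) => ha.trans_le hs.1)
  exact ⟨max C 0, le_max_right _ _, fun s hs => (hC s hs).trans (le_max_left _ _)⟩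

lemma conv_apply (f g : ℝ → 𝕜) (t : ℝ) : conv f g t = ∫ s, f s * g (t - s) := rfl

lemma conv_comm (f g : ℝ → 𝕜) : conv f g = conv g f := by
  funext t
  rw [conv_apply, conv_apply, ← integral_sub_left_eq_self _ _ t]
  simp [mul_comm]

namespace Causal

variable {f g : ℝ → 𝕜}

lemma of_indicator {u : ℝ → 𝕜} (hu : ∀ T, 0 < T → IntegrableOn u (Ioc 0 T)) :
    Causal ((Ioi 0).indicator u) where
  zero t ht := indicator_of_notMem (by simpa using ht) _
  int T := by
    rw [integrableOn_indicator_iff measurableSet_Ioi]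
    exact (hu (max T 1) (by positivity)).mono_set fun s hs => ⟨hs.1, le_max_of_le_left hs.2⟩

lemma aestronglyMeasurable (hf : Causal f) : AEStronglyMeasurable f := by
  have h : LocallyIntegrable f := fun x =>
    ⟨Iic (x + 1), Iic_mem_nhds (by linarith), hf.int _⟩
  exact h.aestronglyMeasurable

lemma norm (hf : Causal f) : Causal fun t => ‖f t‖ where
  zero t ht := by simp [hf.zero t ht]
  int T := (hf.int T).norm

lemma integrableOn_Ioc (hf : Causal f) (T : ℝ) : IntegrableOn f (Ioc 0 T) :=
  (hf.int T).mono_set Ioc_subset_Iic_self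

lemma intervalIntegrable (hf : Causal f) {t : ℝ} (ht : 0 ≤ t) :
    IntervalIntegrable f volume 0 t :=
  (intervalIntegrable_iff_integrableOn_Ioc_of_le ht).2 (hf.integrableOn_Ioc t)

lemma mul_eq_zero (hf : ∀ t ≤ 0, f t = 0) (hg : ∀ t ≤ 0, g t = 0) {s t : ℝ}
    (hs : s ∉ Ioo 0 t) : f s * g (t - s) = 0 := by
  rcases le_or_gt s 0 with h | h
  · simp [hf s h]
  · have : t ≤ s := not_lt.1 fun h2 => hs ⟨h, h2⟩
    simp [hg (t - s) (by linarith)]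

lemma conv_of_nonpos (hf : ∀ t ≤ 0, f t = 0) (hg : ∀ t ≤ 0, g t = 0) {t : ℝ} (ht : t ≤ 0) :
    conv f g t = 0 := by
  rw [conv_apply]
  refine integral_eq_zero_of_ae (Eventually.of_forall fun s => ?_)
  exact mul_eq_zero hf hg (by simp [Ioo_eq_empty (not_lt.2 ht)])

lemma conv_eq_integral (hf : ∀ t ≤ 0, f t = 0) (hg : ∀ t ≤ 0, g t = 0) {t : ℝ} (ht : 0 ≤ t) :
    conv f g t = ∫ s in (0 : ℝ)..t, f s * g (t - s) := by
  rw [conv_apply, intervalIntegral.integral_of_le ht, integral_Ioc_eq_integral_Ioo,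
    setIntegral_eq_integral_of_forall_compl_eq_zero]
  exact fun s hs => mul_eq_zero hf hg hs

lemma conv_eq_integral' (hf : ∀ t ≤ 0, f t = 0) (hg : ∀ t ≤ 0, g t = 0) {t : ℝ} (ht : 0 ≤ t) :
    conv f g t = ∫ s in (0 : ℝ)..t, f (t - s) * g s := by
  rw [conv_comm, conv_eq_integral hg hf ht]
  simp_rw [mul_comm]

lemma conv_congr_of_le {f' g' : ℝ → 𝕜} (hf : ∀ t ≤ 0, f t = 0) (hg : ∀ t ≤ 0, g t = 0)
    {T : ℝ} (hff' : ∀ t, t ≤ T → f' t = f t) (hgg' : ∀ t, t ≤ T → g' t = g t)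
    (hfT : ∀ t, T < t → f' t = 0) (hgT : ∀ t, T < t → g' t = 0) {t : ℝ} (ht : t ≤ T) :
    conv f g t = conv f' g' t := by
  rw [conv_apply, conv_apply]
  congr 1
  funext s
  rcases le_or_gt s T with h | h
  · rcases le_or_gt (t - s) T with h' | h'
    · rw [hff' s h, hgg' _ h']
    · rw [hgT _ h', mul_zero, hf s (by linarith), zero_mul]
  · rw [hfT _ h, zero_mul, hg (t - s) (by linarith), mul_zero]

lemma integrable_indicator (hf : Causal f) (T : ℝ) : Integrable ((Iic T).indicator f) :=
  (hf.int T).integrable_indicator measurableSet_Iic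

protected lemma conv (hf : Causal f) (hg : Causal g) : Causal (conv f g) where
  zero t ht := conv_of_nonpos hf.zero hg.zero ht
  int T := by
    have h := ((hf.integrable_indicator T).integrable_convolution (ContinuousLinearMap.mul ℝ 𝕜)
      (hg.integrable_indicator T)).integrableOn (s := Iic T)
    refine h.congr_fun (fun t ht => ?_) measurableSet_Iic
    exact (conv_congr_of_le hf.zero hg.zero
      (fun s hs => indicator_of_mem (s := Iic T) hs f)
      (fun s hs => indicator_of_mem (s := Iic T) hs g)
      (fun s hs => indicator_of_notMem (by simpa using hs) f)
      (fun s hs => indicator_of_notMem (by simpa using hs) g) ht).symm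

end Causal

namespace CausalContinuous

variable {f g h : ℝ → 𝕜}

lemma of_indicator {u : ℝ → 𝕜} (hc : ContinuousOn u (Ioi 0))
    (hu : ∀ T, 0 < T → IntegrableOn u (Ioc 0 T)) : CausalContinuous ((Ioi 0).indicator u) where
  toCausal := Causal.of_indicator hu
  cont := hc.congr fun _ ht => indicator_of_mem ht u

lemma norm (hf : CausalContinuous f) : CausalContinuous fun t => ‖f t‖ where
  toCausal := hf.toCausal.norm
  cont := hf.cont.norm

lemma const_mul (hf : CausalContinuous f) (c : 𝕜) : CausalContinuous fun t => c * f t where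
  zero t ht := by simp [hf.zero t ht]
  int T := (hf.int T).const_mul c
  cont := continuousOn_const.mul hf.cont

lemma add (hf : CausalContinuous f) (hg : CausalContinuous g) :
    CausalContinuous fun t => f t + g t where
  zero t ht := by simp [hf.zero t ht, hg.zero t ht]
  int T := (hf.int T).add (hg.int T)
  cont := hf.cont.add hg.cont

/-- The part of the convolution integral over `s ≤ t / 2`, where only the first factor can be
singular. -/
lemma integrable_half (hf : Causal f) (hg : CausalContinuous g) {t : ℝ} (ht : 0 < t) :
    Integrable fun s => (Iic (t / 2)).indicator f s * g (t - s) := by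
  obtain ⟨C, hC0, hC⟩ := hg.cont.exists_bound_Icc (b := t) (half_pos ht)
  have hgm : AEStronglyMeasurable (fun s => g (t - s)) :=
    hg.aestronglyMeasurable.comp_quasiMeasurePreserving
      (quasiMeasurePreserving_sub_left_of_right_invariant volume t)
  refine ((hf.integrable_indicator (t / 2)).norm.mul_const C).mono'
    ((hf.integrable_indicator (t / 2)).aestronglyMeasurable.mul hgm)
    (Eventually.of_forall fun s => ?_)
  rw [norm_mul]
  by_cases hs : s ∈ Ioc 0 (t / 2)
  · have h1 := hC (t - s) ⟨by linarith [hs.2], by linarith [hs.1]⟩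
    gcongr
  · have : (Iic (t / 2)).indicator f s = 0 := by
      by_cases h : s ∈ Iic (t / 2)
      · rw [indicator_of_mem h, hf.zero s (not_lt.1 fun h0 => hs ⟨h0, h⟩)]
      · exact indicator_of_notMem h f
    simp [this]

lemma continuousAt_half (hf : Causal f) (hg : CausalContinuous g) {t₀ : ℝ} (ht₀ : 0 < t₀) :
    ContinuousAt (fun t => ∫ s, (Iic (t / 2)).indicator f s * g (t - s)) t₀ := by
  obtain ⟨C, hC0, hC⟩ := hg.cont.exists_bound_Icc (a := t₀ / 4) (b := 2 * t₀) (by positivity)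
  have hnear : ∀ᶠ t in 𝓝 t₀, t ∈ Ioo (t₀ / 2) (2 * t₀) :=
    Ioo_mem_nhds (by linarith) (by linarith)
  refine continuousAt_of_dominated (bound := fun s => ‖(Iic t₀).indicator f s‖ * C) ?_ ?_
    ((hf.integrable_indicator t₀).norm.mul_const C) ?_
  · filter_upwards [hnear] with t ht
    exact (integrable_half hf hg (by linarith [ht.1])).aestronglyMeasurable
  · filter_upwards [hnear] with t ht
    refine Eventually.of_forall fun s => ?_
    rw [norm_mul]
    by_cases hs : s ∈ Ioc 0 (t / 2)
    · have h1 := hC (t - s) ⟨by linarith [hs.2, ht.1], by linarith [hs.1, ht.2]⟩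
      rw [indicator_of_mem (show s ∈ Iic (t / 2) from hs.2),
        indicator_of_mem (show s ∈ Iic t₀ from hs.2.trans (by linarith [ht.2]))]
      gcongr
    · have : (Iic (t / 2)).indicator f s = 0 := by
        by_cases h : s ∈ Iic (t / 2)
        · rw [indicator_of_mem h, hf.zero s (not_lt.1 fun h0 => hs ⟨h0, h⟩)]
        · exact indicator_of_notMem h f
      rw [this, norm_zero, zero_mul]
      positivity
  · have hne : ∀ᵐ s : ℝ, s ≠ t₀ / 2 := by simp [ae_iff]
    filter_upwards [hne] with s hs
    have hhalf : Tendsto (fun t : ℝ => t / 2) (𝓝 t₀) (𝓝 (t₀ / 2)) :=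
      tendsto_id.div_const 2
    rcases lt_or_gt_of_ne hs with h | h
    · have h1 : ContinuousAt (fun t => f s * g (t - s)) t₀ := by
        refine continuousAt_const.mul (ContinuousAt.comp (g := g) (f := fun t => t - s) ?_
          (by fun_prop))
        exact hg.cont.continuousAt (Ioi_mem_nhds (by linarith))
      refine h1.congr ?_
      filter_upwards [hhalf.eventually (lt_mem_nhds h)] with t ht
      rw [indicator_of_mem (show s ∈ Iic (t / 2) from ht.le)]
    · refine (continuousAt_const (y := (0 : 𝕜))).congr ?_
      filter_upwards [hhalf.eventually (gt_mem_nhds h)] with t ht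
      rw [indicator_of_notMem (by simpa using ht), zero_mul]

lemma half_reflect (f g : ℝ → 𝕜) (t : ℝ) (s : ℝ) :
    (Iio (t / 2)).indicator g (t - s) * f (t - (t - s)) =
      (Ioi (t / 2)).indicator f s * g (t - s) := by
  by_cases h : t / 2 < s
  · rw [indicator_of_mem (show s ∈ Ioi (t / 2) from h),
      indicator_of_mem (show t - s ∈ Iio (t / 2) by simp only [mem_Iio]; linarith),
      sub_sub_cancel, mul_comm]
  · rw [indicator_of_notMem (show s ∉ Ioi (t / 2) from h),
      indicator_of_notMem (show t - s ∉ Iio (t / 2) by simp only [mem_Iio]; linarith),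
      zero_mul, zero_mul]

lemma split_half (f g : ℝ → 𝕜) (t : ℝ) (s : ℝ) :
    f s * g (t - s) =
      (Iic (t / 2)).indicator f s * g (t - s) + (Ioi (t / 2)).indicator f s * g (t - s) := by
  rw [← add_mul, ← compl_Iic, indicator_self_add_compl_apply]

lemma half_ae_eq (f g : ℝ → 𝕜) (t : ℝ) :
    (fun s => (Iic (t / 2)).indicator f s * g (t - s)) =ᵐ[volume]
      fun s => (Iio (t / 2)).indicator f s * g (t - s) := by
  have hne : ∀ᵐ s : ℝ, s ≠ t / 2 := by simp [ae_iff]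
  filter_upwards [hne] with s hs
  by_cases h : s < t / 2
  · rw [indicator_of_mem (show s ∈ Iic (t / 2) from h.le), indicator_of_mem (show s ∈ Iio _ from h)]
  · rw [indicator_of_notMem (show s ∉ Iic (t / 2) from fun h' => h (lt_of_le_of_ne h' hs)),
      indicator_of_notMem (show s ∉ Iio _ from h)]

lemma integrable_half' (hf : CausalContinuous f) (hg : Causal g) {t : ℝ} (ht : 0 < t) :
    Integrable fun s => (Ioi (t / 2)).indicator f s * g (t - s) := by
  have h1 := (integrable_half hg hf ht).congr (half_ae_eq g f t)
  have h2 := h1.comp_sub_left t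
  simpa only [half_reflect] using h2

lemma convolutionExists (hf : CausalContinuous f) (hg : CausalContinuous g) :
    ConvolutionExists f g (ContinuousLinearMap.mul ℝ 𝕜) := by
  intro t
  change Integrable fun s => f s * g (t - s)
  rcases le_or_gt t 0 with ht | ht
  · refine (integrable_zero ℝ 𝕜 volume).congr (Eventually.of_forall fun s => ?_)
    exact (Causal.mul_eq_zero hf.zero hg.zero (by simp [Ioo_eq_empty (not_lt.2 ht)])).symm
  · simp_rw [split_half f g t]
    exact (integrable_half hf.toCausal hg ht).add (integrable_half' hf hg.toCausal ht)

lemma conv_eq_half_add_half (hf : CausalContinuous f) (hg : CausalContinuous g) {t : ℝ}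
    (ht : 0 < t) :
    conv f g t = (∫ s, (Iic (t / 2)).indicator f s * g (t - s)) +
      ∫ s, (Iic (t / 2)).indicator g s * f (t - s) := by
  have h1 : ∫ s, (Iic (t / 2)).indicator g s * f (t - s)
      = ∫ s, (Ioi (t / 2)).indicator f s * g (t - s) := by
    rw [integral_congr_ae (half_ae_eq g f t), ← integral_sub_left_eq_self _ volume t]
    exact integral_congr_ae (Eventually.of_forall (half_reflect f g t))
  rw [h1, ← integral_add (integrable_half hf.toCausal hg ht) (integrable_half' hf hg.toCausal ht)]
  exact integral_congr_ae (Eventually.of_forall (split_half f g t))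

protected lemma conv (hf : CausalContinuous f) (hg : CausalContinuous g) :
    CausalContinuous (conv f g) where
  toCausal := hf.toCausal.conv hg.toCausal
  cont := by
    have h : ContinuousOn (fun t => (∫ s, (Iic (t / 2)).indicator f s * g (t - s)) +
        ∫ s, (Iic (t / 2)).indicator g s * f (t - s)) (Ioi 0) := fun t ht =>
      ((continuousAt_half hf.toCausal hg ht).add
        (continuousAt_half hg.toCausal hf ht)).continuousWithinAt
    exact h.congr fun t ht => conv_eq_half_add_half hf hg ht

lemma conv_assoc (hf : CausalContinuous f) (hg : CausalContinuous g) (hh : CausalContinuous h)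
    (t : ℝ) : conv (conv f g) h t = conv f (conv g h) t :=
  convolution_assoc _ _ _ _ (fun x y z => mul_assoc x y z) hf.aestronglyMeasurable
    hg.aestronglyMeasurable hh.aestronglyMeasurable
    (Eventually.of_forall (hf.convolutionExists hg))
    (Eventually.of_forall (hg.norm.convolutionExists hh.norm))
    (hf.norm.convolutionExists (hg.norm.conv hh.norm) t)

end CausalContinuous

lemma norm_conv_le (f g : ℝ → 𝕜) (t : ℝ) :
    ‖conv f g t‖ ≤ conv (fun s => ‖f s‖) (fun s => ‖g s‖) t := by
  rw [conv_apply, conv_apply]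
  refine (norm_integral_le_integral_norm _).trans_eq ?_
  simp_rw [norm_mul]

lemma norm_conv_le_of_le {f g : ℝ → 𝕜} {F G : ℝ → ℝ} (hF : CausalContinuous F)
    (hG : CausalContinuous G) (hf : ∀ t, ‖f t‖ ≤ F t) (hg : ∀ t, ‖g t‖ ≤ G t) (t : ℝ) :
    ‖conv f g t‖ ≤ conv F G t := by
  refine (norm_conv_le f g t).trans ?_
  refine integral_mono_of_nonneg (Eventually.of_forall fun s => ?_)
    (hF.convolutionExists hG t) (Eventually.of_forall fun s => ?_)
  · exact mul_nonneg (norm_nonneg _) (norm_nonneg _)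
  · exact mul_le_mul (hf s) (hg _) (norm_nonneg _) ((norm_nonneg _).trans (hf s))

end Causal

section

variable {𝕜 : Type*} [RCLike 𝕜]

lemma conv_const_mul_right (f g : ℝ → 𝕜) (c : 𝕜) (t : ℝ) :
    conv f (fun s => c * g s) t = c * conv f g t := by
  rw [conv_apply, conv_apply, ← integral_const_mul]
  congr 1
  funext s
  ring

lemma conv_add_right {f g h : ℝ → 𝕜} (hf : CausalContinuous f) (hg : CausalContinuous g)
    (hh : CausalContinuous h) (t : ℝ) :
    conv f (fun s => g s + h s) t = conv f g t + conv f h t := by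
  refine Eq.trans (integral_congr_ae (Eventually.of_forall fun s => ?_))
    (integral_add (hf.convolutionExists hg t) (hf.convolutionExists hh t))
  exact mul_add _ _ _

lemma conv_ofReal (f g : ℝ → ℝ) (t : ℝ) :
    conv (fun s => ((f s : ℝ) : ℂ)) (fun s => ((g s : ℝ) : ℂ)) t = ((conv f g t : ℝ) : ℂ) := by
  rw [conv_apply, conv_apply, ← integral_complex_ofReal]
  push_cast
  rfl

end

/-! ### Riemann–Liouville kernels -/

/-- The kernel `t ^ (a - 1) / Γ(a)` of the fractional integral of order `a`, extended by `0` to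
`t ≤ 0`. -/
noncomputable def rlKernel (a : ℝ) : ℝ → ℝ :=
  (Ioi 0).indicator fun t => t ^ (a - 1) / Real.Gamma a

/-- The kernel `rlKernel`, with complex values. -/
noncomputable def rlKernelC (a t : ℝ) : ℂ := (rlKernel a t : ℝ)

lemma rlKernel_of_pos (a : ℝ) {t : ℝ} (ht : 0 < t) :
    rlKernel a t = t ^ (a - 1) / Real.Gamma a := indicator_of_mem (mem_Ioi.2 ht) _

lemma rlKernel_one {t : ℝ} (ht : 0 < t) : rlKernel 1 t = 1 := by
  simp [rlKernel_of_pos 1 ht]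

lemma rlKernel_nonneg {a : ℝ} (ha : 0 < a) (t : ℝ) : 0 ≤ rlKernel a t := by
  refine indicator_nonneg (fun s hs => ?_) t
  have := Real.Gamma_pos_of_pos ha
  have : 0 < s := hs
  positivity

lemma norm_rlKernelC {a : ℝ} (ha : 0 < a) (t : ℝ) : ‖rlKernelC a t‖ = rlKernel a t := by
  rw [rlKernelC, Complex.norm_real, Real.norm_of_nonneg (rlKernel_nonneg ha t)]

lemma causalContinuous_rlKernel {a : ℝ} (ha : 0 < a) : CausalContinuous (rlKernel a) := by
  refine CausalContinuous.of_indicator ?_ fun T hT => ?_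
  · exact (ContinuousOn.rpow_const continuousOn_id fun x hx => Or.inl (ne_of_gt hx)).div_const _
  · have h := intervalIntegral.intervalIntegrable_rpow' (a := 0) (b := T)
      (by linarith : -1 < a - 1)
    exact ((intervalIntegrable_iff_integrableOn_Ioc_of_le hT.le).1 h).div_const _

lemma CausalContinuous.ofReal {f : ℝ → ℝ} (hf : CausalContinuous f) :
    CausalContinuous fun t => ((f t : ℝ) : ℂ) where
  zero t ht := by simp [hf.zero t ht]
  int T := (hf.int T).ofReal
  cont := Complex.continuous_ofReal.comp_continuousOn hf.cont

lemma causalContinuous_rlKernelC {a : ℝ} (ha : 0 < a) : CausalContinuous (rlKernelC a) :=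
  (causalContinuous_rlKernel ha).ofReal

/-- The semigroup property of fractional integration, from the Beta integral. -/
lemma conv_rlKernel {a b : ℝ} (ha : 0 < a) (hb : 0 < b) (t : ℝ) :
    conv (rlKernel a) (rlKernel b) t = rlKernel (a + b) t := by
  have hka := causalContinuous_rlKernel ha
  have hkb := causalContinuous_rlKernel hb
  rcases le_or_gt t 0 with ht | ht
  · rw [Causal.conv_of_nonpos hka.zero hkb.zero ht,
      (causalContinuous_rlKernel (by positivity : 0 < a + b)).zero t ht]
  have hΓa := (Real.Gamma_pos_of_pos ha).ne'
  have hΓb := (Real.Gamma_pos_of_pos hb).ne'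
  have key := Complex.betaIntegral_scaled a b ht
  rw [Complex.betaIntegral_eq_Gamma_mul_div _ _ (by simpa) (by simpa)] at key
  have key2 : ((∫ s in (0 : ℝ)..t, s ^ (a - 1) * (t - s) ^ (b - 1) : ℝ) : ℂ)
      = ((t ^ (a + b - 1) * (Real.Gamma a * Real.Gamma b / Real.Gamma (a + b)) : ℝ) : ℂ) := by
    rw [← intervalIntegral.integral_ofReal]
    push_cast
    rw [← Complex.Gamma_ofReal, ← Complex.Gamma_ofReal, ← Complex.Gamma_ofReal,
      Complex.ofReal_cpow ht.le]
    push_cast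
    rw [← key]
    refine intervalIntegral.integral_congr fun s hs => ?_
    rw [uIcc_of_le ht.le] at hs
    rw [Complex.ofReal_cpow hs.1, Complex.ofReal_cpow (by linarith [hs.2])]
    push_cast
    rfl
  have key3 := Complex.ofReal_injective key2
  rw [Causal.conv_eq_integral hka.zero hkb.zero ht.le, rlKernel_of_pos _ ht]
  have h1 : ∫ s in (0 : ℝ)..t, rlKernel a s * rlKernel b (t - s)
      = ∫ s in (0 : ℝ)..t,
        (Real.Gamma a * Real.Gamma b)⁻¹ * (s ^ (a - 1) * (t - s) ^ (b - 1)) := by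
    rw [intervalIntegral.integral_of_le ht.le, intervalIntegral.integral_of_le ht.le,
      integral_Ioc_eq_integral_Ioo, integral_Ioc_eq_integral_Ioo]
    refine setIntegral_congr_fun measurableSet_Ioo fun s hs => ?_
    rw [rlKernel_of_pos _ hs.1, rlKernel_of_pos _ (by linarith [hs.2])]
    field_simp
  rw [h1, intervalIntegral.integral_const_mul, key3]
  field_simp

lemma conv_rlKernelC {a b : ℝ} (ha : 0 < a) (hb : 0 < b) :
    conv (rlKernelC a) (rlKernelC b) = rlKernelC (a + b) := by
  funext t
  rw [rlKernelC, ← conv_rlKernel ha hb, ← conv_ofReal]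
  rfl

lemma conv_rlKernelC_one {f : ℝ → ℂ} (hf : ∀ t ≤ 0, f t = 0) {t : ℝ} (ht : 0 ≤ t) :
    conv (rlKernelC 1) f t = ∫ s in (0 : ℝ)..t, f s := by
  rw [Causal.conv_eq_integral' (causalContinuous_rlKernelC one_pos).zero hf ht,
    intervalIntegral.integral_of_le ht, intervalIntegral.integral_of_le ht,
    integral_Ioc_eq_integral_Ioo, integral_Ioc_eq_integral_Ioo]
  refine setIntegral_congr_fun measurableSet_Ioo fun s hs => ?_
  rw [rlKernelC, rlKernel_one (by linarith [hs.2]), Complex.ofReal_one, one_mul]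

lemma intervalIntegral_indicator_Ioi (u : ℝ → ℂ) {t : ℝ} (ht : 0 ≤ t) :
    ∫ s in (0 : ℝ)..t, (Ioi 0).indicator u s = ∫ s in (0 : ℝ)..t, u s := by
  rw [intervalIntegral.integral_of_le ht, intervalIntegral.integral_of_le ht]
  exact setIntegral_congr_fun measurableSet_Ioc fun s hs => indicator_of_mem (mem_Ioi.2 hs.1) u

lemma rlIntegral_eq_conv {ν : ℝ} (hν : 0 < ν) (u : ℝ → ℂ) {t : ℝ} (ht : 0 < t) :
    rlIntegral ν u t = conv (rlKernelC ν) ((Ioi 0).indicator u) t := by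
  rw [rlIntegral, if_neg hν.ne', Causal.conv_eq_integral' (causalContinuous_rlKernelC hν).zero
      (fun t ht => indicator_of_notMem (by simpa using ht) _) ht.le,
    ← intervalIntegral.integral_const_mul, intervalIntegral.integral_of_le ht.le,
    intervalIntegral.integral_of_le ht.le, integral_Ioc_eq_integral_Ioo,
    integral_Ioc_eq_integral_Ioo]
  refine setIntegral_congr_fun measurableSet_Ioo fun s hs => ?_
  rw [rlKernelC, rlKernel_of_pos _ (by linarith [hs.2]), indicator_of_mem (mem_Ioi.2 hs.1)]
  push_cast
  ring

lemma indicator_rlIntegral {ν : ℝ} (hν : 0 < ν) (u : ℝ → ℂ) :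
    (Ioi 0).indicator (rlIntegral ν u) = conv (rlKernelC ν) ((Ioi 0).indicator u) := by
  funext t
  rcases le_or_gt t 0 with ht | ht
  · rw [indicator_of_notMem (by simpa using ht), Causal.conv_of_nonpos
      (causalContinuous_rlKernelC hν).zero
      (fun t ht => indicator_of_notMem (by simpa using ht) _) ht]
  · rw [indicator_of_mem (mem_Ioi.2 ht), rlIntegral_eq_conv hν u ht]

lemma rlIntegral_zero (u : ℝ → ℂ) : rlIntegral 0 u = u := by
  funext t
  simp [rlIntegral]

lemma rlIntegral_one (u : ℝ → ℂ) : rlIntegral 1 u = fun t => ∫ s in (0 : ℝ)..t, u s := by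
  funext t
  simp [rlIntegral]

section

variable {u : ℝ → ℂ} {α : ℝ}

lemma hasDerivAt_integral_of_causal {t : ℝ} (hc : ContinuousOn u (Ioi 0))
    (hi : ∀ T, 0 < T → IntegrableOn u (Ioc 0 T)) (ht : 0 < t) :
    HasDerivAt (fun t => ∫ s in (0 : ℝ)..t, u s) (u t) t := by
  refine intervalIntegral.integral_hasDerivAt_right
    ((intervalIntegrable_iff_integrableOn_Ioc_of_le ht.le).2 (hi t ht)) ?_
    (hc.continuousAt (Ioi_mem_nhds ht))
  exact hc.stronglyMeasurableAtFilter isOpen_Ioi t ht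

/-- For `0 < α ≤ 1` the Riemann–Liouville derivative is the derivative of the integral of order
`1 - α`. At `α = 1` this removes the integration and differentiation that cancel. -/
lemma hasRLDerivAt_iff (hα0 : 0 < α) (hα1 : α ≤ 1) (hc : ContinuousOn u (Ioi 0))
    (hi : ∀ T, 0 < T → IntegrableOn u (Ioc 0 T)) {t : ℝ} (ht : 0 < t) (v : ℂ) :
    HasRLDerivAt α u v t ↔ HasDerivAt (rlIntegral (1 - α) u) v t := by
  rcases hα1.lt_or_eq with h | rfl
  · have hf : ⌊α⌋₊ = 0 := Nat.floor_eq_zero.2 h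
    simp [HasRLDerivAt, hf]
  · have e : ((1 : ℕ) : ℝ) + 1 - 1 = 1 := by norm_num
    simp only [HasRLDerivAt, Nat.floor_one, e, iteratedDeriv_one, sub_self, rlIntegral_zero,
      rlIntegral_one]
    have h1 : ∀ᶠ s in 𝓝 t, HasDerivAt (fun t => ∫ s in (0 : ℝ)..t, u s) (u s) s := by
      filter_upwards [Ioi_mem_nhds ht] with s hs using hasDerivAt_integral_of_causal hc hi hs
    have h2 : deriv (fun t => ∫ s in (0 : ℝ)..t, u s) =ᶠ[𝓝 t] u := h1.mono fun s hs => hs.deriv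
    rw [h2.hasDerivAt_iff]
    refine ⟨fun h => h.2, fun h => ⟨fun i hi => ?_, h⟩⟩
    obtain rfl : i = 0 := by omega
    simp only [iteratedDeriv_zero]
    exact h1.mono fun s hs => hs.differentiableAt

/-- Fractional integration of order `α` after one of order `1 - α` is integration. -/
lemma conv_rlKernelC_indicator_rlIntegral (hα0 : 0 < α) (hα1 : α ≤ 1)
    (hc : ContinuousOn u (Ioi 0)) (hi : ∀ T, 0 < T → IntegrableOn u (Ioc 0 T)) {t : ℝ}
    (ht : 0 ≤ t) :
    conv (rlKernelC α) ((Ioi 0).indicator (rlIntegral (1 - α) u)) t = ∫ s in (0 : ℝ)..t, u s := by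
  have hu := CausalContinuous.of_indicator hc hi
  rw [← intervalIntegral_indicator_Ioi u ht, ← conv_rlKernelC_one hu.zero ht]
  rcases hα1.lt_or_eq with h | rfl
  · have h' : 0 < 1 - α := by linarith
    rw [indicator_rlIntegral h', ← CausalContinuous.conv_assoc (causalContinuous_rlKernelC hα0)
      (causalContinuous_rlKernelC h') hu, conv_rlKernelC hα0 h', add_sub_cancel]
  · simp only [sub_self, rlIntegral_zero]

end

/-! ### The scalar relaxation equation -/

/-- The function `t ^ (α - 1) * E_{α,α}(-b t ^ α)`, extended by `0` to `t ≤ 0`: the fundamental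
solution of `D^α v = -b v`. -/
noncomputable def mlKernel (α : ℝ) (b : ℂ) : ℝ → ℂ :=
  (Ioi 0).indicator fun t =>
    ((t ^ (α - 1) : ℝ) : ℂ) * mittagLeffler α α (-b * ((t ^ α : ℝ) : ℂ))

lemma mlKernel_of_pos (α : ℝ) (b : ℂ) {t : ℝ} (ht : 0 < t) : mlKernel α b t =
    ((t ^ (α - 1) : ℝ) : ℂ) * mittagLeffler α α (-b * ((t ^ α : ℝ) : ℂ)) :=
  indicator_of_mem (mem_Ioi.2 ht) _

lemma norm_mlKernel_le {α : ℝ} (hα0 : 0 < α) (hα1 : α ≤ 1) {b : ℂ} (hb : 0 ≤ b.re) (t : ℝ) :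
    ‖mlKernel α b t‖ ≤ rlKernel α t := by
  rcases le_or_gt t 0 with ht | ht
  · rw [mlKernel, indicator_of_notMem (by simpa using ht), norm_zero]
    exact rlKernel_nonneg hα0 t
  · rw [mlKernel_of_pos _ _ ht, rlKernel_of_pos _ ht, norm_mul, Complex.norm_real,
      Real.norm_of_nonneg (by positivity), div_eq_mul_one_div, neg_mul]
    refine mul_le_mul_of_nonneg_left (norm_mittagLeffler_neg_le hα0 hα1 ?_) (by positivity)
    rw [Complex.re_mul_ofReal]
    positivity

lemma continuousOn_mlKernel {α : ℝ} (hα0 : 0 < α) (hα1 : α ≤ 1) (b : ℂ) :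
    ContinuousOn (mlKernel α b) (Ioi 0) := by
  have h : ContinuousOn (fun t : ℝ =>
      ((t ^ (α - 1) : ℝ) : ℂ) * mittagLeffler α α (-b * ((t ^ α : ℝ) : ℂ))) (Ioi 0) := by
    have hr (p : ℝ) : ContinuousOn (fun t : ℝ => ((t ^ p : ℝ) : ℂ)) (Ioi 0) :=
      Complex.continuous_ofReal.comp_continuousOn
        (ContinuousOn.rpow_const continuousOn_id fun x hx => Or.inl (ne_of_gt hx))
    exact (hr _).mul ((continuous_mittagLeffler hα0 hα1).comp_continuousOn
      (continuousOn_const.mul (hr _)))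
  exact h.congr fun t ht => mlKernel_of_pos α b ht

lemma causalContinuous_mlKernel {α : ℝ} (hα0 : 0 < α) (hα1 : α ≤ 1) {b : ℂ} (hb : 0 ≤ b.re) :
    CausalContinuous (mlKernel α b) where
  zero t ht := indicator_of_notMem (by simpa using ht) _
  int T := by
    have hm : AEStronglyMeasurable (mlKernel α b) := by
      have h := (continuousOn_mlKernel hα0 hα1 b).aestronglyMeasurable (μ := volume)
        measurableSet_Ioi
      rw [← aestronglyMeasurable_indicator_iff measurableSet_Ioi] at h
      rwa [mlKernel, indicator_indicator, inter_self] at h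
    exact ((causalContinuous_rlKernel hα0).int T).mono' hm.restrict
      (Eventually.of_forall (norm_mlKernel_le hα0 hα1 hb))
  cont := continuousOn_mlKernel hα0 hα1 b

lemma rlKernel_series_term (α : ℝ) (m : ℕ) {t : ℝ} (ht : 0 < t) :
    rlKernel (α * (m + 1)) t = t ^ (α - 1) * ((t ^ α) ^ m / Real.Gamma (α * m + α)) := by
  have e : α * ((m : ℝ) + 1) - 1 = (α - 1) + α * m := by ring
  have e' : α * ((m : ℝ) + 1) = α * m + α := by ring
  rw [rlKernel_of_pos _ ht, e, Real.rpow_add ht, Real.rpow_mul ht.le, Real.rpow_natCast, e']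
  ring

lemma hasSum_mlKernel {α : ℝ} (hα0 : 0 < α) (hα1 : α ≤ 1) (b : ℂ) (t : ℝ) :
    HasSum (fun m : ℕ => (-b) ^ m * rlKernelC (α * (m + 1)) t) (mlKernel α b t) := by
  rcases le_or_gt t 0 with ht | ht
  · rw [mlKernel, indicator_of_notMem (by simpa using ht)]
    refine hasSum_zero.congr_fun fun m => ?_
    rw [(causalContinuous_rlKernelC (by positivity)).zero t ht, mul_zero]
  · rw [mlKernel_of_pos _ _ ht]
    refine ((summable_mittagLeffler hα0 hα1 (-b * ((t ^ α : ℝ) : ℂ))).hasSum.mul_left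
      ((t ^ (α - 1) : ℝ) : ℂ)).congr_fun fun m => ?_
    rw [rlKernelC, rlKernel_series_term α m ht, mul_pow]
    push_cast
    ring

lemma summable_rlKernel_series {α : ℝ} (hα0 : 0 < α) (hα1 : α ≤ 1) {r : ℝ} (hr : 0 ≤ r)
    {t : ℝ} (ht : 0 < t) : Summable fun m : ℕ => r ^ m * rlKernel (α * (m + 1)) t := by
  refine ((summable_pow_div_Gamma hα0 hα1
    (by positivity : 0 ≤ r * t ^ α)).mul_left (t ^ (α - 1))).congr fun m => ?_
  rw [rlKernel_series_term α m ht, mul_pow]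
  ring

/-- The Volterra equation of the fundamental solution. -/
lemma mlKernel_volterra {α : ℝ} (hα0 : 0 < α) (hα1 : α ≤ 1) (b : ℂ) (t : ℝ) :
    mlKernel α b t = rlKernelC α t - b * conv (rlKernelC α) (mlKernel α b) t := by
  have hk := causalContinuous_rlKernelC hα0
  have hz : ∀ t ≤ 0, mlKernel α b t = 0 := fun t ht => indicator_of_notMem (by simpa using ht) _
  rcases le_or_gt t 0 with ht | ht
  · rw [hz t ht, hk.zero t ht, Causal.conv_of_nonpos hk.zero hz ht]
    simp
  have hkm (m : ℕ) : CausalContinuous (rlKernelC (α * (m + 1))) :=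
    causalContinuous_rlKernelC (by positivity)
  let F : ℕ → ℝ → ℂ := fun m s =>
    (-b) ^ (m + 1) * (rlKernelC α s * rlKernelC (α * (m + 1)) (t - s))
  have e (m : ℕ) : α + α * ((m : ℝ) + 1) = α * (((m + 1 : ℕ) : ℝ) + 1) := by push_cast; ring
  have hF1 (m : ℕ) : Integrable (F m) := (hk.convolutionExists (hkm m) t).const_mul _
  have hF2 (m : ℕ) : ∫ s, ‖F m s‖ = ‖b‖ ^ (m + 1) * rlKernel (α * (((m + 1 : ℕ) : ℝ) + 1)) t := by
    rw [← e, ← conv_rlKernel hα0 (by positivity), conv_apply, ← integral_const_mul]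
    congr 1
    funext s
    rw [norm_mul, norm_mul, norm_pow, norm_neg, norm_rlKernelC hα0,
      norm_rlKernelC (by positivity)]
  have hF3 : Summable fun m => ∫ s, ‖F m s‖ := by
    simp_rw [hF2]
    exact (summable_nat_add_iff 1).2 (summable_rlKernel_series hα0 hα1 (norm_nonneg b) ht)
  have h1 := hasSum_integral_of_summable_integral_norm hF1 hF3
  have h2 : ∫ s, ∑' m, F m s = -b * conv (rlKernelC α) (mlKernel α b) t := by
    rw [conv_apply, ← integral_const_mul]
    congr 1
    funext s
    have := ((hasSum_mlKernel hα0 hα1 b (t - s)).mul_left (rlKernelC α s)).mul_left (-b)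
    rw [← this.tsum_eq]
    refine tsum_congr fun m => ?_
    simp only [F, pow_succ]
    ring
  have h3 (m : ℕ) : ∫ s, F m s = (-b) ^ (m + 1) * rlKernelC (α * (((m + 1 : ℕ) : ℝ) + 1)) t := by
    rw [← e, ← conv_rlKernelC hα0 (by positivity), conv_apply, ← integral_const_mul]
  rw [h2] at h1
  simp_rw [h3] at h1
  have h4 := (hasSum_nat_add_iff' 1).2 (hasSum_mlKernel hα0 hα1 b t)
  have h5 := h1.unique h4
  simp only [Finset.range_one, Finset.sum_singleton, pow_zero, Nat.cast_zero, zero_add, mul_one,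
    one_mul] at h5
  linear_combination -h5

/-- The homogeneous Volterra equation has only the zero solution: iterating it bounds a solution by
the terms of a convergent Mittag-Leffler series. -/
lemma eq_zero_of_volterra {α : ℝ} (hα0 : 0 < α) (hα1 : α ≤ 1) {b : ℂ} {G : ℝ → ℂ}
    (hG : CausalContinuous G) (h : ∀ t, 0 < t → G t = -b * conv (rlKernelC α) G t) (t : ℝ) :
    G t = 0 := by
  rcases le_or_gt t 0 with ht | ht
  · exact hG.zero t ht
  have hk := causalContinuous_rlKernel hα0
  have h0 (s : ℝ) : ‖G s‖ ≤ ‖b‖ * conv (rlKernel α) (fun s => ‖G s‖) s := by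
    rcases le_or_gt s 0 with hs | hs
    · rw [hG.zero s hs, norm_zero, Causal.conv_of_nonpos hk.zero hG.norm.zero hs, mul_zero]
    · rw [h s hs, norm_mul, norm_neg]
      refine mul_le_mul_of_nonneg_left ?_ (norm_nonneg b)
      exact norm_conv_le_of_le hk hG.norm (fun s => (norm_rlKernelC hα0 s).le) (fun s => le_rfl) s
  have h1 (n : ℕ) (s : ℝ) :
      ‖G s‖ ≤ ‖b‖ ^ (n + 1) * conv (rlKernel (α * (n + 1))) (fun s => ‖G s‖) s := by
    induction n generalizing s with
    | zero => simpa using h0 s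
    | succ n ih =>
      have hkn := causalContinuous_rlKernel (by positivity : 0 < α * ((n : ℝ) + 1))
      have h2 := norm_conv_le_of_le (f := rlKernel α) (g := fun s => ‖G s‖) hk
        ((hkn.conv hG.norm).const_mul (‖b‖ ^ (n + 1)))
        (fun s => (Real.norm_of_nonneg (rlKernel_nonneg hα0 s)).le)
        (fun s => (norm_norm _).trans_le (ih s)) s
      rw [conv_const_mul_right, ← CausalContinuous.conv_assoc hk hkn hG.norm] at h2
      have e : α + α * ((n : ℝ) + 1) = α * (((n + 1 : ℕ) : ℝ) + 1) := by push_cast; ring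
      rw [funext (conv_rlKernel hα0 (by positivity : 0 < α * ((n : ℝ) + 1))), e] at h2
      calc ‖G s‖ ≤ ‖b‖ * conv (rlKernel α) (fun s => ‖G s‖) s := h0 s
        _ ≤ ‖b‖ * (‖b‖ ^ (n + 1) * conv (rlKernel (α * (((n + 1 : ℕ) : ℝ) + 1)))
            (fun s => ‖G s‖) s) :=
          mul_le_mul_of_nonneg_left ((le_abs_self _).trans h2) (norm_nonneg b)
        _ = _ := by ring
  -- once `α (n + 1) ≥ 1`, the kernel of order `α (n + 1)` increases on `(0, t]`
  have h2 : ∀ᶠ n : ℕ in atTop, ‖G t‖ ≤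
      (‖b‖ ^ n * rlKernel (α * (n + 1)) t) * (‖b‖ * ∫ s in (0 : ℝ)..t, ‖G s‖) := by
    obtain ⟨n₀, hn₀⟩ := exists_nat_ge (1 / α)
    filter_upwards [eventually_ge_atTop n₀] with n hn
    have hn1 : 1 ≤ α * (n + 1) := by
      have : 1 / α ≤ n + 1 := hn₀.trans (by exact_mod_cast (by omega : n₀ ≤ n + 1))
      rwa [div_le_iff₀ hα0, mul_comm] at this
    have hkn := causalContinuous_rlKernel (by positivity : 0 < α * ((n : ℝ) + 1))
    have h3 : conv (rlKernel (α * (n + 1))) (fun s => ‖G s‖) t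
        ≤ ∫ s in (0 : ℝ)..t, rlKernel (α * (n + 1)) t * ‖G s‖ := by
      rw [Causal.conv_eq_integral' hkn.zero hG.norm.zero ht.le,
        intervalIntegral.integral_of_le ht.le, intervalIntegral.integral_of_le ht.le,
        integral_Ioc_eq_integral_Ioo, integral_Ioc_eq_integral_Ioo]
      refine integral_mono_of_nonneg (Eventually.of_forall fun s =>
        mul_nonneg (rlKernel_nonneg (by positivity) _) (norm_nonneg _)) ?_ ?_
      · exact ((hG.norm.integrableOn_Ioc t).mono_set Ioo_subset_Ioc_self).const_mul _
      · refine (ae_restrict_mem measurableSet_Ioo).mono fun s hs => ?_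
        refine mul_le_mul_of_nonneg_right ?_ (norm_nonneg _)
        have hΓ := Real.Gamma_pos_of_pos (by positivity : 0 < α * ((n : ℝ) + 1))
        rw [rlKernel_of_pos _ ht, rlKernel_of_pos _ (by linarith [hs.2])]
        exact div_le_div_of_nonneg_right (Real.rpow_le_rpow (by linarith [hs.2])
          (by linarith [hs.1]) (by linarith)) hΓ.le
    rw [intervalIntegral.integral_const_mul] at h3
    calc ‖G t‖ ≤ ‖b‖ ^ (n + 1) * conv (rlKernel (α * (n + 1))) (fun s => ‖G s‖) t := h1 n t
      _ ≤ ‖b‖ ^ (n + 1) * (rlKernel (α * (n + 1)) t * ∫ s in (0 : ℝ)..t, ‖G s‖) :=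
        mul_le_mul_of_nonneg_left h3 (by positivity)
      _ = _ := by ring
  have h4 := (summable_rlKernel_series hα0 hα1 (norm_nonneg b) ht).tendsto_atTop_zero.mul_const
    (‖b‖ * ∫ s in (0 : ℝ)..t, ‖G s‖)
  rw [zero_mul] at h4
  exact norm_le_zero_iff.1 (ge_of_tendsto h4 h2)

/-- The solution `c u + u * f` of the scalar problem `D^α v = -b v + f`, `D^{α-1} v (0) = c`, where
`u` is the fundamental solution. -/
noncomputable def mlSolution (α : ℝ) (b c : ℂ) (f : ℝ → ℂ) (t : ℝ) : ℂ :=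
  c * mlKernel α b t + conv (mlKernel α b) f t

section

variable {α : ℝ} {b c : ℂ} {f : ℝ → ℂ}

lemma causalContinuous_mlSolution (hα0 : 0 < α) (hα1 : α ≤ 1) (hb : 0 ≤ b.re)
    (hf : CausalContinuous f) : CausalContinuous (mlSolution α b c f) :=
  ((causalContinuous_mlKernel hα0 hα1 hb).const_mul c).add
    ((causalContinuous_mlKernel hα0 hα1 hb).conv hf)

lemma norm_mlSolution_le (hα0 : 0 < α) (hα1 : α ≤ 1) (hb : 0 ≤ b.re) {m : ℝ → ℝ}
    (hm : CausalContinuous m) (hfm : ∀ t, ‖f t‖ ≤ m t) (t : ℝ) :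
    ‖mlSolution α b c f t‖ ≤ ‖c‖ * rlKernel α t + conv (rlKernel α) m t := by
  refine (norm_add_le _ _).trans (add_le_add ?_ ?_)
  · rw [norm_mul]
    exact mul_le_mul_of_nonneg_left (norm_mlKernel_le hα0 hα1 hb t) (norm_nonneg c)
  · exact norm_conv_le_of_le (causalContinuous_rlKernel hα0) hm (norm_mlKernel_le hα0 hα1 hb) hfm t

lemma mlSolution_volterra (hα0 : 0 < α) (hα1 : α ≤ 1) (hb : 0 ≤ b.re)
    (hf : CausalContinuous f) (t : ℝ) :
    mlSolution α b c f t = c * rlKernelC α t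
      + conv (rlKernelC α) (fun s => -b * mlSolution α b c f s + f s) t := by
  have hu := causalContinuous_mlKernel hα0 hα1 hb
  have hk := causalContinuous_rlKernelC hα0
  have hv := causalContinuous_mlSolution (c := c) hα0 hα1 hb hf
  have h1 : conv (mlKernel α b) f t = conv (rlKernelC α) f t
      - b * conv (rlKernelC α) (conv (mlKernel α b) f) t := by
    have e : mlKernel α b
        = fun s => rlKernelC α s + (-b) * conv (rlKernelC α) (mlKernel α b) s := by
      funext s
      rw [mlKernel_volterra hα0 hα1 b s]
      ring
    rw [← CausalContinuous.conv_assoc hk hu hf, conv_comm (mlKernel α b) f,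
      congrArg (fun g => conv f g t) e, conv_add_right hf hk ((hk.conv hu).const_mul (-b)),
      conv_const_mul_right, conv_comm f, conv_comm f]
    ring
  have h2 : conv (rlKernelC α) (mlSolution α b c f) t
      = c * conv (rlKernelC α) (mlKernel α b) t
        + conv (rlKernelC α) (conv (mlKernel α b) f) t := by
    rw [← conv_const_mul_right]
    exact conv_add_right hk (hu.const_mul c) (hu.conv hf) t
  rw [conv_add_right hk (hv.const_mul (-b)) hf, conv_const_mul_right, h2]
  have h3 := mlKernel_volterra hα0 hα1 b t
  simp only [mlSolution]
  rw [h1]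
  linear_combination c * h3

/-- The integrated form of the scalar problem. -/
lemma rlIntegral_mlSolution (hα0 : 0 < α) (hα1 : α ≤ 1) (hb : 0 ≤ b.re)
    (hf : CausalContinuous f) {t : ℝ} (ht : 0 < t) :
    rlIntegral (1 - α) (mlSolution α b c f) t
      = c + ∫ s in (0 : ℝ)..t, (-b * mlSolution α b c f s + f s) := by
  have hv := causalContinuous_mlSolution (c := c) hα0 hα1 hb hf
  have hw : CausalContinuous fun s => -b * mlSolution α b c f s + f s :=
    (hv.const_mul (-b)).add hf
  have hone : rlKernelC 1 t = 1 := by rw [rlKernelC, rlKernel_one ht, Complex.ofReal_one]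
  rw [← conv_rlKernelC_one hw.zero ht.le]
  rcases hα1.lt_or_eq with h | rfl
  · have h' : 0 < 1 - α := by linarith
    have hk := causalContinuous_rlKernelC hα0
    have hk' := causalContinuous_rlKernelC h'
    have e : (Ioi 0).indicator (mlSolution α b c f) = fun s => c * rlKernelC α s
        + conv (rlKernelC α) (fun s => -b * mlSolution α b c f s + f s) s := by
      funext s
      rw [← mlSolution_volterra hα0 hα1 hb hf]
      rcases le_or_gt s 0 with hs | hs
      · rw [hv.zero s hs, indicator_of_notMem (by simpa using hs)]
      · rw [indicator_of_mem (mem_Ioi.2 hs)]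
    rw [rlIntegral_eq_conv h' _ ht, e, conv_add_right hk' (hk.const_mul c) (hk.conv hw),
      conv_const_mul_right, ← CausalContinuous.conv_assoc hk' hk hw, conv_rlKernelC h' hα0,
      sub_add_cancel, hone, mul_one]
  · rw [sub_self, rlIntegral_zero, mlSolution_volterra hα0 hα1 hb hf, hone, mul_one]

end

/-! ### The Fourier transform in the normalisation `(2π)^{-1/2} ∫ e^{±ikx}` -/

open scoped FourierTransform ContDiff

lemma norm_exp_I_mul_mul (x k : ℝ) : ‖Complex.exp (Complex.I * k * x)‖ = 1 := by
  have e : Complex.I * k * x = ((k * x : ℝ) : ℂ) * Complex.I := by push_cast; ring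
  rw [e, Complex.norm_exp_ofReal_mul_I]

lemma norm_exp_neg_I_mul_mul (x k : ℝ) : ‖Complex.exp (-Complex.I * k * x)‖ = 1 := by
  have e : -Complex.I * k * x = ((-(k * x) : ℝ) : ℂ) * Complex.I := by push_cast; ring
  rw [e, Complex.norm_exp_ofReal_mul_I]

lemma fourierStarInv_eq_fourierStar_neg (h : ℝ → ℂ) (k : ℝ) :
    fourierStarInv h k = fourierStar h (-k) := by
  simp [fourierStarInv, fourierStar]

lemma fourierStarInv_eq (h : ℝ → ℂ) (k : ℝ) :
    fourierStarInv h k = 1 / (√(2 * Real.pi) : ℂ) * 𝓕 h (k / (2 * Real.pi)) := by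
  rw [fourierStarInv, Real.fourier_real_eq_integral_exp_smul]
  congr 2
  funext x
  rw [smul_eq_mul]
  congr 2
  have : (Real.pi : ℂ) ≠ 0 := by exact_mod_cast Real.pi_ne_zero
  push_cast
  field_simp

lemma sqrt_two_pi_sq : (√(2 * Real.pi) : ℂ) * (√(2 * Real.pi) : ℂ) = 2 * Real.pi := by
  rw [← Complex.ofReal_mul, Real.mul_self_sqrt (by positivity)]
  push_cast
  rfl

lemma sqrt_two_pi_ne_zero : (√(2 * Real.pi) : ℂ) ≠ 0 := by
  have : √(2 * Real.pi) ≠ 0 := by positivity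
  exact_mod_cast this

/-- The dilation `x ↦ x / (2π)` of the line. -/
noncomputable def twoPiDilation : ℝ ≃L[ℝ] ℝ :=
  ContinuousLinearEquiv.unitsEquivAut ℝ (Units.mk0 (2 * Real.pi)⁻¹ (by positivity))

lemma twoPiDilation_apply (x : ℝ) : twoPiDilation x = x / (2 * Real.pi) := by
  simp [twoPiDilation, ContinuousLinearEquiv.unitsEquivAut_apply, div_eq_mul_inv]

/-- The transform `fourierStarInv` as a continuous linear map of the Schwartz space. -/
noncomputable def fourierStarInvCLM : 𝓢(ℝ, ℂ) →L[ℂ] 𝓢(ℝ, ℂ) :=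
  (1 / (√(2 * Real.pi) : ℂ)) • (SchwartzMap.compCLMOfContinuousLinearEquiv ℂ twoPiDilation).comp
    (SchwartzMap.fourierTransformCLM ℂ)

lemma fourierStarInvCLM_apply (ψ : 𝓢(ℝ, ℂ)) (k : ℝ) :
    fourierStarInvCLM ψ k = fourierStarInv ψ k := by
  rw [fourierStarInv_eq, ← twoPiDilation_apply]
  rfl

lemma fourierStarInvCLM_surjective : Function.Surjective fourierStarInvCLM := by
  intro g
  refine ⟨(√(2 * Real.pi) : ℂ) •
    𝓕⁻ (SchwartzMap.compCLMOfContinuousLinearEquiv ℂ twoPiDilation.symm g), ?_⟩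
  ext k
  have h : fourierStarInvCLM ((√(2 * Real.pi) : ℂ) •
      𝓕⁻ (SchwartzMap.compCLMOfContinuousLinearEquiv ℂ twoPiDilation.symm g)) k =
      (√(2 * Real.pi) : ℂ) * ((1 / (√(2 * Real.pi) : ℂ)) *
        (𝓕 (𝓕⁻ (SchwartzMap.compCLMOfContinuousLinearEquiv ℂ twoPiDilation.symm g)))
          (twoPiDilation k)) := by
    rw [map_smul]
    rfl
  rw [h, FourierTransform.fourier_fourierInv_eq]
  have := sqrt_two_pi_ne_zero
  simp only [SchwartzMap.compCLMOfContinuousLinearEquiv_apply, Function.comp_apply,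
    ContinuousLinearEquiv.symm_apply_apply]
  field_simp

/-- Fourier inversion on the Schwartz space. -/
lemma fourierStar_fourierStarInvCLM (ψ : 𝓢(ℝ, ℂ)) (x : ℝ) :
    fourierStar (fourierStarInvCLM ψ) x = ψ x := by
  have h1 : ∀ k : ℝ, Complex.exp (Complex.I * x * k) * fourierStarInvCLM ψ k
      = (fun u : ℝ => 1 / (√(2 * Real.pi) : ℂ) *
        (Complex.exp (((2 * Real.pi * (u * x) : ℝ) : ℂ) * Complex.I) • 𝓕 (ψ : ℝ → ℂ) u))
          (k / (2 * Real.pi)) := by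
    intro k
    rw [fourierStarInvCLM_apply, fourierStarInv_eq]
    have : (Real.pi : ℂ) ≠ 0 := by exact_mod_cast Real.pi_ne_zero
    have e : Complex.I * x * k
        = ((2 * Real.pi * (k / (2 * Real.pi) * x) : ℝ) : ℂ) * Complex.I := by
      push_cast
      field_simp
    rw [e]
    simp only [smul_eq_mul]
    ring
  have h2 : 𝓕⁻ (𝓕 (ψ : ℝ → ℂ)) x = ψ x := by
    have h3 := congrArg (fun f : 𝓢(ℝ, ℂ) => f x)
      (FourierTransform.fourierInv_fourier_eq (F := 𝓢(ℝ, ℂ)) ψ)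
    simpa only [SchwartzMap.fourierInv_coe, SchwartzMap.fourier_coe] using h3
  have h4 : 𝓕⁻ (𝓕 (ψ : ℝ → ℂ)) x = ∫ u : ℝ,
      Complex.exp (((2 * Real.pi * (u * x) : ℝ) : ℂ) * Complex.I) • 𝓕 (ψ : ℝ → ℂ) u := by
    rw [Real.fourierInv_eq']
    congr 1
    funext u
    simp [mul_comm]
  rw [fourierStar, integral_congr_ae (Eventually.of_forall h1),
    Measure.integral_comp_div (fun u : ℝ => 1 / (√(2 * Real.pi) : ℂ) *
        (Complex.exp (((2 * Real.pi * (u * x) : ℝ) : ℂ) * Complex.I) • 𝓕 (ψ : ℝ → ℂ) u))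
      (2 * Real.pi), integral_const_mul, ← h4, h2,
    abs_of_pos (by positivity), Complex.real_smul]
  have h5 := sqrt_two_pi_sq
  have := sqrt_two_pi_ne_zero
  have h6 : (Real.pi : ℂ) ≠ 0 := by exact_mod_cast Real.pi_ne_zero
  push_cast
  rw [← h5]
  field_simp

lemma integral_fourierStarInvCLM (ψ : 𝓢(ℝ, ℂ)) :
    1 / (√(2 * Real.pi) : ℂ) * ∫ k, fourierStarInvCLM ψ k = ψ 0 := by
  rw [← fourierStar_fourierStarInvCLM ψ 0]
  simp [fourierStar]

lemma integrable_exp_mul {f : ℝ → ℂ} (hf : Integrable f) (k : ℝ) :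
    Integrable fun x : ℝ => Complex.exp (Complex.I * k * x) * f x :=
  hf.bdd_mul (c := 1) (by fun_prop) (Eventually.of_forall fun x => (norm_exp_I_mul_mul x k).le)

lemma norm_fourierStar_le (f : ℝ → ℂ) (k : ℝ) :
    ‖fourierStar f k‖ ≤ 1 / √(2 * Real.pi) * ∫ x, ‖f x‖ := by
  rw [fourierStar, norm_mul, norm_div, norm_one, Complex.norm_real,
    Real.norm_of_nonneg (by positivity)]
  refine mul_le_mul_of_nonneg_left ((norm_integral_le_integral_norm _).trans_eq ?_) (by positivity)
  simp_rw [norm_mul, norm_exp_I_mul_mul, one_mul]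

lemma fourierStar_sub {f g : ℝ → ℂ} (hf : Integrable f) (hg : Integrable g) (k : ℝ) :
    fourierStar f k - fourierStar g k = fourierStar (fun x => f x - g x) k := by
  simp only [fourierStar, mul_sub]
  rw [integral_sub (integrable_exp_mul hf k) (integrable_exp_mul hg k), mul_sub]

lemma continuous_fourierStarInv {h : ℝ → ℂ} (hh : Integrable h) :
    Continuous (fourierStarInv h) := by
  have h1 : Continuous (𝓕 h) :=
    VectorFourier.fourierIntegral_continuous Real.continuous_fourierChar
      (by exact continuous_inner) hh
  have h2 : fourierStarInv h
      = fun k => 1 / (√(2 * Real.pi) : ℂ) * 𝓕 h (k / (2 * Real.pi)) :=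
    funext (fourierStarInv_eq h)
  rw [h2]
  exact continuous_const.mul (h1.comp (by fun_prop))

lemma continuous_fourierStar {h : ℝ → ℂ} (hh : Integrable h) : Continuous (fourierStar h) := by
  have e : fourierStar h = fun k => fourierStarInv h (-k) := by
    funext k
    rw [fourierStarInv_eq_fourierStar_neg, neg_neg]
  rw [e]
  exact (continuous_fourierStarInv hh).comp continuous_neg

/-- The Riemann–Lebesgue lemma. -/
lemma tendsto_fourierStarInv_cocompact (h : ℝ → ℂ) :
    Tendsto (fourierStarInv h) (cocompact ℝ) (𝓝 0) := by
  have h2 : fourierStarInv h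
      = fun k => 1 / (√(2 * Real.pi) : ℂ) * 𝓕 h (k * (2 * Real.pi)⁻¹) := by
    funext k
    rw [fourierStarInv_eq, div_eq_mul_inv k]
  have h3 : Tendsto (fun k : ℝ => k * (2 * Real.pi)⁻¹) (cocompact ℝ) (cocompact ℝ) :=
    Filter.tendsto_cocompact_mul_right₀ (by positivity)
  have h4 := ((Real.zero_at_infty_fourier h).comp h3).const_mul (1 / (√(2 * Real.pi) : ℂ))
  rw [mul_zero] at h4
  rw [h2]
  exact h4

lemma integral_integral_mul_swap {f h : ℝ → ℂ} (hf : Integrable f) (hh : Integrable h)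
    {e : ℝ → ℝ → ℂ} (he : Continuous (Function.uncurry e)) (he1 : ∀ k x, ‖e k x‖ = 1) :
    ∫ k, (∫ x, e k x * f x) * h k = ∫ x, f x * ∫ k, e k x * h k := by
  have hint : Integrable (Function.uncurry fun k x => e k x * (h k * f x)) (volume.prod volume) :=
    (hh.mul_prod hf).bdd_mul (c := 1) he.aestronglyMeasurable
      (Eventually.of_forall fun p => (he1 p.1 p.2).le)
  simp_rw [← integral_mul_const, ← integral_const_mul]
  have e1 : ∀ k x, e k x * f x * h k = e k x * (h k * f x) := fun k x => by ring
  have e2 : ∀ k x, f x * (e k x * h k) = e k x * (h k * f x) := fun k x => by ring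
  simp_rw [e1, e2]
  exact integral_integral_swap hint

lemma integral_fourierStar_mul {f h : ℝ → ℂ} (hf : Integrable f) (hh : Integrable h) :
    ∫ k, fourierStar f k * h k = ∫ x, f x * fourierStar h x := by
  have h1 := integral_integral_mul_swap hf hh
    (e := fun k x : ℝ => Complex.exp (Complex.I * k * x))
    (by unfold Function.uncurry; fun_prop) (fun k x => norm_exp_I_mul_mul x k)
  simp only [fourierStar, mul_assoc, mul_left_comm _ (1 / (√(2 * Real.pi) : ℂ))] at h1 ⊢
  rw [integral_const_mul, integral_const_mul, h1]
  congr 2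
  funext x
  congr 2
  funext k
  ring_nf

lemma integral_fourierStarInv_mul {f h : ℝ → ℂ} (hf : Integrable f) (hh : Integrable h) :
    ∫ k, fourierStarInv f k * h k = ∫ x, f x * fourierStarInv h x := by
  have h1 := integral_integral_mul_swap hf hh
    (e := fun k x : ℝ => Complex.exp (-Complex.I * k * x))
    (by unfold Function.uncurry; fun_prop) (fun k x => norm_exp_neg_I_mul_mul x k)
  simp only [fourierStarInv, mul_assoc, mul_left_comm _ (1 / (√(2 * Real.pi) : ℂ))] at h1 ⊢
  rw [integral_const_mul, integral_const_mul, h1]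
  congr 2
  funext x
  congr 2
  funext k
  ring_nf

lemma integral_mul_eq_integral_fourierStar_mul {f : ℝ → ℂ} (hf : Integrable f) (ψ : 𝓢(ℝ, ℂ)) :
    ∫ x, f x * ψ x = ∫ k, fourierStar f k * fourierStarInvCLM ψ k := by
  rw [integral_fourierStar_mul hf (fourierStarInvCLM ψ).integrable]
  simp_rw [fourierStar_fourierStarInvCLM]

lemma fourierStarInvCLM_compSubConst (ψ : 𝓢(ℝ, ℂ)) (y k : ℝ) :
    fourierStarInvCLM (SchwartzMap.compSubConstCLM ℂ y ψ) k
      = Complex.exp (-Complex.I * y * k) * fourierStarInvCLM ψ k := by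
  rw [fourierStarInvCLM_apply, fourierStarInvCLM_apply, fourierStarInv, fourierStarInv,
    mul_left_comm, ← integral_const_mul (Complex.exp (-Complex.I * y * k)),
    ← integral_add_right_eq_self (fun x : ℝ => Complex.exp (-Complex.I * k * x) *
      SchwartzMap.compSubConstCLM ℂ y ψ x) y]
  congr 2
  funext x
  rw [SchwartzMap.compSubConstCLM_apply, add_sub_cancel_right, ← mul_assoc, ← Complex.exp_add]
  congr 2
  push_cast
  ring

/-! ### Tempered distributions given by a function on the Fourier side -/

lemma SchwartzMap.norm_le_div_one_add_abs_pow (g : 𝓢(ℝ, ℂ)) (m : ℕ) :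
    ∃ C, 0 ≤ C ∧ ∀ k, ‖g k‖ ≤ C / (1 + |k|) ^ m := by
  have h := fun k => SchwartzMap.one_add_le_sup_seminorm_apply (𝕜 := ℂ) (m := (m, 0)) (k := m)
    (n := 0) le_rfl le_rfl g k
  refine ⟨2 ^ m * (Finset.Iic (m, 0)).sup
    (fun m => SchwartzMap.seminorm ℂ m.1 m.2) g, ?_, fun k => ?_⟩
  · exact mul_nonneg (by positivity) (apply_nonneg _ _)
  · have h' := h k
    rw [norm_iteratedFDeriv_zero, Real.norm_eq_abs] at h'
    rw [le_div_iff₀ (by positivity), mul_comm]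
    exact h'

lemma norm_one_add_abs_pow (k : ℝ) (m : ℕ) : ‖((1 + |k| : ℝ) : ℂ) ^ m‖ = (1 + |k|) ^ m := by
  rw [norm_pow, Complex.norm_real, Real.norm_of_nonneg (by positivity)]

lemma ofReal_one_add_abs_ne_zero (k : ℝ) : ((1 + |k| : ℝ) : ℂ) ≠ 0 := by
  have : 1 + |k| ≠ 0 := by positivity
  exact_mod_cast this

lemma integrable_mul_schwartz_of_weight {X : Type*} [MeasurableSpace X] {ν : Measure X}
    {κ : X → ℝ} (hκ : Measurable κ) {h : X → ℂ} {m : ℕ}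
    (hh : Integrable (fun p => h p / ((1 + |κ p| : ℝ) : ℂ) ^ m) ν) (g : 𝓢(ℝ, ℂ)) :
    Integrable (fun p => h p * g (κ p)) ν := by
  obtain ⟨C, hC0, hC⟩ := g.norm_le_div_one_add_abs_pow m
  have e : (fun p => h p * g (κ p)) = fun p =>
      (((1 + |κ p| : ℝ) : ℂ) ^ m * g (κ p)) * (h p / ((1 + |κ p| : ℝ) : ℂ) ^ m) := by
    funext p
    have := ofReal_one_add_abs_ne_zero (κ p)
    field_simp
  have hc : Continuous fun k : ℝ => ((1 + |k| : ℝ) : ℂ) ^ m * g k :=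
    ((Complex.continuous_ofReal.comp (by fun_prop)).pow m).mul g.continuous
  rw [e]
  refine hh.bdd_mul (c := C) (hc.measurable.comp hκ).aestronglyMeasurable
    (Eventually.of_forall fun p => ?_)
  rw [norm_mul, norm_one_add_abs_pow, mul_comm, ← le_div_iff₀ (by positivity)]
  exact hC _

lemma HasFourierStar.integrable_mul {T : 𝓢'(ℝ, ℂ)} {h : ℝ → ℂ} (hT : HasFourierStar T h)
    (g : 𝓢(ℝ, ℂ)) : Integrable fun k => h k * g k := by
  obtain ⟨m, hm⟩ := hT.1
  exact integrable_mul_schwartz_of_weight measurable_id hm g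

lemma HasFourierStar.apply {T : 𝓢'(ℝ, ℂ)} {h : ℝ → ℂ} (hT : HasFourierStar T h)
    (ψ : 𝓢(ℝ, ℂ)) : T ψ = ∫ k, h k * fourierStarInvCLM ψ k := by
  rw [hT.2 ψ]
  simp_rw [fourierStarInvCLM_apply]

lemma hasFourierStar_iff {T : 𝓢'(ℝ, ℂ)} {h : ℝ → ℂ} : HasFourierStar T h ↔
    (∃ m : ℕ, Integrable (fun k : ℝ => h k / ((1 + |k| : ℝ) : ℂ) ^ m)) ∧
      ∀ ψ : 𝓢(ℝ, ℂ), T ψ = ∫ k, h k * fourierStarInvCLM ψ k := by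
  simp_rw [fourierStarInvCLM_apply]
  rfl

/-- A function that is integrable against some weight `(1 + |k|)^{-m}` is the Fourier transform of a
tempered distribution. -/
lemma exists_hasFourierStar {h : ℝ → ℂ} {m : ℕ}
    (hh : Integrable (fun k : ℝ => h k / ((1 + |k| : ℝ) : ℂ) ^ m)) :
    ∃ T : 𝓢'(ℝ, ℂ), HasFourierStar T h := by
  have hint : ∀ g : 𝓢(ℝ, ℂ), Integrable fun k => h k * g k :=
    integrable_mul_schwartz_of_weight measurable_id hh
  let A : 𝓢(ℝ, ℂ) →L[ℂ] ℂ := SchwartzMap.mkCLMtoNormedSpace (𝕜 := ℂ) (σ := RingHom.id ℂ)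
    (fun g => ∫ k, h k * g k)
    (fun f g => by
      simp only [add_apply, mul_add]
      exact integral_add (hint f) (hint g))
    (fun a g => by
      simp only [smul_apply, smul_eq_mul, RingHom.id_apply, ← integral_const_mul]
      congr 1
      funext k
      ring)
    ⟨Finset.Iic (m, 0), (∫ k, ‖h k / ((1 + |k| : ℝ) : ℂ) ^ m‖) * 2 ^ m, by positivity, by
      intro g
      rw [mul_assoc, ← integral_mul_const]
      refine norm_integral_le_of_norm_le (hh.norm.mul_const _) (Eventually.of_forall fun k => ?_)
      have h' := SchwartzMap.one_add_le_sup_seminorm_apply (𝕜 := ℂ) (m := (m, 0)) (k := m)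
        (n := 0) le_rfl le_rfl g k
      rw [norm_iteratedFDeriv_zero, Real.norm_eq_abs] at h'
      rw [norm_mul, norm_div, norm_one_add_abs_pow]
      calc ‖h k‖ * ‖g k‖ = ‖h k‖ / (1 + |k|) ^ m * ((1 + |k|) ^ m * ‖g k‖) := by
            field_simp
        _ ≤ _ := mul_le_mul_of_nonneg_left h' (by positivity)⟩
  refine ⟨ContinuousLinearMap.toPointwiseConvergenceCLM _ _ _ _ (A.comp fourierStarInvCLM),
    hasFourierStar_iff.2 ⟨⟨m, hh⟩, fun ψ => rfl⟩⟩

lemma locallyIntegrable_of_weight {h : ℝ → ℂ} {m : ℕ}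
    (hh : Integrable (fun k : ℝ => h k / ((1 + |k| : ℝ) : ℂ) ^ m)) : LocallyIntegrable h := by
  have h1 := hh.locallyIntegrable.continuous_smul
    (g := fun k : ℝ => ((1 + |k| : ℝ) : ℂ) ^ m)
    ((Complex.continuous_ofReal.comp (by fun_prop)).pow m)
  refine h1.congr (Eventually.of_forall fun k => ?_)
  have := ofReal_one_add_abs_ne_zero k
  simp only [smul_eq_mul]
  exact mul_div_cancel₀ _ (pow_ne_zero m this)

lemma HasFourierStar.locallyIntegrable {T : 𝓢'(ℝ, ℂ)} {h : ℝ → ℂ} (hT : HasFourierStar T h) :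
    LocallyIntegrable h := by
  obtain ⟨m, hm⟩ := hT.1
  exact locallyIntegrable_of_weight hm

lemma ae_eq_of_integral_mul_fourierStarInvCLM {h h' : ℝ → ℂ} (hh : LocallyIntegrable h)
    (hh' : LocallyIntegrable h')
    (heq : ∀ ψ, ∫ k, h k * fourierStarInvCLM ψ k = ∫ k, h' k * fourierStarInvCLM ψ k) :
    h =ᵐ[volume] h' := by
  refine ae_eq_of_integral_contDiff_smul_eq hh hh' fun g hg hgc => ?_
  have hgc' : HasCompactSupport fun k => ((g k : ℝ) : ℂ) :=
    hgc.comp_left (g := fun r : ℝ => (r : ℂ)) Complex.ofReal_zero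
  obtain ⟨ψ, hψ⟩ := fourierStarInvCLM_surjective
    (hgc'.toSchwartzMap (Complex.ofRealCLM.contDiff.comp hg))
  have h1 := heq ψ
  rw [hψ] at h1
  have e (f : ℝ → ℂ) : ∫ k, g k • f k = ∫ k, f k * ((g k : ℝ) : ℂ) := by
    congr 1
    funext k
    rw [Complex.real_smul, mul_comm]
  rw [e, e]
  exact h1

/-- The Fourier transform of a tempered distribution, if it is a function, is unique. -/
lemma HasFourierStar.ae_eq {T : 𝓢'(ℝ, ℂ)} {h h' : ℝ → ℂ} (hT : HasFourierStar T h)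
    (hT' : HasFourierStar T h') : h =ᵐ[volume] h' :=
  ae_eq_of_integral_mul_fourierStarInvCLM hT.locallyIntegrable hT'.locallyIntegrable
    fun ψ => (hT.apply ψ).symm.trans (hT'.apply ψ)

/-- A distribution whose Fourier transform is a function vanishes at infinity. -/
lemma HasFourierStar.tendsto_translate {T : 𝓢'(ℝ, ℂ)} {h : ℝ → ℂ} (hT : HasFourierStar T h)
    (ψ : 𝓢(ℝ, ℂ)) :
    Tendsto (fun y : ℝ => T (SchwartzMap.compSubConstCLM ℂ y ψ)) (cocompact ℝ) (𝓝 0) := by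
  have h1 := (tendsto_fourierStarInv_cocompact
    (fun k => h k * fourierStarInvCLM ψ k)).const_mul (√(2 * Real.pi) : ℂ)
  rw [mul_zero] at h1
  refine h1.congr fun y => ?_
  have := sqrt_two_pi_ne_zero
  rw [hT.apply, fourierStarInv, ← mul_assoc, mul_one_div_cancel this, one_mul]
  congr 1
  funext k
  rw [fourierStarInvCLM_compSubConst]
  ring

/-! ### Families of causal functions depending on a frequency -/

section Family

lemma ContinuousOn.aestronglyMeasurable_of_zero {f : ℝ → ℂ} (hc : ContinuousOn f (Ioi 0))
    (hz : ∀ t ≤ 0, f t = 0) : AEStronglyMeasurable f := by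
  have h := hc.aestronglyMeasurable (μ := volume) measurableSet_Ioi
  rw [← aestronglyMeasurable_indicator_iff measurableSet_Ioi] at h
  have e : (Ioi 0).indicator f = f := by
    rw [indicator_eq_self]
    intro t ht
    by_contra h0
    exact ht (hz t (not_lt.1 h0))
  rwa [e] at h

lemma CausalContinuous.of_norm_le {f : ℝ → ℂ} (hc : ContinuousOn f (Ioi 0))
    (hz : ∀ t ≤ 0, f t = 0) {B : ℝ → ℝ} (hB : CausalContinuous B) (hfB : ∀ t, ‖f t‖ ≤ B t) :
    CausalContinuous f where
  zero := hz
  int T := (hB.int T).mono' (hc.aestronglyMeasurable_of_zero hz).restrict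
    (Eventually.of_forall hfB)
  cont := hc

lemma Causal.indicator_eq_self {f : ℝ → ℂ} (hf : Causal f) : (Ioi 0).indicator f = f := by
  rw [Set.indicator_eq_self]
  intro t ht
  by_contra h0
  exact ht (hf.zero t (not_lt.1 h0))

lemma Causal.rlIntegral_eq_conv {f : ℝ → ℂ} (hf : Causal f) {ν : ℝ} (hν : 0 < ν) {t : ℝ}
    (ht : 0 < t) : rlIntegral ν f t = conv (rlKernelC ν) f t := by
  rw [_root_.rlIntegral_eq_conv hν f ht, hf.indicator_eq_self]

lemma measurable_rlKernelC (ν : ℝ) : Measurable (rlKernelC ν) := by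
  refine Complex.measurable_ofReal.comp (Measurable.indicator ?_ measurableSet_Ioi)
  fun_prop

/-- `v k t` is a family of causal functions of `t`, dominated by a product of a causal function of
`t` and an integrable function of `k`. -/
structure DominatedFamily (v : ℝ → ℝ → ℂ) (B : ℝ → ℝ) (w : ℝ → ℝ) : Prop where
  meas : Measurable (Function.uncurry v)
  causal : ∀ k, CausalContinuous (v k)
  hB : CausalContinuous B
  hw : Integrable w
  bound : ∀ k t, ‖v k t‖ ≤ B t * w k

namespace DominatedFamily

variable {v : ℝ → ℝ → ℂ} {B w : ℝ → ℝ}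

lemma integrable (h : DominatedFamily v B w) (t : ℝ) : Integrable fun k => v k t :=
  (h.hw.const_mul (B t)).mono' (h.meas.comp measurable_prodMk_right).aestronglyMeasurable
    (Eventually.of_forall fun k => h.bound k t)

lemma causalContinuous_integral (h : DominatedFamily v B w) :
    CausalContinuous fun t => ∫ k, v k t := by
  refine CausalContinuous.of_norm_le (B := fun t => (∫ k, w k) * B t) ?_ ?_
    (h.hB.const_mul _) ?_
  · intro t₀ ht₀
    obtain ⟨C, hC0, hC⟩ := h.hB.cont.exists_bound_Icc (a := t₀ / 2) (b := 2 * t₀)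
      (half_pos ht₀)
    have ht₀' : 0 < t₀ := ht₀
    have hnear : ∀ᶠ t in 𝓝 t₀, t ∈ Icc (t₀ / 2) (2 * t₀) :=
      Icc_mem_nhds (by linarith) (by linarith)
    refine (continuousAt_of_dominated (bound := fun k => C * ‖w k‖) ?_ ?_
      (h.hw.norm.const_mul C) ?_).continuousWithinAt
    · exact Eventually.of_forall fun t => (h.integrable t).aestronglyMeasurable
    · filter_upwards [hnear] with t ht
      refine Eventually.of_forall fun k => (h.bound k t).trans ?_
      refine (le_abs_self _).trans ?_
      rw [abs_mul]
      exact mul_le_mul_of_nonneg_right (hC t ht) (abs_nonneg _)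
    · exact Eventually.of_forall fun k => (h.causal k).cont.continuousAt (Ioi_mem_nhds ht₀)
  · intro t ht
    exact integral_eq_zero_of_ae (Eventually.of_forall fun k => (h.causal k).zero t ht)
  · intro t
    rw [mul_comm, ← integral_const_mul]
    exact norm_integral_le_of_norm_le (h.hw.const_mul _)
      (Eventually.of_forall fun k => h.bound k t)

lemma rlIntegral_integral (h : DominatedFamily v B w) {ν : ℝ} (hν : 0 ≤ ν) {t : ℝ}
    (ht : 0 < t) :
    rlIntegral ν (fun t => ∫ k, v k t) t = ∫ k, rlIntegral ν (v k) t := by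
  rcases hν.eq_or_lt with rfl | hν
  · simp only [rlIntegral_zero]
  · rw [h.causalContinuous_integral.toCausal.rlIntegral_eq_conv hν ht]
    simp_rw [fun k => (h.causal k).toCausal.rlIntegral_eq_conv hν ht]
    simp only [conv_apply, ← integral_const_mul]
    refine integral_integral_swap ?_
    have h1 : Integrable (fun s => rlKernel ν s * B (t - s)) :=
      (causalContinuous_rlKernel hν).convolutionExists h.hB t
    refine (h1.mul_prod h.hw).mono' ?_ (Eventually.of_forall fun p => ?_)
    · refine Measurable.aestronglyMeasurable ?_
      exact ((measurable_rlKernelC ν).comp measurable_fst).mul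
        (h.meas.comp (measurable_snd.prodMk (measurable_const.sub measurable_fst)))
    · simp only [Function.uncurry]
      rw [norm_mul, norm_rlKernelC hν, mul_assoc]
      exact mul_le_mul_of_nonneg_left (h.bound _ _) (rlKernel_nonneg hν _)

lemma integral_integral (h : DominatedFamily v B w) {t : ℝ} (ht : 0 < t) :
    ∫ s in (0 : ℝ)..t, ∫ k, v k s = ∫ k, ∫ s in (0 : ℝ)..t, v k s := by
  simpa only [rlIntegral_one] using h.rlIntegral_integral zero_le_one ht

lemma integrable_rlIntegral (h : DominatedFamily v B w) {ν : ℝ} (hν : 0 ≤ ν) {t : ℝ}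
    (ht : 0 < t) : Integrable fun k => rlIntegral ν (v k) t := by
  rcases hν.eq_or_lt with rfl | hν
  · simpa only [rlIntegral_zero] using h.integrable t
  · simp_rw [fun k => (h.causal k).toCausal.rlIntegral_eq_conv hν ht]
    simp only [conv_apply]
    have h1 : Integrable (fun s => rlKernel ν s * B (t - s)) :=
      (causalContinuous_rlKernel hν).convolutionExists h.hB t
    have h2 : Integrable (Function.uncurry fun k s => rlKernelC ν s * v k (t - s))
        (volume.prod volume) := by
      refine (h.hw.mul_prod h1).mono' ?_ (Eventually.of_forall fun p => ?_)
      · refine Measurable.aestronglyMeasurable ?_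
        exact ((measurable_rlKernelC ν).comp measurable_snd).mul
          (h.meas.comp (measurable_fst.prodMk (measurable_const.sub measurable_snd)))
      · simp only [Function.uncurry]
        rw [norm_mul, norm_rlKernelC hν, mul_comm (w _), mul_assoc]
        exact mul_le_mul_of_nonneg_left (h.bound _ _) (rlKernel_nonneg hν _)
    exact h2.integral_prod_left

end DominatedFamily

end Family

lemma rlIntegral_const_mul (ν : ℝ) (u : ℝ → ℂ) (c : ℂ) (t : ℝ) :
    rlIntegral ν (fun s => c * u s) t = c * rlIntegral ν u t := by
  unfold rlIntegral
  split_ifs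
  · rfl
  · rw [mul_left_comm, ← intervalIntegral.integral_const_mul c]
    congr 2
    funext s
    ring

lemma tendsto_integral_zero {𝕜 : Type*} [RCLike 𝕜] {f : ℝ → 𝕜} (hf : Causal f) :
    Tendsto (fun t => ∫ s in (0 : ℝ)..t, f s) (𝓝[>] 0) (𝓝 0) := by
  have h := intervalIntegral.continuous_primitive (μ := volume) (f := f) (fun a b => by
    refine (hf.int (max a b)).mono_set ?_ |>.intervalIntegrable
    exact fun x hx => hx.2) 0
  have h0 := h.tendsto 0
  rw [intervalIntegral.integral_same] at h0
  exact h0.mono_left nhdsWithin_le_nhds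

/-- Fractional integrals of order at least `1` vanish at `0`. -/
lemma tendsto_rlIntegral_zero {f : ℝ → ℂ} (hf : Causal f) {ν : ℝ} (hν : 1 ≤ ν) :
    Tendsto (rlIntegral ν f) (𝓝[>] 0) (𝓝 0) := by
  have hν0 : 0 < ν := by linarith
  have hΓ := Real.Gamma_pos_of_pos hν0
  have h1 := (tendsto_integral_zero hf.norm).const_mul (1 / Real.Gamma ν)
  rw [mul_zero] at h1
  refine squeeze_zero_norm' ?_ h1
  filter_upwards [Ioo_mem_nhdsGT (zero_lt_one' ℝ)] with t ht
  rw [rlIntegral, if_neg hν0.ne', norm_mul, norm_div, norm_one, Complex.norm_real,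
    Real.norm_of_nonneg hΓ.le]
  refine mul_le_mul_of_nonneg_left ?_ (by positivity)
  refine intervalIntegral.norm_integral_le_of_norm_le ht.1.le
    (Eventually.of_forall fun s hs => ?_) (hf.norm.intervalIntegrable ht.1.le)
  have h0 : 0 ≤ t - s := by linarith [hs.2]
  rw [norm_mul, Complex.norm_real, Real.norm_of_nonneg (by positivity)]
  refine mul_le_of_le_one_left (norm_nonneg _) ?_
  exact Real.rpow_le_one h0 (by linarith [hs.1, ht.2]) (by linarith)

/-! ### The symbol -/

section Symbol

lemma norm_rieszFellerSymbol (γ θ k : ℝ) : ‖rieszFellerSymbol γ θ k‖ = |k| ^ γ := by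
  have e : Complex.I * (Real.sign k : ℝ) * (θ * Real.pi / 2 : ℝ)
      = ((Real.sign k * (θ * Real.pi / 2) : ℝ) : ℂ) * Complex.I := by push_cast; ring
  rw [rieszFellerSymbol, norm_mul, e, Complex.norm_exp_ofReal_mul_I, mul_one, Complex.norm_real,
    Real.norm_of_nonneg (by positivity)]

lemma norm_rieszFellerSymbol_le {γ : ℝ} (hγ0 : 0 < γ) (hγ2 : γ ≤ 2) (θ k : ℝ) :
    ‖rieszFellerSymbol γ θ k‖ ≤ (1 + |k|) ^ 2 := by
  rw [norm_rieszFellerSymbol]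
  calc |k| ^ γ ≤ (1 + |k|) ^ γ := by gcongr; linarith
    _ ≤ (1 + |k|) ^ (2 : ℝ) :=
      Real.rpow_le_rpow_of_exponent_le (by linarith [abs_nonneg k]) hγ2
    _ = (1 + |k|) ^ 2 := by norm_cast

lemma abs_sign_le_one (k : ℝ) : |Real.sign k| ≤ 1 := by
  rcases Real.sign_apply_eq k with h | h | h <;> simp [h]

lemma rieszFellerSymbol_re_nonneg {γ θ : ℝ} (hθ : |θ| ≤ min γ (2 - γ)) (k : ℝ) :
    0 ≤ (rieszFellerSymbol γ θ k).re := by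
  have e : Complex.I * (Real.sign k : ℝ) * (θ * Real.pi / 2 : ℝ)
      = ((Real.sign k * (θ * Real.pi / 2) : ℝ) : ℂ) * Complex.I := by push_cast; ring
  rw [rieszFellerSymbol, Complex.re_ofReal_mul, e, Complex.exp_ofReal_mul_I_re]
  refine mul_nonneg (by positivity) (Real.cos_nonneg_of_mem_Icc (abs_le.1 ?_))
  have hθ1 : |θ| ≤ 1 := by
    have h1 := hθ.trans (min_le_left _ _)
    have h2 := hθ.trans (min_le_right _ _)
    linarith
  rw [abs_mul, abs_div, abs_mul, abs_of_pos Real.pi_pos, abs_of_pos (zero_lt_two' ℝ)]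
  calc |Real.sign k| * (|θ| * Real.pi / 2) ≤ 1 * (1 * Real.pi / 2) := by
        gcongr
        exact abs_sign_le_one k
    _ = Real.pi / 2 := by ring

lemma measurable_rieszFellerSymbol (γ θ : ℝ) : Measurable (rieszFellerSymbol γ θ) := by
  have hs : Measurable Real.sign := by
    unfold Real.sign
    exact Measurable.ite measurableSet_Iio measurable_const
      (Measurable.ite measurableSet_Ioi measurable_const measurable_const)
  unfold rieszFellerSymbol
  fun_prop

variable {n : ℕ} {μ γ θ : Fin n → ℝ}

lemma measurable_totalSymbol : Measurable (totalSymbol μ γ θ) := by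
  unfold totalSymbol
  exact Finset.measurable_sum _ fun j _ => (measurable_rieszFellerSymbol _ _).const_mul _

lemma totalSymbol_re_nonneg (hμ : ∀ j, 0 < μ j) (hθ : ∀ j, |θ j| ≤ min (γ j) (2 - γ j)) (k : ℝ) :
    0 ≤ (totalSymbol μ γ θ k).re := by
  rw [totalSymbol, Complex.re_sum]
  refine Finset.sum_nonneg fun j _ => ?_
  rw [Complex.re_ofReal_mul]
  exact mul_nonneg (hμ j).le (rieszFellerSymbol_re_nonneg (hθ j) k)

lemma norm_totalSymbol_le (hμ : ∀ j, 0 < μ j) (hγ0 : ∀ j, 0 < γ j) (hγ2 : ∀ j, γ j ≤ 2) (k : ℝ) :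
    ‖totalSymbol μ γ θ k‖ ≤ (∑ j, μ j) * (1 + |k|) ^ 2 := by
  rw [totalSymbol, Finset.sum_mul]
  refine (norm_sum_le _ _).trans (Finset.sum_le_sum fun j _ => ?_)
  rw [norm_mul, Complex.norm_real, Real.norm_of_nonneg (hμ j).le]
  exact mul_le_mul_of_nonneg_left (norm_rieszFellerSymbol_le (hγ0 j) (hγ2 j) _ _) (hμ j).le

end Symbol

/-- Multiplication by a function of at most quadratic growth preserves integrability against a
polynomial weight. -/
lemma integrable_mul_div_weight {X : Type*} [MeasurableSpace X] {ν : Measure X} {κ : X → ℝ}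
    (hκ : Measurable κ) {a : ℝ → ℂ} (ha : Measurable a) {C : ℝ}
    (haC : ∀ k, ‖a k‖ ≤ C * (1 + |k|) ^ 2) {h : X → ℂ} {m : ℕ}
    (hh : Integrable (fun p => h p / ((1 + |κ p| : ℝ) : ℂ) ^ m) ν) :
    Integrable (fun p => a (κ p) * h p / ((1 + |κ p| : ℝ) : ℂ) ^ (m + 2)) ν := by
  have e : (fun p => a (κ p) * h p / ((1 + |κ p| : ℝ) : ℂ) ^ (m + 2)) = fun p =>
      (a (κ p) / ((1 + |κ p| : ℝ) : ℂ) ^ 2) * (h p / ((1 + |κ p| : ℝ) : ℂ) ^ m) := by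
    funext p
    have := ofReal_one_add_abs_ne_zero (κ p)
    rw [pow_add]
    field_simp
  rw [e]
  refine hh.bdd_mul (c := C) ?_ (Eventually.of_forall fun p => ?_)
  · exact ((ha.comp hκ).div ((Complex.measurable_ofReal.comp
      (measurable_const.add hκ.norm)).pow_const 2)).aestronglyMeasurable
  · rw [norm_div, norm_one_add_abs_pow, div_le_iff₀ (by positivity)]
    exact haC _

/-! ### The source on the Fourier side -/

section Source

/-- The Fourier transform of the source at the frequency `k`, as a causal function of time. -/
noncomputable def sourceStar (φ : ℝ → ℝ → ℂ) (k : ℝ) : ℝ → ℂ :=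
  (Ioi 0).indicator fun t => fourierStar (fun x => φ x t) k

/-- The bound `(2π)^{-1/2} ‖φ(·, t)‖` of the Fourier transform of the source, as a causal function
of time. -/
noncomputable def sourceBound (φ : ℝ → ℝ → ℂ) : ℝ → ℝ :=
  (Ioi 0).indicator fun t => 1 / √(2 * Real.pi) * ∫ x : ℝ, ‖φ x t‖

variable {φ : ℝ → ℝ → ℂ}

lemma sourceStar_of_pos (φ : ℝ → ℝ → ℂ) (k : ℝ) {t : ℝ} (ht : 0 < t) :
    sourceStar φ k t = fourierStar (fun x => φ x t) k := indicator_of_mem (mem_Ioi.2 ht) _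

lemma norm_sourceStar_le (φ : ℝ → ℝ → ℂ) (k t : ℝ) : ‖sourceStar φ k t‖ ≤ sourceBound φ t := by
  rw [sourceStar, sourceBound, norm_indicator_eq_indicator_norm]
  exact indicator_le_indicator (norm_fourierStar_le _ k)

variable (hφ : ∀ t, 0 < t → Integrable (fun x => φ x t))
  (hφc : ∀ t₀, 0 < t₀ → Tendsto (fun t => ∫ x : ℝ, ‖φ x t - φ x t₀‖) (𝓝 t₀) (𝓝 0))
  (hφi : ∀ T, 0 < T → IntegrableOn (fun t => ∫ x : ℝ, ‖φ x t‖) (Ioc 0 T))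

include hφ hφc in
lemma continuousOn_integral_norm : ContinuousOn (fun t => ∫ x : ℝ, ‖φ x t‖) (Ioi 0) := by
  intro t₀ ht₀
  refine ContinuousAt.continuousWithinAt ?_
  rw [ContinuousAt, tendsto_iff_norm_sub_tendsto_zero]
  refine squeeze_zero' (Eventually.of_forall fun _ => norm_nonneg _) ?_ (hφc t₀ ht₀)
  filter_upwards [Ioi_mem_nhds (show 0 < t₀ from ht₀)] with t ht
  rw [← integral_sub (hφ t ht).norm (hφ t₀ ht₀).norm]
  refine norm_integral_le_of_norm_le ((hφ t ht).sub (hφ t₀ ht₀)).norm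
    (Eventually.of_forall fun x => ?_)
  exact abs_norm_sub_norm_le _ _

include hφ hφc in
lemma continuousOn_fourierStar_source :
    ContinuousOn (fun p : ℝ × ℝ => fourierStar (fun x => φ x p.2) p.1) (univ ×ˢ Ioi 0) := by
  rintro ⟨k₀, t₀⟩ ⟨-, ht₀⟩
  replace ht₀ : 0 < t₀ := ht₀
  refine ContinuousAt.continuousWithinAt ?_
  have h1 : Tendsto (fun p : ℝ × ℝ => fourierStar (fun x => φ x t₀) p.1) (𝓝 (k₀, t₀))
      (𝓝 (fourierStar (fun x => φ x t₀) k₀)) :=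
    ((continuous_fourierStar (hφ t₀ ht₀)).comp continuous_fst).tendsto (k₀, t₀)
  have h2 : Tendsto (fun p : ℝ × ℝ => fourierStar (fun x => φ x p.2) p.1
      - fourierStar (fun x => φ x t₀) p.1) (𝓝 (k₀, t₀)) (𝓝 0) := by
    have h3 := ((hφc t₀ ht₀).comp (continuous_snd.tendsto (k₀, t₀))).const_mul
      (1 / √(2 * Real.pi))
    rw [mul_zero] at h3
    refine squeeze_zero_norm' ?_ h3
    filter_upwards [continuous_snd.tendsto (k₀, t₀) (Ioi_mem_nhds ht₀)] with p hp
    rw [fourierStar_sub (hφ _ hp) (hφ t₀ ht₀)]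
    exact norm_fourierStar_le _ _
  have h4 := h2.add h1
  simpa only [sub_add_cancel, zero_add] using! h4

include hφ hφc hφi in
lemma causalContinuous_sourceBound : CausalContinuous (sourceBound φ) :=
  CausalContinuous.of_indicator (continuousOn_const.mul (continuousOn_integral_norm hφ hφc))
    fun T hT => (hφi T hT).const_mul _

include hφ hφc hφi in
lemma causalContinuous_sourceStar (k : ℝ) : CausalContinuous (sourceStar φ k) := by
  refine CausalContinuous.of_norm_le ?_ (fun t ht => indicator_of_notMem (by simpa using ht) _)
    (causalContinuous_sourceBound hφ hφc hφi) (norm_sourceStar_le φ k)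
  have h := (continuousOn_fourierStar_source hφ hφc).comp (f := fun t : ℝ => (k, t)) (s := Ioi 0)
    (by fun_prop) (fun t ht => ⟨mem_univ _, ht⟩)
  exact h.congr fun t ht => sourceStar_of_pos φ k ht

include hφ hφc in
lemma measurable_sourceStar : Measurable (Function.uncurry (sourceStar φ)) := by
  classical
  have h := (continuousOn_fourierStar_source hφ hφc).measurable_piecewise
    (g := fun _ => 0) continuousOn_const (MeasurableSet.univ.prod measurableSet_Ioi)
  convert h using 1
  funext p
  by_cases hp : 0 < p.2
  · rw [piecewise_eq_of_mem _ _ _ (show p ∈ (univ : Set ℝ) ×ˢ Ioi (0 : ℝ) from ⟨mem_univ _, hp⟩)]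
    exact sourceStar_of_pos φ p.1 hp
  · rw [piecewise_eq_of_notMem _ _ _ (fun h : p ∈ (univ : Set ℝ) ×ˢ Ioi (0 : ℝ) => hp h.2)]
    exact indicator_of_notMem (s := Ioi 0) hp (fun t => fourierStar (fun x => φ x t) p.1)

lemma integral_source_mul (hφ : ∀ t, 0 < t → Integrable (fun x => φ x t)) {t : ℝ} (ht : 0 < t)
    (ψ : 𝓢(ℝ, ℂ)) :
    ∫ x, φ x t * ψ x = ∫ k, fourierStarInvCLM ψ k * sourceStar φ k t := by
  rw [integral_mul_eq_integral_fourierStar_mul (hφ t ht)]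
  congr 1
  funext k
  rw [sourceStar_of_pos φ k ht, mul_comm]

end Source

/-! ### The solution on the Fourier side -/

section Solution

/-- The Fourier transform of the solution at the frequency `k`. -/
noncomputable def solutionStar (α : ℝ) (b : ℝ → ℂ) (φ : ℝ → ℝ → ℂ) (k : ℝ) : ℝ → ℂ :=
  mlSolution α (b k) (1 / (√(2 * Real.pi) : ℂ)) (sourceStar φ k)

/-- A bound of the Fourier transform of the solution that is uniform in the frequency. -/
noncomputable def solutionBound (α : ℝ) (φ : ℝ → ℝ → ℂ) (t : ℝ) : ℝ :=
  ‖1 / (√(2 * Real.pi) : ℂ)‖ * rlKernel α t + conv (rlKernel α) (sourceBound φ) t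

variable {α : ℝ} {b : ℝ → ℂ} {φ : ℝ → ℝ → ℂ}
  (hα0 : 0 < α) (hα1 : α ≤ 1) (hb : ∀ k, 0 ≤ (b k).re) (hbm : Measurable b)
  (hφ : ∀ t, 0 < t → Integrable (fun x => φ x t))
  (hφc : ∀ t₀, 0 < t₀ → Tendsto (fun t => ∫ x : ℝ, ‖φ x t - φ x t₀‖) (𝓝 t₀) (𝓝 0))
  (hφi : ∀ T, 0 < T → IntegrableOn (fun t => ∫ x : ℝ, ‖φ x t‖) (Ioc 0 T))

include hα0 hα1 hbm in
lemma measurable_mlKernel :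
    Measurable (Function.uncurry fun k t : ℝ => mlKernel α (b k) t) := by
  have h : (Function.uncurry fun k t : ℝ => mlKernel α (b k) t)
      = (univ ×ˢ Ioi 0 : Set (ℝ × ℝ)).indicator fun p =>
        ((p.2 ^ (α - 1) : ℝ) : ℂ) * mittagLeffler α α (-b p.1 * ((p.2 ^ α : ℝ) : ℂ)) := by
    funext p
    by_cases hp : 0 < p.2
    · rw [indicator_of_mem (show p ∈ (univ : Set ℝ) ×ˢ Ioi (0 : ℝ) from ⟨mem_univ _, hp⟩)]
      exact mlKernel_of_pos α _ hp
    · rw [indicator_of_notMem (fun h : p ∈ (univ : Set ℝ) ×ˢ Ioi (0 : ℝ) => hp h.2)]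
      exact indicator_of_notMem (s := Ioi 0) hp (fun t : ℝ => ((t ^ (α - 1) : ℝ) : ℂ) *
        mittagLeffler α α (-b p.1 * ((t ^ α : ℝ) : ℂ)))
  rw [h]
  have hE := (continuous_mittagLeffler hα0 hα1).measurable
  refine Measurable.indicator ?_ (MeasurableSet.univ.prod measurableSet_Ioi)
  fun_prop

include hα0 hα1 hbm hφ hφc in
lemma measurable_solutionStar : Measurable (Function.uncurry (solutionStar α b φ)) := by
  have hU := measurable_mlKernel hα0 hα1 hbm
  have hF := measurable_sourceStar hφ hφc
  have h1 : Measurable fun p : ℝ × ℝ => ∫ s, mlKernel α (b p.1) s * sourceStar φ p.1 (p.2 - s) := by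
    refine StronglyMeasurable.measurable (StronglyMeasurable.integral_prod_right
      (f := fun (p : ℝ × ℝ) (s : ℝ) => mlKernel α (b p.1) s * sourceStar φ p.1 (p.2 - s)) ?_)
    refine Measurable.stronglyMeasurable ?_
    exact (hU.comp ((measurable_fst.comp measurable_fst).prodMk measurable_snd)).mul
      (hF.comp ((measurable_fst.comp measurable_fst).prodMk
        ((measurable_snd.comp measurable_fst).sub measurable_snd)))
  exact (hU.const_mul _).add h1

include hα0 hφ hφc hφi in
lemma causalContinuous_solutionBound : CausalContinuous (solutionBound α φ) :=
  ((causalContinuous_rlKernel hα0).const_mul _).add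
    ((causalContinuous_rlKernel hα0).conv (causalContinuous_sourceBound hφ hφc hφi))

include hα0 hα1 hb hφ hφc hφi in
lemma causalContinuous_solutionStar (k : ℝ) : CausalContinuous (solutionStar α b φ k) :=
  causalContinuous_mlSolution hα0 hα1 (hb k) (causalContinuous_sourceStar hφ hφc hφi k)

include hα0 hα1 hb hφ hφc hφi in
lemma norm_solutionStar_le (k t : ℝ) : ‖solutionStar α b φ k t‖ ≤ solutionBound α φ t :=
  norm_mlSolution_le hα0 hα1 (hb k) (causalContinuous_sourceBound hφ hφc hφi)
    (norm_sourceStar_le φ k) t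

include hα0 hα1 hb hbm hφ hφc hφi in
lemma dominatedFamily_solutionStar {q : ℝ → ℂ} (hqm : Measurable q) (hq : Integrable q) :
    DominatedFamily (fun k t => q k * solutionStar α b φ k t) (solutionBound α φ)
      (fun k => ‖q k‖) where
  meas := (hqm.comp measurable_fst).mul (measurable_solutionStar hα0 hα1 hbm hφ hφc)
  causal k := (causalContinuous_solutionStar hα0 hα1 hb hφ hφc hφi k).const_mul _
  hB := causalContinuous_solutionBound hα0 hφ hφc hφi
  hw := hq.norm
  bound k t := by
    rw [norm_mul, mul_comm]
    exact mul_le_mul_of_nonneg_right (norm_solutionStar_le hα0 hα1 hb hφ hφc hφi k t)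
      (norm_nonneg _)

include hφ hφc hφi in
lemma dominatedFamily_sourceStar {q : ℝ → ℂ} (hqm : Measurable q) (hq : Integrable q) :
    DominatedFamily (fun k t => q k * sourceStar φ k t) (sourceBound φ) (fun k => ‖q k‖) where
  meas := (hqm.comp measurable_fst).mul (measurable_sourceStar hφ hφc)
  causal k := (causalContinuous_sourceStar hφ hφc hφi k).const_mul _
  hB := causalContinuous_sourceBound hφ hφc hφi
  hw := hq.norm
  bound k t := by
    rw [norm_mul, mul_comm]
    exact mul_le_mul_of_nonneg_right (norm_sourceStar_le φ k t) (norm_nonneg _)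

include hα0 hα1 hb hbm hφ hφc hφi in
/-- The integrated equation, tested against a function `q` of the frequency. -/
lemma rlIntegral_integral_solutionStar {q : ℝ → ℂ} (hqm : Measurable q) (hq : Integrable q)
    (hbq : Integrable fun k => -b k * q k) {t : ℝ} (ht : 0 < t) :
    rlIntegral (1 - α) (fun t => ∫ k, q k * solutionStar α b φ k t) t
      = 1 / (√(2 * Real.pi) : ℂ) * (∫ k, q k)
        + ∫ s in (0 : ℝ)..t, ((∫ k, (-b k * q k) * solutionStar α b φ k s)
          + ∫ k, q k * sourceStar φ k s) := by
  have hN := dominatedFamily_solutionStar hα0 hα1 hb hbm hφ hφc hφi hqm hq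
  have hbN := dominatedFamily_solutionStar hα0 hα1 hb hbm hφ hφc hφi
    (q := fun k => -b k * q k) (hbm.neg.mul hqm) hbq
  have hF := dominatedFamily_sourceStar hφ hφc hφi hqm hq
  rw [hN.rlIntegral_integral (by linarith) ht,
    intervalIntegral.integral_add (hbN.causalContinuous_integral.intervalIntegrable ht.le)
      (hF.causalContinuous_integral.intervalIntegrable ht.le),
    hbN.integral_integral ht, hF.integral_integral ht, ← integral_const_mul]
  have h1 := hbN.integrable_rlIntegral zero_le_one ht
  have h2 := hF.integrable_rlIntegral zero_le_one ht
  simp only [rlIntegral_one] at h1 h2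
  rw [← integral_add h1 h2]
  refine Eq.trans (integral_congr_ae (Eventually.of_forall fun k => ?_))
    (integral_add (hq.const_mul _) (h1.add h2))
  have hS := causalContinuous_sourceStar hφ hφc hφi k
  have hv : CausalContinuous (mlSolution α (b k) (1 / (√(2 * Real.pi) : ℂ)) (sourceStar φ k)) :=
    causalContinuous_solutionStar hα0 hα1 hb hφ hφc hφi k
  have h3 := rlIntegral_mlSolution (c := 1 / (√(2 * Real.pi) : ℂ)) hα0 hα1 (hb k) hS ht
  rw [intervalIntegral.integral_add ((hv.const_mul _).intervalIntegrable ht.le)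
    (hS.intervalIntegrable ht.le), intervalIntegral.integral_const_mul] at h3
  change rlIntegral (1 - α) (fun t => q k * mlSolution α (b k) _ (sourceStar φ k) t) t
    = _ * q k + ((∫ s in (0 : ℝ)..t, -b k * q k * solutionStar α b φ k s)
      + ∫ s in (0 : ℝ)..t, q k * sourceStar φ k s)
  rw [rlIntegral_const_mul, h3, intervalIntegral.integral_const_mul,
    intervalIntegral.integral_const_mul]
  simp only [solutionStar]
  ring

end Solution

/-! ### Existence -/

lemma HasFourierStar.sum_rieszFeller {n : ℕ} {μ γ θ : Fin n → ℝ} {T : 𝓢'(ℝ, ℂ)} {h : ℝ → ℂ}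
    (hT : HasFourierStar T h) {S : Fin n → 𝓢'(ℝ, ℂ)}
    (hS : ∀ j, HasRieszFellerDeriv (γ j) (θ j) T (S j)) (ψ : 𝓢(ℝ, ℂ)) :
    ∑ j, (μ j : ℂ) * S j ψ
      = ∫ k, (-totalSymbol μ γ θ k * fourierStarInvCLM ψ k) * h k := by
  have h1 (j : Fin n) : Integrable (fun k =>
        -rieszFellerSymbol (γ j) (θ j) k * h k * fourierStarInvCLM ψ k) ∧
      S j ψ = ∫ k, -rieszFellerSymbol (γ j) (θ j) k * h k * fourierStarInvCLM ψ k := by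
    obtain ⟨h', hT', hS'⟩ := hS j
    have hae : (fun k => -rieszFellerSymbol (γ j) (θ j) k * h' k * fourierStarInvCLM ψ k)
        =ᵐ[volume]
        fun k => -rieszFellerSymbol (γ j) (θ j) k * h k * fourierStarInvCLM ψ k := by
      filter_upwards [hT'.ae_eq hT] with k hk
      rw [hk]
    exact ⟨(hS'.integrable_mul _).congr hae, (hS'.apply ψ).trans (integral_congr_ae hae)⟩
  simp_rw [fun j => (h1 j).2, ← integral_const_mul]
  rw [← integral_finsetSum _ fun j _ => ((h1 j).1).const_mul _]
  congr 1
  funext k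
  rw [totalSymbol, ← Finset.sum_neg_distrib, Finset.sum_mul, Finset.sum_mul]
  exact Finset.sum_congr rfl fun j _ => by ring

lemma integrable_one_div_weight :
    Integrable fun k : ℝ => (1 : ℂ) / ((1 + |k| : ℝ) : ℂ) ^ 2 := by
  refine integrable_inv_one_add_sq.mono' ?_ (Eventually.of_forall fun k => ?_)
  · exact Measurable.aestronglyMeasurable (by fun_prop)
  · rw [norm_div, norm_one_add_abs_pow, norm_one, one_div]
    gcongr
    nlinarith [abs_nonneg k, sq_abs k]

lemma integrable_mul_schwartz_of_le {a : ℝ → ℂ} (ha : Measurable a) {C : ℝ}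
    (haC : ∀ k, ‖a k‖ ≤ C * (1 + |k|) ^ 2) (g : 𝓢(ℝ, ℂ)) : Integrable fun k => a k * g k := by
  have h := integrable_mul_div_weight (κ := id) measurable_id ha haC integrable_one_div_weight
  simp only [mul_one] at h
  exact integrable_mul_schwartz_of_weight measurable_id h g

section Existence

variable {n : ℕ} {α : ℝ} {μ γ θ : Fin n → ℝ} {φ : ℝ → ℝ → ℂ}
  (hα0 : 0 < α) (hα1 : α ≤ 1)
  (hμ : ∀ j, 0 < μ j) (hγ0 : ∀ j, 0 < γ j) (hγ2 : ∀ j, γ j ≤ 2)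
  (hθ : ∀ j, |θ j| ≤ min (γ j) (2 - γ j))
  (hφ : ∀ t, 0 < t → Integrable (fun x => φ x t))
  (hφc : ∀ t₀, 0 < t₀ → Tendsto (fun t => ∫ x : ℝ, ‖φ x t - φ x t₀‖) (𝓝 t₀) (𝓝 0))
  (hφi : ∀ T, 0 < T → IntegrableOn (fun t => ∫ x : ℝ, ‖φ x t‖) (Ioc 0 T))

include hμ hγ0 hγ2 in
lemma integrable_neg_totalSymbol_mul (g : 𝓢(ℝ, ℂ)) :
    Integrable fun k => -totalSymbol μ γ θ k * g k :=
  integrable_mul_schwartz_of_le measurable_totalSymbol.neg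
    (fun k => (norm_neg _).trans_le (norm_totalSymbol_le hμ hγ0 hγ2 k)) g

include hα0 hα1 hμ hθ hφ hφc hφi in
lemma integrable_solutionStar_div_weight (t : ℝ) :
    Integrable fun k => solutionStar α (totalSymbol μ γ θ) φ k t / ((1 + |k| : ℝ) : ℂ) ^ 2 := by
  refine (integrable_one_div_weight.norm.const_mul (solutionBound α φ t)).mono' ?_
    (Eventually.of_forall fun k => ?_)
  · exact (((measurable_solutionStar hα0 hα1 measurable_totalSymbol hφ hφc).comp
      measurable_prodMk_right).div (by fun_prop)).aestronglyMeasurable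
  · rw [norm_div, norm_div, norm_one, ← mul_div_assoc, mul_one]
    gcongr
    exact norm_solutionStar_le hα0 hα1 (totalSymbol_re_nonneg hμ hθ) hφ hφc hφi k t

include hα0 hα1 hμ hγ0 hγ2 hθ hφ hφc hφi in
theorem exists_isDeltaSolution :
    ∃ N : ℝ → 𝓢'(ℝ, ℂ), IsDeltaSolution α μ γ θ φ N ∧
      ∀ t, HasFourierStar (N t) fun k => solutionStar α (totalSymbol μ γ θ) φ k t := by
  have hre := totalSymbol_re_nonneg (γ := γ) (θ := θ) hμ hθ
  have hbm : Measurable (totalSymbol μ γ θ) := measurable_totalSymbol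
  have hw := integrable_solutionStar_div_weight hα0 hα1 hμ hθ hφ hφc hφi
  choose N hN using fun t => exists_hasFourierStar (hw t)
  have hq (ψ : 𝓢(ℝ, ℂ)) : Integrable (fourierStarInvCLM ψ) := (fourierStarInvCLM ψ).integrable
  have hqm (ψ : 𝓢(ℝ, ℂ)) : Measurable (fourierStarInvCLM ψ) :=
    (fourierStarInvCLM ψ).continuous.measurable
  have hbq (ψ : 𝓢(ℝ, ℂ)) :=
    integrable_neg_totalSymbol_mul (θ := θ) hμ hγ0 hγ2 (fourierStarInvCLM ψ)
  have hNψ (ψ : 𝓢(ℝ, ℂ)) : (fun t => N t ψ) =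
      fun t => ∫ k, fourierStarInvCLM ψ k * solutionStar α (totalSymbol μ γ θ) φ k t := by
    funext t
    rw [(hN t).apply ψ]
    simp_rw [mul_comm]
  have hfam (ψ : 𝓢(ℝ, ℂ)) :=
    dominatedFamily_solutionStar hα0 hα1 hre hbm hφ hφc hφi (hqm ψ) (hq ψ)
  have hcc (ψ : 𝓢(ℝ, ℂ)) : CausalContinuous (fun t => N t ψ) := by
    rw [hNψ ψ]
    exact (hfam ψ).causalContinuous_integral
  have hbfam (ψ : 𝓢(ℝ, ℂ)) := (dominatedFamily_solutionStar hα0 hα1 hre hbm hφ hφc hφi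
    (q := fun k => -totalSymbol μ γ θ k * fourierStarInvCLM ψ k)
    (hbm.neg.mul (hqm ψ)) (hbq ψ)).causalContinuous_integral
  have hsfam (ψ : 𝓢(ℝ, ℂ)) :=
    (dominatedFamily_sourceStar hφ hφc hφi (hqm ψ) (hq ψ)).causalContinuous_integral
  have hrl (ψ : 𝓢(ℝ, ℂ)) {t : ℝ} (ht : 0 < t) := by
    have h := rlIntegral_integral_solutionStar hα0 hα1 hre hbm hφ hφc hφi (hqm ψ) (hq ψ)
      (hbq ψ) ht
    rw [integral_fourierStarInvCLM, ← hNψ ψ] at h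
    exact h
  have hRF (t : ℝ) (j : Fin n) : ∃ S, HasRieszFellerDeriv (γ j) (θ j) (N t) S := by
    have h := integrable_mul_div_weight (κ := id) measurable_id
      (measurable_rieszFellerSymbol (γ j) (θ j)).neg (C := 1)
      (fun k => by
        rw [Pi.neg_apply, norm_neg, one_mul]
        exact norm_rieszFellerSymbol_le (hγ0 j) (hγ2 j) _ _) (hw t)
    obtain ⟨S, hS⟩ := exists_hasFourierStar h
    exact ⟨S, _, hN t, hS⟩
  choose S hS using hRF
  refine ⟨N, ⟨?_, fun ψ => (hcc ψ).cont, ?_, fun ψ => ?_, fun ψ => ?_, fun t _ ψ => ?_⟩, hN⟩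
  · refine ⟨solutionStar α (totalSymbol μ γ θ) φ, fun t _ => hN t, fun T hT => ⟨2, ?_⟩⟩
    have hB := (causalContinuous_solutionBound hα0 hφ hφc hφi).integrableOn_Ioc T
    have h2 := integrable_one_div_weight.norm.mul_prod hB
    rw [IntegrableOn, Measure.volume_eq_prod, ← Measure.prod_restrict, Measure.restrict_univ]
    refine h2.mono' ?_ (Eventually.of_forall fun p => ?_)
    · exact ((measurable_solutionStar hα0 hα1 hbm hφ hφc).div
        (by fun_prop)).aestronglyMeasurable
    · rw [norm_div, norm_div, norm_one, one_div, mul_comm, ← div_eq_mul_inv]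
      gcongr
      exact norm_solutionStar_le hα0 hα1 hre hφ hφc hφi p.1 p.2
  · refine ⟨fun j t => S t j, fun j t _ => hS t j, fun t ht ψ => ?_⟩
    rw [(hN t).sum_rieszFeller (hS t), integral_source_mul hφ ht,
      hasRLDerivAt_iff hα0 hα1 (hcc ψ).cont (fun T _ => (hcc ψ).integrableOn_Ioc T) ht]
    have h1 : CausalContinuous fun s =>
        (∫ k, (-totalSymbol μ γ θ k * fourierStarInvCLM ψ k) *
          solutionStar α (totalSymbol μ γ θ) φ k s)
        + ∫ k, fourierStarInvCLM ψ k * sourceStar φ k s := (hbfam ψ).add (hsfam ψ)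
    have h2 := (hasDerivAt_integral_of_causal h1.cont
      (fun T _ => h1.integrableOn_Ioc T) ht).const_add (ψ 0)
    refine h2.congr_of_eventuallyEq ?_
    filter_upwards [Ioi_mem_nhds ht] with s hs using hrl ψ hs
  · have h1 := ((hbfam ψ).add (hsfam ψ)).toCausal
    have h2 := (tendsto_integral_zero h1).const_add (ψ 0)
    rw [add_zero] at h2
    rw [TemperedDistribution.delta_apply]
    refine h2.congr' ?_
    filter_upwards [self_mem_nhdsWithin] with t ht using (hrl ψ ht).symm
  · exact tendsto_rlIntegral_zero (hcc ψ).toCausal (by linarith)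
  · exact (hN t).tendsto_translate ψ

end Existence

/-! ### Integration as a convolution -/

section Step

variable {𝕜 : Type*} [RCLike 𝕜]

/-- The Heaviside function. -/
noncomputable def step (𝕜 : Type*) [RCLike 𝕜] : ℝ → 𝕜 := (Ioi 0).indicator fun _ => 1

lemma rlKernelC_one_eq_step : rlKernelC 1 = step ℂ := by
  funext t
  by_cases ht : 0 < t
  · rw [rlKernelC, rlKernel_one ht, step, indicator_of_mem (mem_Ioi.2 ht), Complex.ofReal_one]
  · rw [(causalContinuous_rlKernelC one_pos).zero t (not_lt.1 ht), step,
      indicator_of_notMem (s := Ioi (0 : ℝ)) ht]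

lemma causalContinuous_step : CausalContinuous (step 𝕜) :=
  CausalContinuous.of_indicator continuousOn_const fun T _ => integrableOn_const (by simp)

lemma norm_step (t : ℝ) : ‖step 𝕜 t‖ = step ℝ t := by
  rw [step, step, norm_indicator_eq_indicator_norm]
  simp

lemma step_mul_eq (f : ℝ → 𝕜) (t s : ℝ) :
    step 𝕜 s * f (t - s) = (Iic t).indicator f (t - s) * step 𝕜 s := by
  by_cases hs : 0 < s
  · rw [indicator_of_mem (show t - s ∈ Iic t by simp only [mem_Iic]; linarith), mul_comm]
  · rw [step, indicator_of_notMem (s := Ioi (0 : ℝ)) hs, zero_mul, mul_zero]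

lemma convolutionExists_step {f : ℝ → 𝕜} (hf : Causal f) :
    ConvolutionExists (step 𝕜) f (ContinuousLinearMap.mul ℝ 𝕜) := by
  intro t
  change Integrable fun s => step 𝕜 s * f (t - s)
  simp_rw [fun s => step_mul_eq f t s]
  refine ((hf.integrable_indicator t).comp_sub_left t).mul_bdd (c := 1)
    causalContinuous_step.aestronglyMeasurable (Eventually.of_forall fun s => ?_)
  rw [norm_step, step]
  exact indicator_apply_le' (fun _ => le_rfl) fun _ => zero_le_one

lemma conv_step {f : ℝ → 𝕜} (hf : Causal f) {t : ℝ} (ht : 0 ≤ t) :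
    conv (step 𝕜) f t = ∫ s in (0 : ℝ)..t, f s := by
  rw [Causal.conv_eq_integral' causalContinuous_step.zero hf.zero ht,
    intervalIntegral.integral_of_le ht, intervalIntegral.integral_of_le ht,
    integral_Ioc_eq_integral_Ioo, integral_Ioc_eq_integral_Ioo]
  refine setIntegral_congr_fun measurableSet_Ioo fun s hs => ?_
  rw [step, indicator_of_mem (by simpa using hs.2), one_mul]

lemma Causal.causalContinuous_conv_step {f : ℝ → 𝕜} (hf : Causal f) :
    CausalContinuous (conv (step 𝕜) f) where
  toCausal := causalContinuous_step.toCausal.conv hf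
  cont := by
    have h := intervalIntegral.continuous_primitive (μ := volume) (f := f) (fun a b => by
      refine (hf.int (max a b)).mono_set ?_ |>.intervalIntegrable
      exact fun x hx => hx.2) 0
    exact h.continuousOn.congr fun t ht => conv_step hf (le_of_lt ht)

/-- Associativity with the Heaviside function in the middle needs no continuity of the last
factor. -/
lemma CausalContinuous.conv_step_assoc {f g : ℝ → 𝕜} (hf : CausalContinuous f) (hg : Causal g)
    (t : ℝ) : conv (conv f (step 𝕜)) g t = conv f (conv (step 𝕜) g) t := by
  have e : (fun s => ‖step 𝕜 s‖) = step ℝ := funext norm_step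
  refine convolution_assoc _ _ _ _ (fun x y z => mul_assoc x y z) hf.aestronglyMeasurable
    causalContinuous_step.aestronglyMeasurable hg.aestronglyMeasurable
    (Eventually.of_forall (hf.convolutionExists causalContinuous_step)) ?_ ?_
  · rw [e]
    exact Eventually.of_forall (convolutionExists_step hg.norm)
  · rw [e]
    exact hf.norm.convolutionExists hg.norm.causalContinuous_conv_step t

end Step

/-! ### Uniqueness -/

/-- Fubini for a function of frequency and time that is integrable against a polynomial weight in
the frequency, tested against a bounded function of time and a function of rapid decay in
frequency. -/
lemma integral_mul_integral_swap {D : ℝ → ℝ → ℂ} {m : ℕ} {ν : Measure ℝ} [SFinite ν]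
    (hD : Integrable (fun p : ℝ × ℝ => D p.1 p.2 / ((1 + |p.1| : ℝ) : ℂ) ^ m) (volume.prod ν))
    {K : ℝ → ℂ} (hK : Measurable K) {M : ℝ} (hM : ∀ᵐ s ∂ν, ‖K s‖ ≤ M)
    {a : ℝ → ℂ} (ha : Measurable a) {C : ℝ} (haC : ∀ k, ‖a k‖ ≤ C * (1 + |k|) ^ 2) :
    Integrable (fun k => (a k * ∫ s, K s * D k s ∂ν) / ((1 + |k| : ℝ) : ℂ) ^ (m + 2)) ∧
    ∀ g : 𝓢(ℝ, ℂ), ∫ s, (K s * ∫ k, (a k * g k) * D k s) ∂ν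
      = ∫ k, (a k * ∫ s, K s * D k s ∂ν) * g k := by
  have hKp : ∀ᵐ p ∂((volume : Measure ℝ).prod ν), ‖K p.2‖ ≤ M :=
    Measure.quasiMeasurePreserving_snd.ae hM
  have h1 : Integrable (fun p : ℝ × ℝ =>
      (K p.2 * D p.1 p.2) / ((1 + |p.1| : ℝ) : ℂ) ^ m) (volume.prod ν) := by
    simp_rw [mul_div_assoc]
    exact hD.bdd_mul (hK.comp measurable_snd).aestronglyMeasurable hKp
  have h2 := integrable_mul_div_weight measurable_fst ha haC h1
  constructor
  · refine h2.integral_prod_left.congr (Eventually.of_forall fun k => ?_)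
    simp only [← integral_const_mul, ← integral_div]
  · intro g
    have h3 := integrable_mul_schwartz_of_weight measurable_fst h2 g
    have h4 := integral_integral_swap (f := fun k s => a k * (K s * D k s) * g k) h3
    simp only [← integral_const_mul, ← integral_mul_const]
    refine Eq.trans ?_ h4.symm
    refine integral_congr_ae (Eventually.of_forall fun s => ?_)
    refine integral_congr_ae (Eventually.of_forall fun k => ?_)
    ring

lemma norm_one_le_mul_sq (k : ℝ) : ‖(1 : ℂ)‖ ≤ 1 * (1 + |k|) ^ 2 := by
  rw [norm_one, one_mul]
  nlinarith [abs_nonneg k]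

section Homogeneous

-- `D` is the difference of the Fourier transforms of two solutions, and `d ψ` its pairing with `ψ`
variable {α : ℝ} {b : ℝ → ℂ} {D : ℝ → ℝ → ℂ} {d : 𝓢(ℝ, ℂ) → ℝ → ℂ}

lemma integrable_restrict_prod {m : ℕ} {T : ℝ}
    (h : IntegrableOn (fun p : ℝ × ℝ => D p.1 p.2 / ((1 + |p.1| : ℝ) : ℂ) ^ m)
      (univ ×ˢ Ioc 0 T)) :
    Integrable (fun p : ℝ × ℝ => D p.1 p.2 / ((1 + |p.1| : ℝ) : ℂ) ^ m)
      (volume.prod (volume.restrict (Ioc 0 T))) := by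
  rwa [IntegrableOn, Measure.volume_eq_prod, ← Measure.prod_restrict, Measure.restrict_univ] at h

/-- The pairings of `D` with functions of rapid decay in frequency are integrable in time. -/
lemma integrableOn_integral_mul
    (hD : ∀ T, 0 < T → ∃ m : ℕ,
      IntegrableOn (fun p : ℝ × ℝ => D p.1 p.2 / ((1 + |p.1| : ℝ) : ℂ) ^ m) (univ ×ˢ Ioc 0 T))
    {a : ℝ → ℂ} (ha : Measurable a) {C : ℝ} (haC : ∀ k, ‖a k‖ ≤ C * (1 + |k|) ^ 2)
    (g : 𝓢(ℝ, ℂ)) {T : ℝ} (hT : 0 < T) :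
    IntegrableOn (fun s => ∫ k, (a k * g k) * D k s) (Ioc 0 T) := by
  obtain ⟨m, hm⟩ := hD T hT
  have h1 := integrable_mul_div_weight measurable_fst ha haC (integrable_restrict_prod hm)
  have h2 := (integrable_mul_schwartz_of_weight measurable_fst h1 g).integral_prod_right
  refine h2.congr (Eventually.of_forall fun s => ?_)
  refine integral_congr_ae (Eventually.of_forall fun k => ?_)
  ring

lemma ae_causal_of_weight
    (hD : ∀ T, 0 < T → ∃ m : ℕ,
      IntegrableOn (fun p : ℝ × ℝ => D p.1 p.2 / ((1 + |p.1| : ℝ) : ℂ) ^ m) (univ ×ˢ Ioc 0 T)) :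
    ∀ᵐ k, Causal ((Ioi 0).indicator (D k)) := by
  have h1 : ∀ᵐ k, ∀ n : ℕ, IntegrableOn (D k) (Ioc 0 (n + 1)) := by
    rw [ae_all_iff]
    intro n
    obtain ⟨m, hm⟩ := hD (n + 1) (by positivity)
    filter_upwards [(integrable_restrict_prod hm).prod_right_ae] with k hk
    refine (hk.mul_const (((1 + |k| : ℝ) : ℂ) ^ m)).congr (Eventually.of_forall fun s => ?_)
    exact div_mul_cancel₀ _ (pow_ne_zero m (ofReal_one_add_abs_ne_zero k))
  filter_upwards [h1] with k hk
  refine Causal.of_indicator fun T _ => ?_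
  obtain ⟨n, hn⟩ := exists_nat_ge T
  exact (hk n).mono_set (Ioc_subset_Ioc_right (by linarith))

/-- The problem with zero data has only the zero solution. -/
theorem eq_zero_of_homogeneous (hα0 : 0 < α) (hα1 : α ≤ 1) (hbm : Measurable b) {C : ℝ}
    (hbC : ∀ k, ‖b k‖ ≤ C * (1 + |k|) ^ 2)
    (hD : ∀ T, 0 < T → ∃ m : ℕ,
      IntegrableOn (fun p : ℝ × ℝ => D p.1 p.2 / ((1 + |p.1| : ℝ) : ℂ) ^ m) (univ ×ˢ Ioc 0 T))
    (hd : ∀ ψ t, 0 < t → d ψ t = ∫ k, fourierStarInvCLM ψ k * D k t)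
    (hc : ∀ ψ, ContinuousOn (d ψ) (Ioi 0))
    (heq : ∀ ψ t, 0 < t → rlIntegral (1 - α) (d ψ) t
      = ∫ s in (0 : ℝ)..t, ∫ k, (-b k * fourierStarInvCLM ψ k) * D k s)
    (ψ : 𝓢(ℝ, ℂ)) {t : ℝ} (ht : 0 < t) : d ψ t = 0 := by
  have hnegb : ∀ k, ‖(-b) k‖ ≤ C * (1 + |k|) ^ 2 := fun k => (norm_neg _).trans_le (hbC k)
  have hkα := causalContinuous_rlKernelC hα0
  have hk1 := causalContinuous_rlKernelC (by linarith : 0 < α + 1)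
  have hkstep : conv (rlKernelC α) (step ℂ) = rlKernelC (α + 1) := by
    rw [← rlKernelC_one_eq_step, conv_rlKernelC hα0 one_pos]
  have hdi (ψ : 𝓢(ℝ, ℂ)) (T : ℝ) (hT : 0 < T) : IntegrableOn (d ψ) (Ioc 0 T) := by
    refine (integrableOn_integral_mul hD measurable_const norm_one_le_mul_sq
      (fourierStarInvCLM ψ) hT).congr_fun
      (fun s hs => ?_) measurableSet_Ioc
    rw [hd ψ s hs.1]
    simp only [one_mul]
  -- the equation integrated to order one, in a form where time enters through bounded kernels
  have hA (ψ : 𝓢(ℝ, ℂ)) {t : ℝ} (ht : 0 < t) : ∫ s in (0 : ℝ)..t, d ψ s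
      = ∫ s in Ioc 0 t, rlKernelC (α + 1) (t - s) *
          ∫ k, ((-b) k * fourierStarInvCLM ψ k) * D k s := by
    have hq : Causal ((Ioi 0).indicator
        fun s => ∫ k, ((-b) k * fourierStarInvCLM ψ k) * D k s) :=
      Causal.of_indicator fun T hT =>
        integrableOn_integral_mul hD hbm.neg hnegb (fourierStarInvCLM ψ) hT
    have e : (Ioi 0).indicator (rlIntegral (1 - α) (d ψ)) = conv (step ℂ) ((Ioi 0).indicator
        fun s => ∫ k, ((-b) k * fourierStarInvCLM ψ k) * D k s) := by
      funext s
      rcases le_or_gt s 0 with hs | hs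
      · rw [indicator_of_notMem (by simpa using hs),
          Causal.conv_of_nonpos causalContinuous_step.zero hq.zero hs]
      · rw [indicator_of_mem (mem_Ioi.2 hs), conv_step hq hs.le, heq ψ s hs,
          intervalIntegral_indicator_Ioi _ hs.le]
        rfl
    rw [← conv_rlKernelC_indicator_rlIntegral hα0 hα1 (hc ψ) (hdi ψ) ht.le, e,
      ← hkα.conv_step_assoc hq, hkstep, Causal.conv_eq_integral' hk1.zero hq.zero ht.le,
      intervalIntegral.integral_of_le ht.le]
    refine setIntegral_congr_fun measurableSet_Ioc fun s hs => ?_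
    rw [indicator_of_mem (mem_Ioi.2 hs.1)]
  have hKm (t : ℝ) : Measurable fun s => rlKernelC (α + 1) (t - s) :=
    (measurable_rlKernelC _).comp (measurable_const.sub measurable_id)
  have hKb {t : ℝ} (ht : 0 < t) : ∀ᵐ s ∂(volume.restrict (Ioc 0 t)),
      ‖rlKernelC (α + 1) (t - s)‖ ≤ t ^ α / Real.Gamma (α + 1) := by
    have hΓ := Real.Gamma_pos_of_pos (by linarith : 0 < α + 1)
    refine (ae_restrict_mem measurableSet_Ioc).mono fun s hs => ?_
    rw [norm_rlKernelC (by linarith)]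
    rcases le_or_gt (t - s) 0 with h | h
    · rw [(causalContinuous_rlKernel (by linarith : 0 < α + 1)).zero _ h]
      positivity
    · rw [rlKernel_of_pos _ h, add_sub_cancel_right]
      have : t - s ≤ t := by linarith [hs.1]
      gcongr
  -- for each time, the Volterra equation holds at almost every frequency
  have hB {t : ℝ} (ht : 0 < t) : ∀ᵐ k, (∫ s in Ioc 0 t, D k s)
      = -b k * ∫ s in Ioc 0 t, rlKernelC (α + 1) (t - s) * D k s := by
    obtain ⟨m, hm⟩ := hD t ht
    have hm' := integrable_restrict_prod hm
    obtain ⟨hl1, hl2⟩ := integral_mul_integral_swap hm' (K := fun _ => 1) measurable_const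
      (Eventually.of_forall fun _ => norm_one.le) (a := fun _ => 1) measurable_const
      norm_one_le_mul_sq
    obtain ⟨hr1, hr2⟩ := integral_mul_integral_swap hm' (hKm t) (hKb ht) hbm.neg hnegb
    have h := ae_eq_of_integral_mul_fourierStarInvCLM (locallyIntegrable_of_weight hl1)
      (locallyIntegrable_of_weight hr1) fun ψ => ?_
    · simpa only [one_mul] using! h
    · rw [← hl2, ← hr2, ← hA ψ ht, intervalIntegral.integral_of_le ht.le]
      refine setIntegral_congr_fun measurableSet_Ioc fun s hs => ?_
      simp only [one_mul]
      exact (hd ψ s hs.1).symm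
  -- restricting to rational times leaves a single null set of exceptional frequencies
  have hBall : ∀ᵐ k, ∀ r : ℚ, 0 < (r : ℝ) → (∫ s in Ioc 0 (r : ℝ), D k s)
      = -b k * ∫ s in Ioc 0 (r : ℝ), rlKernelC (α + 1) (r - s) * D k s := by
    rw [ae_all_iff]
    intro r
    by_cases hr : 0 < (r : ℝ)
    · filter_upwards [hB hr] with k hk _ using hk
    · exact Eventually.of_forall fun k h => absurd h hr
  -- the primitive in time satisfies the homogeneous Volterra equation
  have hzero : ∀ᵐ k, ∀ t, 0 < t → ∫ s in Ioc 0 t, D k s = 0 := by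
    filter_upwards [hBall, ae_causal_of_weight hD] with k hk hcau
    set f := (Ioi 0).indicator (D k) with hf
    have hG := hcau.causalContinuous_conv_step
    have eG {t : ℝ} (ht : 0 < t) : conv (step ℂ) f t = ∫ s in Ioc 0 t, D k s := by
      rw [conv_step hcau ht.le, intervalIntegral_indicator_Ioi _ ht.le,
        intervalIntegral.integral_of_le ht.le]
    have eK {t : ℝ} (ht : 0 < t) : conv (rlKernelC α) (conv (step ℂ) f) t
        = ∫ s in Ioc 0 t, rlKernelC (α + 1) (t - s) * D k s := by
      rw [← hkα.conv_step_assoc hcau t, hkstep,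
        Causal.conv_eq_integral' hk1.zero hcau.zero ht.le, intervalIntegral.integral_of_le ht.le]
      refine setIntegral_congr_fun measurableSet_Ioc fun s hs => ?_
      rw [hf, indicator_of_mem (mem_Ioi.2 hs.1)]
    have hvolt : ∀ t, 0 < t →
        conv (step ℂ) f t = -b k * conv (rlKernelC α) (conv (step ℂ) f) t := by
      have hcont := (hG.cont.sub
        (((hkα.conv hG).const_mul (-b k)).cont)).mono (subset_refl (Ioi (0 : ℝ)))
      intro t ht
      by_contra hne
      have hopen : IsOpen (Ioi (0 : ℝ) ∩ (fun t => conv (step ℂ) f t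
          - -b k * conv (rlKernelC α) (conv (step ℂ) f) t) ⁻¹' {0}ᶜ) :=
        hcont.isOpen_inter_preimage isOpen_Ioi isOpen_compl_singleton
      obtain ⟨x, ⟨hx0, hx1⟩, ⟨r, rfl⟩⟩ := Rat.denseRange_cast.inter_open_nonempty _ hopen
        ⟨t, ht, fun h => hne (sub_eq_zero.1 h)⟩
      refine hx1 (sub_eq_zero.2 ?_)
      rw [eG hx0, eK hx0]
      exact hk r hx0
    intro t ht
    rw [← eG ht]
    exact eq_zero_of_volterra hα0 hα1 hG hvolt t
  have hprim {t : ℝ} (ht : 0 < t) : ∫ s in (0 : ℝ)..t, d ψ s = 0 := by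
    obtain ⟨m, hm⟩ := hD t ht
    obtain ⟨-, hl2⟩ := integral_mul_integral_swap (integrable_restrict_prod hm) (K := fun _ => 1)
      measurable_const (Eventually.of_forall fun _ => norm_one.le) (a := fun _ => 1)
      measurable_const norm_one_le_mul_sq
    have h1 := hl2 (fourierStarInvCLM ψ)
    simp only [one_mul] at h1
    rw [intervalIntegral.integral_of_le ht.le, setIntegral_congr_fun measurableSet_Ioc
      (fun s hs => hd ψ s hs.1), h1]
    refine integral_eq_zero_of_ae ?_
    filter_upwards [hzero] with k hk
    rw [hk t ht, zero_mul]
    rfl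
  have h1 := hasDerivAt_integral_of_causal (hc ψ) (hdi ψ) ht
  refine h1.unique ((hasDerivAt_const t (0 : ℂ)).congr_of_eventuallyEq ?_)
  filter_upwards [Ioi_mem_nhds ht] with s hs using hprim hs

end Homogeneous

lemma rlIntegral_sub {ν : ℝ} (hν : 0 ≤ ν) {u v : ℝ → ℂ} (hu : ContinuousOn u (Ioi 0))
    (hui : ∀ T, 0 < T → IntegrableOn u (Ioc 0 T)) (hv : ContinuousOn v (Ioi 0))
    (hvi : ∀ T, 0 < T → IntegrableOn v (Ioc 0 T)) {t : ℝ} (ht : 0 < t) :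
    rlIntegral ν (fun s => u s - v s) t = rlIntegral ν u t - rlIntegral ν v t := by
  rcases hν.eq_or_lt with rfl | hν
  · simp only [rlIntegral_zero]
  have e : (Ioi 0).indicator (fun s => u s - v s)
      = fun s => (Ioi 0).indicator u s + (-1) * (Ioi 0).indicator v s := by
    funext s
    by_cases hs : s ∈ Ioi (0 : ℝ)
    · simp only [indicator_of_mem hs]
      ring
    · simp only [indicator_of_notMem hs]
      ring
  have hu' := CausalContinuous.of_indicator hu hui
  have hv' := CausalContinuous.of_indicator hv hvi
  rw [rlIntegral_eq_conv hν _ ht, rlIntegral_eq_conv hν _ ht, rlIntegral_eq_conv hν _ ht, e,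
    conv_add_right (causalContinuous_rlKernelC hν) hu' (hv'.const_mul (-1)),
    conv_const_mul_right]
  ring

lemma integrable_div_weight_add {X : Type*} [MeasurableSpace X] {ν : Measure X} {κ : X → ℝ}
    (hκ : Measurable κ) {h : X → ℂ} {m : ℕ}
    (hh : Integrable (fun p => h p / ((1 + |κ p| : ℝ) : ℂ) ^ m) ν) (m' : ℕ) :
    Integrable (fun p => h p / ((1 + |κ p| : ℝ) : ℂ) ^ (m + m')) ν := by
  have e : (fun p => h p / ((1 + |κ p| : ℝ) : ℂ) ^ (m + m')) = fun p =>
      (1 / ((1 + |κ p| : ℝ) : ℂ) ^ m') * (h p / ((1 + |κ p| : ℝ) : ℂ) ^ m) := by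
    funext p
    have := ofReal_one_add_abs_ne_zero (κ p)
    rw [pow_add]
    field_simp
  rw [e]
  refine hh.bdd_mul (c := 1) ?_ (Eventually.of_forall fun p => ?_)
  · exact (measurable_const.div ((Complex.measurable_ofReal.comp
      (measurable_const.add hκ.norm)).pow_const m')).aestronglyMeasurable
  · rw [norm_div, norm_one_add_abs_pow, norm_one, div_le_one (by positivity)]
    exact one_le_pow₀ (by linarith [abs_nonneg (κ p)])

section Uniqueness

variable {n : ℕ} {α : ℝ} {μ γ θ : Fin n → ℝ} {φ : ℝ → ℝ → ℂ}
  (hα0 : 0 < α) (hα1 : α ≤ 1)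
  (hμ : ∀ j, 0 < μ j) (hγ0 : ∀ j, 0 < γ j) (hγ2 : ∀ j, γ j ≤ 2)
  (hφ : ∀ t, 0 < t → Integrable (fun x => φ x t))
  (hφc : ∀ t₀, 0 < t₀ → Tendsto (fun t => ∫ x : ℝ, ‖φ x t - φ x t₀‖) (𝓝 t₀) (𝓝 0))
  (hφi : ∀ T, 0 < T → IntegrableOn (fun t => ∫ x : ℝ, ‖φ x t‖) (Ioc 0 T))

lemma integrableOn_pairing {N : ℝ → 𝓢'(ℝ, ℂ)} {Nstar : ℝ → ℝ → ℂ}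
    (hs : ∀ t, 0 < t → HasFourierStar (N t) (fun k => Nstar k t))
    (hi : ∀ T, 0 < T → ∃ m : ℕ,
      IntegrableOn (fun p : ℝ × ℝ => Nstar p.1 p.2 / ((1 + |p.1| : ℝ) : ℂ) ^ m) (univ ×ˢ Ioc 0 T))
    (ψ : 𝓢(ℝ, ℂ)) {T : ℝ} (hT : 0 < T) : IntegrableOn (fun t => N t ψ) (Ioc 0 T) := by
  refine (integrableOn_integral_mul hi measurable_const norm_one_le_mul_sq
    (fourierStarInvCLM ψ) hT).congr_fun (fun s hs' => ?_) measurableSet_Ioc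
  rw [(hs s hs'.1).apply ψ]
  simp only [one_mul, mul_comm]

include hα0 hα1 hμ hγ0 hγ2 hφ hφc hφi in
/-- The equation and the first initial condition, integrated in time. -/
lemma IsDeltaSolution.rlIntegral_eq {N : ℝ → 𝓢'(ℝ, ℂ)} (hN : IsDeltaSolution α μ γ θ φ N)
    {Nstar : ℝ → ℝ → ℂ} (hs : ∀ t, 0 < t → HasFourierStar (N t) (fun k => Nstar k t))
    (hi : ∀ T, 0 < T → ∃ m : ℕ,
      IntegrableOn (fun p : ℝ × ℝ => Nstar p.1 p.2 / ((1 + |p.1| : ℝ) : ℂ) ^ m) (univ ×ˢ Ioc 0 T))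
    (ψ : 𝓢(ℝ, ℂ)) {t : ℝ} (ht : 0 < t) :
    rlIntegral (1 - α) (fun τ => N τ ψ) t
      = ψ 0 + ((∫ s in (0 : ℝ)..t, ∫ k, (-totalSymbol μ γ θ k * fourierStarInvCLM ψ k) * Nstar k s)
        + ∫ s in (0 : ℝ)..t, ∫ k, fourierStarInvCLM ψ k * sourceStar φ k s) := by
  obtain ⟨S, hS, hSeq⟩ := hN.equation
  have hderiv : ∀ s, 0 < s → HasDerivAt (rlIntegral (1 - α) (fun τ => N τ ψ))
      ((∫ k, (-totalSymbol μ γ θ k * fourierStarInvCLM ψ k) * Nstar k s)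
        + ∫ k, fourierStarInvCLM ψ k * sourceStar φ k s) s := by
    intro s hs0
    have h := hSeq s hs0 ψ
    rwa [(hs s hs0).sum_rieszFeller (fun j => hS j s hs0), integral_source_mul hφ hs0,
      hasRLDerivAt_iff hα0 hα1 (hN.continuousOn ψ)
        (fun T hT => integrableOn_pairing hs hi ψ hT) hs0] at h
  have h1 : IntervalIntegrable (fun s => ∫ k, (-totalSymbol μ γ θ k * fourierStarInvCLM ψ k)
      * Nstar k s) volume 0 t :=
    (intervalIntegrable_iff_integrableOn_Ioc_of_le ht.le).2
      (integrableOn_integral_mul hi measurable_totalSymbol.neg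
        (fun k => (norm_neg _).trans_le (norm_totalSymbol_le hμ hγ0 hγ2 k)) _ ht)
  have h2 : IntervalIntegrable (fun s => ∫ k, fourierStarInvCLM ψ k * sourceStar φ k s)
      volume 0 t :=
    (dominatedFamily_sourceStar hφ hφc hφi (fourierStarInvCLM ψ).continuous.measurable
      (fourierStarInvCLM ψ).integrable).causalContinuous_integral.intervalIntegrable ht.le
  have h3 := intervalIntegral.integral_eq_sub_of_hasDerivAt_of_tendsto ht
    (fun s hs' => hderiv s hs'.1) (h1.add h2) (hN.initial_one ψ)
    ((hderiv t ht).continuousAt.tendsto.mono_left nhdsWithin_le_nhds)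
  rw [← intervalIntegral.integral_add h1 h2, h3, TemperedDistribution.delta_apply]
  ring

include hα0 hα1 hμ hγ0 hγ2 hφ hφc hφi in
/-- Solutions are unique. -/
theorem IsDeltaSolution.eq {N M : ℝ → 𝓢'(ℝ, ℂ)} (hN : IsDeltaSolution α μ γ θ φ N)
    (hM : IsDeltaSolution α μ γ θ φ M) {t : ℝ} (ht : 0 < t) (ψ : 𝓢(ℝ, ℂ)) : N t ψ = M t ψ := by
  obtain ⟨Ns, hNs, hNi⟩ := hN.fourier
  obtain ⟨Ms, hMs, hMi⟩ := hM.fourier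
  have hbm : Measurable (totalSymbol μ γ θ) := measurable_totalSymbol
  have hbC := norm_totalSymbol_le (θ := θ) hμ hγ0 hγ2
  have hbC' (k : ℝ) : ‖(-totalSymbol μ γ θ) k‖ ≤ (∑ j, μ j) * (1 + |k|) ^ 2 :=
    (norm_neg _).trans_le (hbC k)
  refine sub_eq_zero.1 (eq_zero_of_homogeneous (α := α) (b := totalSymbol μ γ θ)
    (D := fun k s => Ns k s - Ms k s) (d := fun ψ s => N s ψ - M s ψ) hα0 hα1 hbm hbC
    (fun T hT => ?_) (fun ψ s hs => ?_) (fun ψ => (hN.continuousOn ψ).sub (hM.continuousOn ψ))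
    (fun ψ s hs => ?_) ψ ht)
  · obtain ⟨m, hm⟩ := hNi T hT
    obtain ⟨m', hm'⟩ := hMi T hT
    refine ⟨m + m', ?_⟩
    have h2 := integrable_div_weight_add measurable_fst hm' m
    rw [add_comm] at h2
    simp only [sub_div]
    exact (integrable_div_weight_add measurable_fst hm m').sub h2
  · rw [(hNs s hs).apply ψ, (hMs s hs).apply ψ,
      ← integral_sub ((hNs s hs).integrable_mul _) ((hMs s hs).integrable_mul _)]
    congr 1
    funext k
    ring
  · have hint {Ns : ℝ → ℝ → ℂ} (hNi : ∀ T, 0 < T → ∃ m : ℕ, IntegrableOn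
        (fun p : ℝ × ℝ => Ns p.1 p.2 / ((1 + |p.1| : ℝ) : ℂ) ^ m) (univ ×ˢ Ioc 0 T)) :
        IntervalIntegrable (fun r => ∫ k, (-totalSymbol μ γ θ k * fourierStarInvCLM ψ k) * Ns k r)
          volume 0 s :=
      (intervalIntegrable_iff_integrableOn_Ioc_of_le hs.le).2
        (integrableOn_integral_mul hNi hbm.neg hbC' _ hs)
    rw [rlIntegral_sub (by linarith) (hN.continuousOn ψ)
        (fun T hT => integrableOn_pairing hNs hNi ψ hT) (hM.continuousOn ψ)
        (fun T hT => integrableOn_pairing hMs hMi ψ hT) hs,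
      hN.rlIntegral_eq hα0 hα1 hμ hγ0 hγ2 hφ hφc hφi hNs hNi ψ hs,
      hM.rlIntegral_eq hα0 hα1 hμ hγ0 hγ2 hφ hφc hφi hMs hMi ψ hs, add_sub_add_left_eq_sub,
      add_sub_add_right_eq_sub, ← intervalIntegral.integral_sub (hint hNi) (hint hMi),
      intervalIntegral.integral_of_le hs.le, intervalIntegral.integral_of_le hs.le]
    refine setIntegral_congr_fun measurableSet_Ioc fun r hr => ?_
    have hint' {T : 𝓢'(ℝ, ℂ)} {h : ℝ → ℂ} (hT : HasFourierStar T h) :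
        Integrable fun k => (-totalSymbol μ γ θ k * fourierStarInvCLM ψ k) * h k := by
      obtain ⟨m, hm⟩ := hT.1
      refine (integrable_mul_schwartz_of_weight measurable_id
        (integrable_mul_div_weight measurable_id hbm.neg hbC' hm) (fourierStarInvCLM ψ)).congr
        (Eventually.of_forall fun k => ?_)
      simp only [id, Pi.neg_apply]
      ring
    rw [← integral_sub (hint' (hNs r hr.1)) (hint' (hMs r hr.1))]
    congr 1
    funext k
    ring

end Uniqueness

/-! ### The solution formula -/

section Formula

variable {α : ℝ} {b : ℝ → ℂ} {φ : ℝ → ℝ → ℂ}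
  (hα0 : 0 < α) (hα1 : α ≤ 1) (hb : ∀ k, 0 ≤ (b k).re) (hbm : Measurable b)
  (hφ : ∀ t, 0 < t → Integrable (fun x => φ x t))
  (hφc : ∀ t₀, 0 < t₀ → Tendsto (fun t => ∫ x : ℝ, ‖φ x t - φ x t₀‖) (𝓝 t₀) (𝓝 0))
  (hφi : ∀ T, 0 < T → IntegrableOn (fun t => ∫ x : ℝ, ‖φ x t‖) (Ioc 0 T))

/-- The integrals of the solution formula, with a function `q` of the frequency in place of the
exponential `exp (-ikx)`, are `∫ q(k) N*(k, t) dk`. -/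
lemma integral_mul_solutionStar {q : ℝ → ℂ} {t : ℝ} (ht : 0 < t)
    (h1 : Integrable fun k => q k * mittagLeffler α α (-b k * ((t ^ α : ℝ) : ℂ)))
    (h2 : IntegrableOn (fun p : ℝ × ℝ => ((p.1 ^ (α - 1) : ℝ) : ℂ) *
      (mittagLeffler α α (-b p.2 * ((p.1 ^ α : ℝ) : ℂ)) * q p.2 *
        fourierStar (fun x => φ x (t - p.1)) p.2)) (Ioc 0 t ×ˢ univ)) :
    Integrable (fun k => q k * solutionStar α b φ k t) ∧
      1 / (√(2 * Real.pi) : ℂ) * ∫ k, q k * solutionStar α b φ k t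
        = ((t ^ (α - 1) : ℝ) : ℂ) / (2 * Real.pi) *
            (∫ k, q k * mittagLeffler α α (-b k * ((t ^ α : ℝ) : ℂ)))
          + 1 / (√(2 * Real.pi) : ℂ) * ∫ ξ in (0 : ℝ)..t, ((ξ ^ (α - 1) : ℝ) : ℂ) *
              ∫ k, mittagLeffler α α (-b k * ((ξ ^ α : ℝ) : ℂ)) * q k *
                fourierStar (fun x => φ x (t - ξ)) k := by
  rw [IntegrableOn, Measure.volume_eq_prod, ← Measure.prod_restrict, Measure.restrict_univ] at h2
  have e (k : ℝ) : q k * solutionStar α b φ k t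
      = ((t ^ (α - 1) : ℝ) : ℂ) / (√(2 * Real.pi) : ℂ) *
          (q k * mittagLeffler α α (-b k * ((t ^ α : ℝ) : ℂ)))
        + ∫ ξ in Ioc 0 t, ((ξ ^ (α - 1) : ℝ) : ℂ) *
            (mittagLeffler α α (-b k * ((ξ ^ α : ℝ) : ℂ)) * q k *
              fourierStar (fun x => φ x (t - ξ)) k) := by
    have hz : ∀ s ≤ 0, mlKernel α (b k) s = 0 := fun s hs =>
      indicator_of_notMem (by simpa using hs) _
    have hz' : ∀ s ≤ 0, sourceStar φ k s = 0 := fun s hs =>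
      indicator_of_notMem (by simpa using hs) _
    rw [solutionStar, mlSolution, mlKernel_of_pos _ _ ht, Causal.conv_eq_integral hz hz' ht.le,
      intervalIntegral.integral_of_le ht.le, integral_Ioc_eq_integral_Ioo,
      integral_Ioc_eq_integral_Ioo, mul_add, ← integral_const_mul]
    congr 1
    · ring
    · refine setIntegral_congr_fun measurableSet_Ioo fun s hs => ?_
      rw [mlKernel_of_pos _ _ hs.1, sourceStar_of_pos φ k (sub_pos.2 hs.2)]
      ring
  have h3 := h2.integral_prod_right
  simp_rw [e]
  refine ⟨(h1.const_mul _).add h3, ?_⟩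
  rw [integral_add (h1.const_mul _) h3, integral_const_mul,
    ← integral_integral_swap (f := fun ξ k => ((ξ ^ (α - 1) : ℝ) : ℂ) *
      (mittagLeffler α α (-b k * ((ξ ^ α : ℝ) : ℂ)) * q k *
        fourierStar (fun x => φ x (t - ξ)) k)) h2,
    intervalIntegral.integral_of_le ht.le, mul_add, ← mul_assoc, div_mul_div_comm, one_mul,
    sqrt_two_pi_sq]
  simp only [integral_const_mul]

include hα0 hα1 hb hbm in
lemma integrable_mul_mittagLeffler {q : ℝ → ℂ} (hq : Integrable q) {t : ℝ} (ht : 0 < t) :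
    Integrable fun k => q k * mittagLeffler α α (-b k * ((t ^ α : ℝ) : ℂ)) := by
  refine hq.mul_bdd (c := 1 / Real.Gamma α) ?_ (Eventually.of_forall fun k => ?_)
  · exact ((continuous_mittagLeffler hα0 hα1).measurable.comp
      (hbm.neg.mul_const _)).aestronglyMeasurable
  · rw [neg_mul]
    refine norm_mittagLeffler_neg_le hα0 hα1 ?_
    rw [Complex.re_mul_ofReal]
    exact mul_nonneg (hb k) (by positivity)

include hα0 hα1 hb hbm hφ hφc hφi in
lemma integrableOn_mul_mlKernel_mul_sourceStar {q : ℝ → ℂ} (hqm : Measurable q)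
    (hq : Integrable q) {t : ℝ} :
    IntegrableOn (fun p : ℝ × ℝ => ((p.1 ^ (α - 1) : ℝ) : ℂ) *
      (mittagLeffler α α (-b p.2 * ((p.1 ^ α : ℝ) : ℂ)) * q p.2 *
        fourierStar (fun x => φ x (t - p.1)) p.2)) (Ioc 0 t ×ˢ univ) := by
  -- the source enters at the time `t - ξ`, which is positive off the null set `ξ = t`
  have e : (volume : Measure (ℝ × ℝ)).restrict (Ioc 0 t ×ˢ univ)
      = (volume : Measure (ℝ × ℝ)).restrict (Ioo 0 t ×ˢ univ) := by
    rw [Measure.volume_eq_prod, ← Measure.prod_restrict, ← Measure.prod_restrict,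
      Measure.restrict_congr_set Ioo_ae_eq_Ioc]
  have h1 : Integrable (fun s => rlKernel α s * sourceBound φ (t - s)) :=
    (causalContinuous_rlKernel hα0).convolutionExists
      (causalContinuous_sourceBound hφ hφc hφi) t
  have h2 : Integrable (fun p : ℝ × ℝ => mlKernel α (b p.2) p.1 * q p.2 *
      sourceStar φ p.2 (t - p.1)) (volume.prod volume) := by
    refine (h1.mul_prod hq.norm).mono' ?_ (Eventually.of_forall fun p => ?_)
    · refine Measurable.aestronglyMeasurable ?_
      exact (((measurable_mlKernel hα0 hα1 hbm).comp measurable_swap).mul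
        (hqm.comp measurable_snd)).mul ((measurable_sourceStar hφ hφc).comp
          (measurable_snd.prodMk (measurable_const.sub measurable_fst)))
    · rw [norm_mul, norm_mul, mul_right_comm]
      have := rlKernel_nonneg hα0 p.1
      gcongr
      · exact norm_mlKernel_le hα0 hα1 (hb _) _
      · exact norm_sourceStar_le φ _ _
  rw [IntegrableOn, e]
  refine IntegrableOn.congr_fun h2.integrableOn (fun p hp => ?_)
    (measurableSet_Ioo.prod MeasurableSet.univ)
  rw [mlKernel_of_pos _ _ hp.1.1, sourceStar_of_pos φ _ (sub_pos.2 hp.1.2)]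
  ring

end Formula

/-- Existence of the solution with `δ` initial data; the solution formula for every solution, in
the sense of tempered distributions in `x` (all integrals converging absolutely); and the formula
as an identity of functions whenever its integrals converge absolutely. -/
theorem corollary2 {n : ℕ} (α : ℝ) (μ γ θ : Fin n → ℝ) (φ : ℝ → ℝ → ℂ)
    (hα0 : 0 < α) (hα1 : α ≤ 1)
    (hμ : ∀ j, 0 < μ j) (hγ0 : ∀ j, 0 < γ j) (hγ2 : ∀ j, γ j ≤ 2)
    (hθ : ∀ j, |θ j| ≤ min (γ j) (2 - γ j))
    -- the source `t ↦ φ(·, t)` is continuous on `(0, ∞)` and integrable near `0`, into `L¹(ℝ)`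
    (hφ : ∀ t, 0 < t → Integrable (fun x => φ x t))
    (hφc : ∀ t₀, 0 < t₀ → Tendsto (fun t => ∫ x : ℝ, ‖φ x t - φ x t₀‖) (𝓝 t₀) (𝓝 0))
    (hφi : ∀ T, 0 < T → IntegrableOn (fun t => ∫ x : ℝ, ‖φ x t‖) (Ioc 0 T)) :
    (∃ N : ℝ → 𝓢'(ℝ, ℂ), IsDeltaSolution α μ γ θ φ N) ∧
    ∀ N : ℝ → 𝓢'(ℝ, ℂ), IsDeltaSolution α μ γ θ φ N → ∀ t : ℝ, 0 < t →
      -- the formula in the sense of tempered distributions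
      (∀ ψ : 𝓢(ℝ, ℂ),
        Integrable (fun k : ℝ =>
          (∫ x : ℝ, Complex.exp (-Complex.I * k * x) * ψ x) *
            mittagLeffler α α (-totalSymbol μ γ θ k * ((t ^ α : ℝ) : ℂ))) ∧
        IntegrableOn (fun p : ℝ × ℝ =>
          ((p.1 ^ (α - 1) : ℝ) : ℂ) *
            (mittagLeffler α α (-totalSymbol μ γ θ p.2 * ((p.1 ^ α : ℝ) : ℂ)) *
              (∫ x : ℝ, Complex.exp (-Complex.I * p.2 * x) * ψ x) *
              fourierStar (fun x => φ x (t - p.1)) p.2)) (Ioc 0 t ×ˢ univ) ∧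
        N t ψ =
          ((t ^ (α - 1) : ℝ) : ℂ) / (2 * Real.pi) *
            (∫ k : ℝ, (∫ x : ℝ, Complex.exp (-Complex.I * k * x) * ψ x) *
              mittagLeffler α α (-totalSymbol μ γ θ k * ((t ^ α : ℝ) : ℂ)))
          + 1 / (√(2 * Real.pi) : ℂ) *
            ∫ ξ in (0 : ℝ)..t, ((ξ ^ (α - 1) : ℝ) : ℂ) *
              ∫ k : ℝ, mittagLeffler α α (-totalSymbol μ γ θ k * ((ξ ^ α : ℝ) : ℂ)) *
                (∫ x : ℝ, Complex.exp (-Complex.I * k * x) * ψ x) *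
                fourierStar (fun x => φ x (t - ξ)) k) ∧
      -- the formula for the function `x ↦ N(x, t)`, whenever its integrals converge absolutely
      (Integrable (fun k : ℝ =>
          mittagLeffler α α (-totalSymbol μ γ θ k * ((t ^ α : ℝ) : ℂ))) →
        IntegrableOn (fun p : ℝ × ℝ =>
          ((p.1 ^ (α - 1) : ℝ) : ℂ) *
            (mittagLeffler α α (-totalSymbol μ γ θ p.2 * ((p.1 ^ α : ℝ) : ℂ)) *
              fourierStar (fun x => φ x (t - p.1)) p.2)) (Ioc 0 t ×ˢ univ) →
        ∃ F : ℝ → ℂ,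
          (∀ x : ℝ, F x =
            ((t ^ (α - 1) : ℝ) : ℂ) / (2 * Real.pi) *
              (∫ k : ℝ, Complex.exp (-Complex.I * k * x) *
                mittagLeffler α α (-totalSymbol μ γ θ k * ((t ^ α : ℝ) : ℂ)))
            + 1 / (√(2 * Real.pi) : ℂ) *
              ∫ ξ in (0 : ℝ)..t, ((ξ ^ (α - 1) : ℝ) : ℂ) *
                ∫ k : ℝ, mittagLeffler α α (-totalSymbol μ γ θ k * ((ξ ^ α : ℝ) : ℂ)) *
                  Complex.exp (-Complex.I * k * x) *
                  fourierStar (fun x' => φ x' (t - ξ)) k) ∧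
          Continuous F ∧ Tendsto F (cocompact ℝ) (𝓝 0) ∧
          ∀ ψ : 𝓢(ℝ, ℂ), N t ψ = ∫ x : ℝ, F x * ψ x) := by
  obtain ⟨M, hM, hMs⟩ := exists_isDeltaSolution hα0 hα1 hμ hγ0 hγ2 hθ hφ hφc hφi
  have hre := totalSymbol_re_nonneg (γ := γ) (θ := θ) hμ hθ
  have hbm : Measurable (totalSymbol μ γ θ) := measurable_totalSymbol
  have hc := sqrt_two_pi_ne_zero
  refine ⟨⟨M, hM⟩, fun N hN t ht => ?_⟩
  have hNψ (ψ : 𝓢(ℝ, ℂ)) :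
      N t ψ = ∫ k, solutionStar α (totalSymbol μ γ θ) φ k t * fourierStarInv ψ k := by
    rw [hN.eq hα0 hα1 hμ hγ0 hγ2 hφ hφc hφi hM ht]
    exact (hMs t).2 ψ
  refine ⟨fun ψ => ?_, fun h1 h2 => ?_⟩
  · have e : (fun k : ℝ => ∫ x : ℝ, Complex.exp (-Complex.I * k * x) * ψ x)
        = fun k => (√(2 * Real.pi) : ℂ) * fourierStarInvCLM ψ k := by
      funext k
      rw [fourierStarInvCLM_apply, fourierStarInv, ← mul_assoc, mul_one_div_cancel hc, one_mul]
    have hq : Integrable (fun k : ℝ => ∫ x : ℝ, Complex.exp (-Complex.I * k * x) * ψ x) := by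
      rw [e]
      exact (fourierStarInvCLM ψ).integrable.const_mul _
    have hqm : Measurable (fun k : ℝ => ∫ x : ℝ, Complex.exp (-Complex.I * k * x) * ψ x) := by
      rw [e]
      exact (fourierStarInvCLM ψ).continuous.measurable.const_mul _
    have h1 := integrable_mul_mittagLeffler hα0 hα1 hre hbm hq ht
    have h2 := integrableOn_mul_mlKernel_mul_sourceStar hα0 hα1 hre hbm hφ hφc hφi hqm hq (t := t)
    refine ⟨h1, h2, ?_⟩
    rw [← (integral_mul_solutionStar ht h1 h2).2, hNψ ψ, ← integral_const_mul]
    congr 1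
    funext k
    rw [fourierStarInv]
    ring
  · have hexp (x : ℝ) : Measurable fun k : ℝ => Complex.exp (-Complex.I * k * x) := by fun_prop
    have h1' (x : ℝ) : Integrable fun k : ℝ => Complex.exp (-Complex.I * k * x) *
        mittagLeffler α α (-totalSymbol μ γ θ k * ((t ^ α : ℝ) : ℂ)) :=
      h1.bdd_mul (hexp x).aestronglyMeasurable
        (Eventually.of_forall fun k => (norm_exp_neg_I_mul_mul x k).le)
    have h2' (x : ℝ) : IntegrableOn (fun p : ℝ × ℝ => ((p.1 ^ (α - 1) : ℝ) : ℂ) *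
        (mittagLeffler α α (-totalSymbol μ γ θ p.2 * ((p.1 ^ α : ℝ) : ℂ)) *
          Complex.exp (-Complex.I * p.2 * x) *
          fourierStar (fun x => φ x (t - p.1)) p.2)) (Ioc 0 t ×ˢ univ) := by
      refine (Integrable.bdd_mul (c := 1) h2 ((hexp x).comp measurable_snd).aestronglyMeasurable
        (Eventually.of_forall fun p => (norm_exp_neg_I_mul_mul x p.2).le)).congr
        (Eventually.of_forall fun p => ?_)
      simp only [Function.comp_apply]
      ring
    have hL : Integrable fun k => solutionStar α (totalSymbol μ γ θ) φ k t := by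
      have h := (integral_mul_solutionStar ht (h1' 0) (h2' 0)).1
      simpa using h
    refine ⟨fourierStarInv fun k => solutionStar α (totalSymbol μ γ θ) φ k t, fun x => ?_,
      continuous_fourierStarInv hL, tendsto_fourierStarInv_cocompact _, fun ψ => ?_⟩
    · rw [← (integral_mul_solutionStar ht (h1' x) (h2' x)).2, fourierStarInv]
      simp only [mul_right_comm _ (x : ℂ)]
    · rw [hNψ ψ, integral_fourierStarInv_mul hL ψ.integrable]
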